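/- **Setting.** Let $G$ be a connected, simply connected nilpotent Lie group of dimension $d$ with Lie algebra $\mathfrak g$, and let $\Gamma<G$ be a discrete cocompact subgroup. A basis $\mathcal X=\{X_1,\dots,X_d\}$ of $\mathfrak g$ is a *Mal'cev basis* for $G/\Gamma$ if (i) $\mathrm{span}(X_{j+1},\dots,X_d)$ is an ideal of $\mathfrak g$ for every $0\le j\le d$; (ii) every $g\in G$ can be written uniquely as $g=\exp(t_1X_1)\cdots\exp(t_dX_d)$ with $\kappa(g):=(t_1,\dots,t_d)\in\mathbb R^d$; (iii) $\Gamma=\{g:\kappa(g)\in\mathbb Z^d\}$. It is *$Q$-rational* if all structure constants $c_{ijk}$ in $[X_i,X_j]=\sum_k c_{ijk}X_k$ are rationals whose numerator and denominator in lowest terms are at most $Q$ in absolute value. Write $|\cdot|$ for the maximum norm on $\mathbb R^d$. Let $d_{\mathcal X}$ be the largest metric on $G$ with $d_{\mathcal X}(x,y)\le|\kappa(xy^{-1})|$ for all $x,y$, that is $$d_{\mathcal X}(x,y)=\inf_{x=x_0,x_1,\dots,x_n=y}\ \sum_{i=0}^{n-1}\min\big(|\kappa(x_ix_{i+1}^{-1})|,|\kappa(x_{i+1}x_i^{-1})|\big),$$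 and let $d_{\mathcal X}(x\Gamma,y\Gamma)=\inf\{d_{\mathcal X}(x',y'):x'\in x\Gamma,\ y'\in y\Gamma\}$ on $G/\Gamma$. For $F:G/\Gamma\to\mathbb C$ put $$\|F\|_{\mathrm{Lip}}=\|F\|_\infty+\sup_{x\ne y}\frac{|F(x)-F(y)|}{d_{\mathcal X}(x,y)},$$ and call $F$ *Lipschitz* if this is finite. For smooth $\varphi:G/\Gamma\to\mathbb C$ put $$\|\varphi\|_{W^m,\mathcal X}=\sup_{0\le k\le m}\ \sup_{1\le i_1,\dots,i_k\le d}\|D_{X_{i_1}}\cdots D_{X_{i_k}}\varphi\|_\infty,\qquad D_X\varphi(g\Gamma)=\tfrac{\mathrm d}{\mathrm dt}\Big|_{t=0}\varphi(\exp(tX)g\Gamma).$$ Let $\mathcal D=\{g\in G:\kappa(g)\in[-\tfrac12,\tfrac12)^d\}$, a fundamental domain for $G/\Gamma$, and let $\mathrm dh$ be the Haar measure on $G$ restricted to $\mathcal D$ and normalised to have total mass $1$. For $F:G/\Gamma\to\mathbb C$ and $\psi:G/\Gamma\to\mathbb R$, identifying $G/\Gamma$ with $\mathcal D$, put $\int_{G/\Gamma}\psi=\int_{\mathcal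 D}\psi(h\Gamma)\,\mathrm dh$ and $$(F*\psi)(x)=\int_{\mathcal D}\psi(h\Gamma)\,F(h^{-1}x)\,\mathrm dh\qquad(x\in G/\Gamma).$$ **Lemma.** For every $d\ge 0$ there are constants $c\in(0,1)$, $C>0$ and $K\in\mathbb N$, depending only on $d$, such that the following holds for every $G$ of dimension $d$ and every $\Gamma$ as above, every $Q\ge 1$ and every $Q$-rational Mal'cev basis $\mathcal X$ for $G/\Gamma$. For every Lipschitz function $F:G/\Gamma\to\mathbb C$, every integer $m\ge1$ and every $\varepsilon\in(0,c)$ there is a non-negative function $\psi_m\in C^\infty(G/\Gamma)$ with $\int_{G/\Gamma}\psi_m=1$, vanishing outside $\{g\Gamma:|\kappa(g)|<\min(\varepsilon,\tfrac12)\}$, such that $F*\psi_m\in C^\infty(G/\Gamma)$, $$\|F-F*\psi_m\|_\infty\le\varepsilon\,(1+\|F\|_{\mathrm{Lip}})$$ and $$\|F*\psi_m\|_{W^m,\mathcal X}\le C\,(m/\varepsilon)^{2m}\,Q^{Km}\,\|F\|_\infty .$$ In particular the last bound is $\ll_d (m/\varepsilon)^{2m}Q^{O_d(m)}$ when $\|F\|_\infty\le1$.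 -/

import Mathlib

open MeasureTheory Set
open scoped Manifold ContDiff ENNReal

noncomputable section

namespace Nil

universe u

section LieGroup

variable {d : ℕ} {G : Type u} [Group G] [TopologicalSpace G]
  [ChartedSpace (EuclideanSpace ℝ (Fin d)) G]

/-- The exponential map of a Lie group: `exp v = γ 1`, where `γ` is the (unique) integral curve of
the left-invariant vector field of `v` with `γ 0 = 1`, that is, the one-parameter subgroup with
initial velocity `v`. -/
def lieExp (v : GroupLieAlgebra (𝓡 d) G) : G :=
  open Classical in
  if h : ∃ γ : ℝ → G, γ 0 = 1 ∧ IsMIntegralCurve (I := 𝓡 d) γ (mulInvariantVectorField v)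
  then h.choose 1 else 1

/-- The ordered product `exp (t₁ X₁) ⋯ exp (t_d X_d)`. -/
def expProd (X : Module.Basis (Fin d) ℝ (GroupLieAlgebra (𝓡 d) G)) (t : Fin d → ℝ) : G :=
  (List.ofFn fun i => lieExp (t i • X i)).prod

/-- `X` is a Mal'cev basis for `G/Γ`: every tail `span (X_{j+1}, …, X_d)` is an ideal, every group
element is uniquely of the form `exp (t₁ X₁) ⋯ exp (t_d X_d)`, and `Γ` consists of those elements
with all `tᵢ` integers.  (Being adapted to a given filtration is the further requirement that the
groups of the filtration occur among the `exp (span (X_{j+1}, …, X_d))`; it is not imposed.) -/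
structure IsMalcevBasis (Γ : Subgroup G)
    (X : Module.Basis (Fin d) ℝ (GroupLieAlgebra (𝓡 d) G)) : Prop where
  ideal : ∀ j : ℕ, ∀ v : GroupLieAlgebra (𝓡 d) G,
    ∀ w ∈ Submodule.span ℝ (X '' {i : Fin d | j ≤ (i : ℕ)}),
      ⁅v, w⁆ ∈ Submodule.span ℝ (X '' {i : Fin d | j ≤ (i : ℕ)})
  existsUnique_coord : ∀ g : G, ∃! t : Fin d → ℝ, expProd X t = g
  mem_lattice_iff : ∀ t : Fin d → ℝ, expProd X t ∈ Γ ↔ ∀ i, ∃ n : ℤ, t i = n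

/-- `X` is `Q`-rational: all structure constants are rationals of height at most `Q`. -/
def IsRationalBasis (Q : ℝ) (X : Module.Basis (Fin d) ℝ (GroupLieAlgebra (𝓡 d) G)) : Prop :=
  ∃ q : Fin d → Fin d → Fin d → ℚ,
    (∀ i j, ⁅X i, X j⁆ = ∑ k, (q i j k : ℝ) • X k) ∧
    ∀ i j k, ((q i j k).num.natAbs : ℝ) ≤ Q ∧ ((q i j k).den : ℝ) ≤ Q

/-- Mal'cev coordinates (of the second kind): the inverse of `expProd X`. -/
def coords (X : Module.Basis (Fin d) ℝ (GroupLieAlgebra (𝓡 d) G)) : G → Fin d → ℝ :=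
  Function.invFun (expProd X)

/-- The largest (pseudo)metric on `G` with `d(x, y) ≤ |coords (x y⁻¹)|` (sup norm): the infimum
over chains `x = c₀, …, cₙ = y`. -/
def groupDist (X : Module.Basis (Fin d) ℝ (GroupLieAlgebra (𝓡 d) G)) (x y : G) : ℝ≥0∞ :=
  ⨅ (n : ℕ) (c : ℕ → G) (_ : c 0 = x) (_ : c n = y),
    ∑ i ∈ Finset.range n,
      min ‖coords X (c i * (c (i + 1))⁻¹)‖ₑ ‖coords X (c (i + 1) * (c i)⁻¹)‖ₑ

variable {Γ : Subgroup G}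

/-- The metric induced on `G/Γ`. -/
def quotDist (X : Module.Basis (Fin d) ℝ (GroupLieAlgebra (𝓡 d) G)) (x y : G ⧸ Γ) : ℝ≥0∞ :=
  ⨅ (g : G) (h : G) (_ : (g : G ⧸ Γ) = x) (_ : (h : G ⧸ Γ) = y), groupDist X g h

/-- The supremum norm, as an extended nonnegative real. -/
def supNorm {α : Type*} (F : α → ℂ) : ℝ≥0∞ := ⨆ x, ‖F x‖ₑ

/-- The Lipschitz norm of a function on `G/Γ`; `F` is Lipschitz when this is finite.
(The diagonal contributes `0 / 0 = 0`.) -/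
def lipNorm (X : Module.Basis (Fin d) ℝ (GroupLieAlgebra (𝓡 d) G)) (F : G ⧸ Γ → ℂ) : ℝ≥0∞ :=
  supNorm F + ⨆ (x : G ⧸ Γ) (y : G ⧸ Γ), ‖F x - F y‖ₑ / quotDist X x y

/-- Smooth functions on `G/Γ` are those whose lift to `G` is smooth (for discrete `Γ`, the
projection is a local diffeomorphism). -/
def IsSmooth (d : ℕ) {G : Type u} [Group G] [TopologicalSpace G]
    [ChartedSpace (EuclideanSpace ℝ (Fin d)) G] {Γ : Subgroup G}
    {V : Type*} [NormedAddCommGroup V] [NormedSpace ℝ V] (φ : G ⧸ Γ → V) : Prop :=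
  ContMDiff (𝓡 d) 𝓘(ℝ, V) ∞ fun g : G => φ (g : G ⧸ Γ)

/-- `D_v φ (gΓ) = d/dt φ (exp(t v) g Γ)` at `t = 0`. -/
def lieDeriv (v : GroupLieAlgebra (𝓡 d) G) (φ : G ⧸ Γ → ℂ) (x : G ⧸ Γ) : ℂ :=
  deriv (fun t : ℝ => φ (lieExp (t • v) • x)) 0

/-- The Sobolev norm `‖φ‖_{W^m, X}`: the supremum of `‖D_{X_{i₁}} ⋯ D_{X_{i_k}} φ‖_∞` over all
`k ≤ m` (including `k = 0`) and all indices `i₁, …, i_k`. -/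
def sobolevNorm (X : Module.Basis (Fin d) ℝ (GroupLieAlgebra (𝓡 d) G)) (m : ℕ)
    (φ : G ⧸ Γ → ℂ) : ℝ≥0∞ :=
  ⨆ (l : List (Fin d)) (_ : l.length ≤ m), supNorm (l.foldr (fun i f => lieDeriv (X i) f) φ)

/-- The fundamental domain of `G/Γ` of all `g` with Mal'cev coordinates in `[-1/2, 1/2)`. -/
def fundDomain (X : Module.Basis (Fin d) ℝ (GroupLieAlgebra (𝓡 d) G)) : Set G :=
  {g | ∀ i, coords X g i ∈ Ico (-(1 / 2) : ℝ) (1 / 2)}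

/-- The measure obtained from a Haar measure `μ` on `G` by restricting to the fundamental domain
and normalising to total mass one.  Under the identification of `G/Γ` with the fundamental domain
it is the invariant probability measure of `G/Γ`. -/
def nilMeasure [MeasurableSpace G] (X : Module.Basis (Fin d) ℝ (GroupLieAlgebra (𝓡 d) G))
    (μ : Measure G) : Measure G :=
  ProbabilityTheory.cond μ (fundDomain X)

/-- The convolution `F * ψ` on `G/Γ`: the function `x ↦ ∫ ψ(y) F(y⁻¹ x) dy` over `y ∈ G/Γ`, where
`G/Γ` is identified with the fundamental domain so that `y⁻¹` acts on `G/Γ`. -/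
def conv [MeasurableSpace G] (X : Module.Basis (Fin d) ℝ (GroupLieAlgebra (𝓡 d) G))
    (μ : Measure G) (F : G ⧸ Γ → ℂ) (ψ : G ⧸ Γ → ℝ) (x : G ⧸ Γ) : ℂ :=
  ∫ h, ψ (h : G ⧸ Γ) • F (h⁻¹ • x) ∂(nilMeasure X μ)

end LieGroup

end Nil

end

open Filter Topology

noncomputable section

namespace Nil

universe u

/-! ### One-parameter subgroups -/

section LieTheory

variable {d : ℕ} {G : Type u} [Group G] [TopologicalSpace G]
  [ChartedSpace (EuclideanSpace ℝ (Fin d)) G] [LieGroup (𝓡 d) ∞ G]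

/-! Convolve with a bump and let every derivative fall on the bump.

Since `ad X_i` is nilpotent and preserves the flag of tails, it is strictly lower triangular in the
basis `X` (`isStrictLower_adMat`), so exp(t ad X_i) is a polynomial in t. Increasing t_j in exp(t_1
X_1)⋯exp(t_d X_d) amounts to a left multiplication by a one-parameter subgroup whose direction is
Ad(exp(t_1 X_1)⋯exp(t_{j-1} X_{j-1})) X_j (`expProd_add_single`). Hence, in Mal'cev coordinates, the
right-invariant vector field of X_i is column i of `invFrame`, the inverse of a unipotent matrix,
and is polynomial in t and in the structure constants.

This has two consequences. Left translations have Jacobian 1 in coordinates, so Lebesgue measure is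
Haar measure (`isHaarMeasure_map_expProd`), the unit box has mass 1, and for a bump φ on the ball of
radius ε/2, carried to G/Γ, the convolution is ∫ φ(t) F(E(t)⁻¹ g) dt with E = `expProd X`
(`conv_descend`). Moreover, on the unit ball the order-n partial derivatives of the frame are at
most O_d(Q^{d³}) d^{3n} (`derivBound_invFrame`).

Approximation: d(gΓ, h⁻¹gΓ) ≤ |κ(h)|, so averaging over |κ(h)| ≤ ε/2 moves F by at most ε times its
Lipschitz norm.

Derivatives: substituting h → gh turns the integral into ∫ φ(κ(g E(t))) F(E(t)⁻¹) dt
(`groupConv_eq`). This is smooth in g although F is only continuous, and D_{X_i} acts on φ as the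
right-invariant field of X_i (`hasDerivAt_groupConv`). The bump is an m-fold average over windows of
length comparable to ε/m, so its derivatives of order n ≤ m are at most (C/ε)^d (4dm/ε)^n
(`exists_box_bump`). Up to m frame derivatives then cost a factor (C₁ (m/ε) Q^{d³})^m
(`foldr_frameDeriv_bound`). The volume ε^d of the ball cancels ε^{-d}, and ε ≤ 1/C₁ gives C₁ ≤ m/ε,
whence the exponent 2m. -/

instance isManifold_one : IsManifold (𝓡 d) 1 G :=
  IsManifold.of_le (n := ∞) (by norm_cast)

theorem mdifferentiableAt_mul_left' (g h : G) :
    MDifferentiableAt (𝓡 d) (𝓡 d) (fun x : G => g * x) h :=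
  (contMDiff_mul_left (I := 𝓡 d) (n := ∞)).mdifferentiableAt (by simp)

theorem mdifferentiableAt_mul_right' (g h : G) :
    MDifferentiableAt (𝓡 d) (𝓡 d) (fun x : G => x * g) h :=
  (contMDiff_mul_right (I := 𝓡 d) (n := ∞)).mdifferentiableAt (by simp)

theorem contMDiff_one_mulInvariantVectorField (v : GroupLieAlgebra (𝓡 d) G) :
    ContMDiff (𝓡 d) (𝓡 d).tangent 1
      (fun g : G => (⟨g, mulInvariantVectorField v g⟩ : TangentBundle (𝓡 d) G)) := by
  have : LieGroup (𝓡 d) (minSmoothness ℝ 3) G :=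
    LieGroup.of_le (n := ∞) (by simp; norm_cast)
  exact (contMDiff_mulInvariantVectorField v).of_le (by simp)

theorem mfderiv_mul_left_mulInvariantVectorField (v : GroupLieAlgebra (𝓡 d) G) (g h : G) :
    mfderiv (𝓡 d) (𝓡 d) (fun x : G => g * x) h (mulInvariantVectorField v h) =
      mulInvariantVectorField v (g * h) := by
  unfold mulInvariantVectorField
  have e : (fun x : G => g * h * x) = (fun x : G => g * x) ∘ (fun x : G => h * x) := by
    ext x; simp [mul_assoc]
  rw [e, mfderiv_comp (I' := 𝓡 d) 1 (mdifferentiableAt_mul_left' _ _)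
    (mdifferentiableAt_mul_left' _ _)]
  change _ = mfderiv (𝓡 d) (𝓡 d) (fun x : G => g * x) (h * 1) (mfderiv (𝓡 d) (𝓡 d) (fun x : G => h * x) 1 v)
  rw [mul_one]

theorem IsMIntegralCurveOn.mul_left {v : GroupLieAlgebra (𝓡 d) G} {γ : ℝ → G} {s : Set ℝ}
    (h : IsMIntegralCurveOn (I := 𝓡 d) γ (mulInvariantVectorField v) s) (g : G) :
    IsMIntegralCurveOn (I := 𝓡 d) (fun t => g * γ t) (mulInvariantVectorField v) s := by
  intro t ht
  have := (mdifferentiableAt_mul_left' (d := d) g (γ t)).hasMFDerivAt.comp_hasMFDerivWithinAt t (h t ht)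
  refine this.congr_mfderiv ?_
  ext
  change mfderiv (𝓡 d) (𝓡 d) (fun x : G => g * x) (γ t) ((1 : ℝ) • mulInvariantVectorField v (γ t)) =
    (1 : ℝ) • mulInvariantVectorField v (g * γ t)
  rw [one_smul, one_smul, mfderiv_mul_left_mulInvariantVectorField]

theorem IsMIntegralCurve.mul_left {v : GroupLieAlgebra (𝓡 d) G} {γ : ℝ → G}
    (h : IsMIntegralCurve (I := 𝓡 d) γ (mulInvariantVectorField v)) (g : G) :
    IsMIntegralCurve (I := 𝓡 d) (fun t => g * γ t) (mulInvariantVectorField v) := by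
  rw [isMIntegralCurve_iff_isMIntegralCurveOn] at *
  exact IsMIntegralCurveOn.mul_left h g

variable [T2Space G]

/-- Completeness: a curve through 1 exists on some (-ε, ε), and its left translates start at every
point with the same lifetime, so the uniform time lemma extends it to all of ℝ. -/
theorem exists_isMIntegralCurve (v : GroupLieAlgebra (𝓡 d) G) :
    ∃ γ : ℝ → G, γ 0 = 1 ∧ IsMIntegralCurve (I := 𝓡 d) γ (mulInvariantVectorField v) := by
  obtain ⟨γ, h0, h⟩ := exists_isMIntegralCurveAt_of_contMDiffAt_boundaryless (I := 𝓡 d) (M := G)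
    (x₀ := (1 : G)) 0 (contMDiff_one_mulInvariantVectorField v).contMDiffAt
  obtain ⟨ε, hε, h⟩ := isMIntegralCurveAt_iff'.1 h
  refine exists_isMIntegralCurve_of_isMIntegralCurveOn
    (contMDiff_one_mulInvariantVectorField v) hε (fun x => ⟨fun t => x * γ t, by simp [h0], ?_⟩) 1
  have := IsMIntegralCurveOn.mul_left h x
  rwa [Real.ball_eq_Ioo, zero_sub, zero_add] at this

theorem isMIntegralCurve_unique {v : GroupLieAlgebra (𝓡 d) G} {γ γ' : ℝ → G}
    (h : IsMIntegralCurve (I := 𝓡 d) γ (mulInvariantVectorField v))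
    (h' : IsMIntegralCurve (I := 𝓡 d) γ' (mulInvariantVectorField v)) (h0 : γ 0 = γ' 0) : γ = γ' :=
  isMIntegralCurve_Ioo_eq_of_contMDiff_boundaryless
    (contMDiff_one_mulInvariantVectorField v) h h' h0

/-- Uniqueness makes the choice in `lieExp` irrelevant, and rescaling time by t turns a curve for v
into one for t • v. -/
theorem lieExp_eq_of_isMIntegralCurve {v : GroupLieAlgebra (𝓡 d) G} {γ : ℝ → G}
    (h : IsMIntegralCurve (I := 𝓡 d) γ (mulInvariantVectorField v)) (h0 : γ 0 = 1) (t : ℝ) :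
    lieExp (t • v) = γ t := by
  have hc : IsMIntegralCurve (I := 𝓡 d) (γ ∘ (· * t)) (mulInvariantVectorField (t • v)) := by
    have := h.comp_mul t
    rwa [mulInvariantVectorField_smul]
  have hex : ∃ γ : ℝ → G, γ 0 = 1 ∧
    IsMIntegralCurve (I := 𝓡 d) γ (mulInvariantVectorField (t • v)) := ⟨_, by simp [h0], hc⟩
  rw [lieExp, dif_pos hex]
  have := isMIntegralCurve_unique hex.choose_spec.2 hc (by simp [h0, hex.choose_spec.1])
  rw [this]; simp

theorem isMIntegralCurve_lieExp (v : GroupLieAlgebra (𝓡 d) G) :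
    IsMIntegralCurve (I := 𝓡 d) (fun t : ℝ => lieExp (t • v)) (mulInvariantVectorField v) := by
  obtain ⟨γ, h0, h⟩ := exists_isMIntegralCurve v
  rwa [funext (lieExp_eq_of_isMIntegralCurve h h0)]

theorem lieExp_zero : lieExp (0 : GroupLieAlgebra (𝓡 d) G) = 1 := by
  obtain ⟨γ, h0, h⟩ := exists_isMIntegralCurve (0 : GroupLieAlgebra (𝓡 d) G)
  have := lieExp_eq_of_isMIntegralCurve h h0 0
  rwa [zero_smul, h0] at this

/-- As functions of t, both sides are integral curves of the field of v with the same value at t =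
0. -/
theorem lieExp_add_smul (s t : ℝ) (v : GroupLieAlgebra (𝓡 d) G) :
    lieExp ((s + t) • v) = lieExp (s • v) * lieExp (t • v) := by
  have h1 := (isMIntegralCurve_lieExp v).comp_add s
  have h2 := IsMIntegralCurve.mul_left (isMIntegralCurve_lieExp v) (lieExp (s • v))
  have := congrFun (isMIntegralCurve_unique h1 h2 (by simp [lieExp_zero])) t
  simpa [add_comm] using this

theorem lieExp_neg_smul (t : ℝ) (v : GroupLieAlgebra (𝓡 d) G) :
    lieExp ((-t) • v) = (lieExp (t • v))⁻¹ := by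
  rw [eq_inv_iff_mul_eq_one, ← lieExp_add_smul]; simp [lieExp_zero]

theorem hasMFDerivAt_lieExp_zero (v : GroupLieAlgebra (𝓡 d) G) :
    HasMFDerivAt 𝓘(ℝ, ℝ) (𝓡 d) (fun t : ℝ => lieExp (t • v)) 0
      ((1 : ℝ →L[ℝ] ℝ).smulRight (mulInvariantVectorField v (lieExp ((0 : ℝ) • v)))) :=
  isMIntegralCurve_lieExp v 0

end LieTheory

/-! ### The multiplication in the chart at the identity -/

section LieTheory

variable {d : ℕ} {G : Type u} [Group G] [TopologicalSpace G]
  [ChartedSpace (EuclideanSpace ℝ (Fin d)) G]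

theorem mulInvariantVectorField_one (v : GroupLieAlgebra (𝓡 d) G) :
    mulInvariantVectorField v (1 : G) = v := by
  have h : (fun x : G => 1 * x) = id := by ext x; simp
  change mfderiv (𝓡 d) (𝓡 d) (fun x : G => 1 * x) 1 v = v
  rw [h, mfderiv_id]; rfl

/-- The derivative at `g` of a vector-valued function, as a map on the model space. -/
def tderiv {E : Type*} [NormedAddCommGroup E] [NormedSpace ℝ E] (F : G → E) (g : G) :
    EuclideanSpace ℝ (Fin d) →L[ℝ] E :=
  mfderiv (𝓡 d) 𝓘(ℝ, E) F g

variable [LieGroup (𝓡 d) ∞ G]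

/-- The group multiplication in the chart at the identity. -/
def mulChart (d : ℕ) (G : Type u) [Group G] [TopologicalSpace G]
    [ChartedSpace (EuclideanSpace ℝ (Fin d)) G]
    (p : EuclideanSpace ℝ (Fin d) × EuclideanSpace ℝ (Fin d)) : EuclideanSpace ℝ (Fin d) :=
  extChartAt (𝓡 d) (1 : G)
    ((extChartAt (𝓡 d) (1 : G)).symm p.1 * (extChartAt (𝓡 d) (1 : G)).symm p.2)

theorem contDiffAt_mulChart {y z : EuclideanSpace ℝ (Fin d)}
    (hy : y ∈ (extChartAt (𝓡 d) (1 : G)).target) (hz : z ∈ (extChartAt (𝓡 d) (1 : G)).target)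
    (h : (extChartAt (𝓡 d) (1 : G)).symm y * (extChartAt (𝓡 d) (1 : G)).symm z ∈
      (extChartAt (𝓡 d) (1 : G)).source) : ContDiffAt ℝ ∞ (mulChart d G) (y, z) := by
  rw [← contMDiffAt_iff_contDiffAt]
  have hs : ∀ w ∈ (extChartAt (𝓡 d) (1 : G)).target,
      ContMDiffAt 𝓘(ℝ, EuclideanSpace ℝ (Fin d)) (𝓡 d) ∞ (extChartAt (𝓡 d) (1 : G)).symm w :=
    fun w hw => (contMDiffOn_extChartAt_symm (I := 𝓡 d) (n := ∞) (1 : G)).contMDiffAt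
      ((isOpen_extChartAt_target (I := 𝓡 d) (1 : G)).mem_nhds hw)
  have h1 : ContMDiffAt 𝓘(ℝ, EuclideanSpace ℝ (Fin d) × EuclideanSpace ℝ (Fin d))
      (𝓡 d) ∞ (fun p : EuclideanSpace ℝ (Fin d) × EuclideanSpace ℝ (Fin d) =>
        (extChartAt (𝓡 d) (1 : G)).symm p.1 * (extChartAt (𝓡 d) (1 : G)).symm p.2) (y, z) :=
    ((hs y hy).comp (y, z) contDiff_fst.contMDiff.contMDiffAt).mul ((hs z hz).comp (y, z) contDiff_snd.contMDiff.contMDiffAt)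
  exact (contMDiffAt_extChartAt' (by simpa using h)).comp (y, z) h1

theorem eventually_contDiffAt_mulChart :
    ∀ᶠ p in 𝓝 (extChartAt (𝓡 d) (1 : G) 1, extChartAt (𝓡 d) (1 : G) 1),
      ContDiffAt ℝ ∞ (mulChart d G) p := by
  set a := extChartAt (𝓡 d) (1 : G) 1
  have ht : (extChartAt (𝓡 d) (1 : G)).target ∈ 𝓝 a := extChartAt_target_mem_nhds _
  have hc : ContinuousAt (extChartAt (𝓡 d) (1 : G)).symm a := continuousAt_extChartAt_symm _
  have ha : (extChartAt (𝓡 d) (1 : G)).symm a = 1 := extChartAt_to_inv _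
  have : IsTopologicalGroup G := topologicalGroup_of_lieGroup (𝓡 d) ∞
  have hm : ContinuousAt (fun p : EuclideanSpace ℝ (Fin d) × EuclideanSpace ℝ (Fin d) =>
        (extChartAt (𝓡 d) (1 : G)).symm p.1 * (extChartAt (𝓡 d) (1 : G)).symm p.2) (a, a) :=
    ContinuousAt.mul (hc.comp (f := Prod.fst) continuousAt_fst)
      (hc.comp (f := Prod.snd) (x := (a, a)) continuousAt_snd)
  filter_upwards [hm.preimage_mem_nhds (t := (extChartAt (𝓡 d) (1 : G)).source)
    (by simp only [ha, mul_one]; exact extChartAt_source_mem_nhds _), prod_mem_nhds ht ht]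
    with p h1 h2
  exact contDiffAt_mulChart h2.1 h2.2 h1

/-- The base point g is a separate variable tied to c t by an equation, so that `lieExp (0 • v) = 1`
can be substituted without transporting vectors between tangent spaces. -/
theorem HasMFDerivAt.hasDerivAt_of_curve {M : Type*} [TopologicalSpace M]
    [ChartedSpace (EuclideanSpace ℝ (Fin d)) M] {E : Type*} [NormedAddCommGroup E] [NormedSpace ℝ E]
    {F : M → E} {c : ℝ → M} {t : ℝ} {g : M} {w : TangentSpace (𝓡 d) (c t)}
    (hF : MDifferentiableAt (𝓡 d) 𝓘(ℝ, E) F (c t)) (hg : c t = g)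
    (hc : HasMFDerivAt 𝓘(ℝ, ℝ) (𝓡 d) c t ((1 : ℝ →L[ℝ] ℝ).smulRight w)) :
    HasDerivAt (fun t => F (c t)) (tderiv F g w) t := by
  subst hg
  have := hF.hasMFDerivAt.comp t hc
  rw [hasMFDerivAt_iff_hasFDerivAt] at this
  have h2 : HasFDerivAt (F ∘ c) ((tderiv F (c t)).comp
    ((1 : ℝ →L[ℝ] ℝ).smulRight (show EuclideanSpace ℝ (Fin d) from w))) t := this
  refine h2.hasDerivAt.congr_deriv ?_
  exact congrArg (tderiv F (c t)) (one_smul ℝ (show EuclideanSpace ℝ (Fin d) from w))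

variable [T2Space G]

/-- The derivative along a one-parameter subgroup at the identity. -/
theorem hasDerivAt_comp_lieExp {E : Type*} [NormedAddCommGroup E] [NormedSpace ℝ E]
    {F : G → E} (hF : MDifferentiableAt (𝓡 d) 𝓘(ℝ, E) F 1) (v : GroupLieAlgebra (𝓡 d) G) :
    HasDerivAt (fun t : ℝ => F (lieExp (t • v)))
      (tderiv F 1 v) 0 := by
  have h0 : lieExp ((0 : ℝ) • v) = (1 : G) := by rw [zero_smul, lieExp_zero]
  have := HasMFDerivAt.hasDerivAt_of_curve (F := F) (by simpa only [h0] using hF) h0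
    (hasMFDerivAt_lieExp_zero v)
  convert! this using 2
  rw [h0, mulInvariantVectorField_one]

end LieTheory

/-! ### Smoothness of one-parameter subgroups -/

section LieTheory

/-- Solutions of smooth autonomous differential equations are smooth. -/
theorem contDiffOn_of_hasDerivAt_comp {V : Type*} [NormedAddCommGroup V] [NormedSpace ℝ V]
    {y : ℝ → V} {W : V → V} {U : Set ℝ} (hU : IsOpen U)
    (hy : ∀ t ∈ U, HasDerivAt y (W (y t)) t) (hW : ∀ t ∈ U, ContDiffAt ℝ ∞ W (y t)) :
    ContDiffOn ℝ ∞ y U := by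
  rw [contDiffOn_infty]
  intro n
  induction n with
  | zero =>
    exact contDiffOn_zero.2 fun t ht => (hy t ht).continuousAt.continuousWithinAt
  | succ n ih =>
    push_cast
    rw [contDiffOn_succ_iff_deriv_of_isOpen hU]
    refine ⟨fun t ht => (hy t ht).differentiableAt.differentiableWithinAt, by simp, ?_⟩
    have h2 : ContDiffOn ℝ n (fun t => W (y t)) U := fun t ht =>
      ((hW t ht).of_le (by norm_cast; exact le_top)).comp_contDiffWithinAt t (ih t ht)
    exact h2.congr fun t ht => (hy t ht).deriv

variable {d : ℕ} {G : Type u} [Group G] [TopologicalSpace G]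
  [ChartedSpace (EuclideanSpace ℝ (Fin d)) G] [LieGroup (𝓡 d) ∞ G]

theorem mdifferentiableAt_chart {g : G} (hg : g ∈ (extChartAt (𝓡 d) (1 : G)).source) :
    MDifferentiableAt (𝓡 d) 𝓘(ℝ, EuclideanSpace ℝ (Fin d)) (extChartAt (𝓡 d) (1 : G)) g :=
  mdifferentiableAt_extChartAt (by simpa using hg)

theorem tderiv_chart_one :
    tderiv (extChartAt (𝓡 d) (1 : G)) (1 : G) =
      ContinuousLinearMap.id ℝ (EuclideanSpace ℝ (Fin d)) :=
  mfderiv_extChartAt_self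

theorem eventually_contDiffAt_fderiv_mulChart (v : EuclideanSpace ℝ (Fin d)) :
    ∀ᶠ y in 𝓝 (extChartAt (𝓡 d) (1 : G) 1),
      ContDiffAt ℝ ∞ (fun y => fderiv ℝ (mulChart d G) (y, extChartAt (𝓡 d) (1 : G) 1) (0, v)) y := by
  set a := extChartAt (𝓡 d) (1 : G) 1
  have h : ∀ᶠ y in 𝓝 a, ContDiffAt ℝ ∞ (mulChart d G) (y, a) :=
    (show ContinuousAt (fun y => (y, a)) a by fun_prop).eventually eventually_contDiffAt_mulChart
  filter_upwards [h] with y hy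
  have h1 : ContDiffAt ℝ ∞ (fderiv ℝ (mulChart d G)) (y, a) := hy.fderiv_right (by simp)
  exact (h1.comp y (by fun_prop : ContDiffAt ℝ ∞ (fun y => (y, a)) y)).clm_apply contDiffAt_const

variable [T2Space G]

theorem continuous_lieExp_smul (v : GroupLieAlgebra (𝓡 d) G) :
    Continuous fun t : ℝ => lieExp (t • v) := (isMIntegralCurve_lieExp v).continuous

theorem hasDerivAt_chart_lieExp_zero (v : GroupLieAlgebra (𝓡 d) G) :
    HasDerivAt (fun t : ℝ => extChartAt (𝓡 d) (1 : G) (lieExp (t • v)))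
      (show EuclideanSpace ℝ (Fin d) from v) 0 := by
  have := hasDerivAt_comp_lieExp (mdifferentiableAt_chart (mem_extChartAt_source (I := 𝓡 d) (1 : G))) v
  rwa [tderiv_chart_one] at this

theorem eventually_lieExp_mem_source (v : GroupLieAlgebra (𝓡 d) G) :
    ∀ᶠ t : ℝ in 𝓝 0, lieExp (t • v) ∈ (extChartAt (𝓡 d) (1 : G)).source := by
  refine (continuous_lieExp_smul v).continuousAt.eventually
    ((isOpen_extChartAt_source (I := 𝓡 d) (1 : G)).mem_nhds ?_)
  simp only [zero_smul, lieExp_zero]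
  exact mem_extChartAt_source _

/-- In the chart at the identity, the vector `fderiv (mulChart d G) (φ g, φ 1) (0, v)` is the
derivative of right multiplication of `g` by a one-parameter subgroup. -/
theorem hasDerivAt_chart_mul_lieExp {g : G} (hg : g ∈ (extChartAt (𝓡 d) (1 : G)).source)
    (v : GroupLieAlgebra (𝓡 d) G) :
    HasDerivAt (fun s : ℝ => extChartAt (𝓡 d) (1 : G) (g * lieExp (s • v)))
      (fderiv ℝ (mulChart d G) (extChartAt (𝓡 d) (1 : G) g, extChartAt (𝓡 d) (1 : G) 1)
        (0, (show EuclideanSpace ℝ (Fin d) from v))) 0 := by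
  set φ := extChartAt (𝓡 d) (1 : G) with hφ
  have hsymm : φ.symm (φ 1) = 1 := extChartAt_to_inv _
  have hΘ : ContDiffAt ℝ ∞ (mulChart d G) (φ g, φ 1) := by
    refine contDiffAt_mulChart (φ.map_source hg) (mem_extChartAt_target _) ?_
    rw [← hφ, φ.left_inv hg, hsymm, mul_one]; exact hg
  have hc : HasDerivAt (fun s : ℝ => (φ g, φ (lieExp (s • v))))
      (0, (show EuclideanSpace ℝ (Fin d) from v)) 0 :=
    (hasDerivAt_const _ _).prodMk (hasDerivAt_chart_lieExp_zero v)
  have h1 := (hΘ.differentiableAt (by simp)).hasFDerivAt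
  have e0 : (φ g, φ (lieExp ((0 : ℝ) • v))) = (φ g, φ 1) := by rw [zero_smul, lieExp_zero]
  rw [← e0] at h1
  have h2 := h1.comp_hasDerivAt (0 : ℝ) hc
  rw [e0] at h2
  refine h2.congr_of_eventuallyEq ?_
  filter_upwards [eventually_lieExp_mem_source v] with s hs
  simp only [Function.comp_apply, mulChart, ← hφ]
  rw [φ.left_inv hg, φ.left_inv hs]

/-- In the chart φ the curve solves an autonomous equation y' = W(y), where W(y) differentiates the
multiplication at (y, φ 1) in its second argument. This W is smooth near φ 1, as
`contDiffOn_of_hasDerivAt_comp` requires. -/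
theorem hasDerivAt_chart_lieExp {v : GroupLieAlgebra (𝓡 d) G} {t : ℝ}
    (ht : lieExp (t • v) ∈ (extChartAt (𝓡 d) (1 : G)).source) :
    HasDerivAt (fun s : ℝ => extChartAt (𝓡 d) (1 : G) (lieExp (s • v)))
      (fderiv ℝ (mulChart d G) (extChartAt (𝓡 d) (1 : G) (lieExp (t • v)),
        extChartAt (𝓡 d) (1 : G) 1) (0, (show EuclideanSpace ℝ (Fin d) from v))) t := by
  have h := hasDerivAt_chart_mul_lieExp ht v
  simp only [← lieExp_add_smul] at h
  rw [← sub_self t] at h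
  have := HasDerivAt.comp_sub_const t t h
  simpa using this

/-- Near t = 0 this is the regularity of the chart equation; the group law translates it to every
other t. -/
theorem contMDiff_lieExp_smul (v : GroupLieAlgebra (𝓡 d) G) :
    ContMDiff 𝓘(ℝ, ℝ) (𝓡 d) ∞ fun t : ℝ => lieExp (t • v) := by
  set φ := extChartAt (𝓡 d) (1 : G) with hφ
  have hcont : ContinuousAt (fun t : ℝ => φ (lieExp (t • v))) 0 :=
    (hasDerivAt_chart_lieExp_zero v).continuousAt
  have hW := eventually_contDiffAt_fderiv_mulChart (G := G) (show EuclideanSpace ℝ (Fin d) from v)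
  have h0 : lieExp ((0 : ℝ) • v) = 1 := by rw [zero_smul, lieExp_zero]
  have hW' := hcont.eventually (by simpa only [h0] using hW)
  obtain ⟨U, hU, hUo, hU0⟩ := eventually_nhds_iff.1 (hW'.and (eventually_lieExp_mem_source v))
  have h1 := contDiffOn_of_hasDerivAt_comp hUo
    (fun t ht => hasDerivAt_chart_lieExp (hU t ht).2) (fun t ht => (hU t ht).1)
  have hz : ContMDiffAt 𝓘(ℝ, ℝ) (𝓡 d) ∞ (fun t : ℝ => lieExp (t • v)) 0 := by
    have h2 : ContMDiffAt 𝓘(ℝ, ℝ) 𝓘(ℝ, EuclideanSpace ℝ (Fin d)) ∞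
        (fun t : ℝ => φ (lieExp (t • v))) 0 :=
      (h1.contDiffAt (hUo.mem_nhds hU0)).contMDiffAt
    have h3 : ContMDiffAt 𝓘(ℝ, EuclideanSpace ℝ (Fin d)) (𝓡 d) ∞ φ.symm
        (φ (lieExp ((0 : ℝ) • v))) :=
      (contMDiffOn_extChartAt_symm (I := 𝓡 d) (n := ∞) (1 : G)).contMDiffAt
        ((isOpen_extChartAt_target (I := 𝓡 d) (1 : G)).mem_nhds (φ.map_source (hU 0 hU0).2))
    refine (h3.comp (0 : ℝ) h2).congr_of_eventuallyEq ?_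
    filter_upwards [hUo.mem_nhds hU0] with t ht
    simp [φ.left_inv (hU t ht).2]
  intro t
  have e : (fun s : ℝ => lieExp (s • v)) = fun s => lieExp (t • v) * lieExp ((s - t) • v) := by
    ext s; rw [← lieExp_add_smul]; simp
  rw [e]
  refine contMDiffAt_const.mul ?_
  have hs : ContMDiffAt 𝓘(ℝ, ℝ) 𝓘(ℝ, ℝ) ∞ (fun s : ℝ => s - t) t :=
    (contDiff_id.sub contDiff_const).contMDiff.contMDiffAt
  rw [← sub_self t] at hz
  exact ContMDiffAt.comp (g := fun s : ℝ => lieExp (s • v)) t hz hs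

end LieTheory

/-! ### The adjoint representation -/

section LieTheory

variable {d : ℕ} {G : Type u} [Group G] [TopologicalSpace G]
  [ChartedSpace (EuclideanSpace ℝ (Fin d)) G]

/-- The adjoint representation, read in the chart at the identity (whose derivative at the identity
is the identity of the model space). -/
def lieAd (g : G) : EuclideanSpace ℝ (Fin d) →L[ℝ] EuclideanSpace ℝ (Fin d) :=
  tderiv (fun x : G => extChartAt (𝓡 d) (1 : G) (g * x * g⁻¹)) 1

variable [LieGroup (𝓡 d) ∞ G]

theorem contMDiff_conj (g : G) : ContMDiff (𝓡 d) (𝓡 d) ∞ (fun x : G => g * x * g⁻¹) :=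
  (contMDiff_const.mul contMDiff_id).mul contMDiff_const

theorem contMDiffAt_chart_conj (g : G) :
    ContMDiffAt (𝓡 d) 𝓘(ℝ, EuclideanSpace ℝ (Fin d)) ∞
      (fun x : G => extChartAt (𝓡 d) (1 : G) (g * x * g⁻¹)) 1 := by
  refine ContMDiffAt.comp (1 : G) (contMDiffAt_extChartAt' ?_) (contMDiff_conj g).contMDiffAt
  simp

theorem lieAd_one : (lieAd (1 : G) : EuclideanSpace ℝ (Fin d) →L[ℝ] _) =
    ContinuousLinearMap.id ℝ _ := by
  simp only [lieAd, one_mul, inv_one, mul_one]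
  exact tderiv_chart_one

variable [T2Space G]

theorem hasDerivAt_chart_conj_lieExp (g : G) (v : GroupLieAlgebra (𝓡 d) G) :
    HasDerivAt (fun t : ℝ => extChartAt (𝓡 d) (1 : G) (g * lieExp (t • v) * g⁻¹)) (lieAd g v) 0 :=
  hasDerivAt_comp_lieExp ((contMDiffAt_chart_conj g).mdifferentiableAt (by simp)) v

theorem eq_of_lieExp_eq {v w : GroupLieAlgebra (𝓡 d) G}
    (h : ∀ t : ℝ, lieExp (t • v) = lieExp (t • w)) : v = w := by
  have h1 := hasDerivAt_chart_lieExp_zero v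
  simp only [h] at h1
  exact h1.unique (hasDerivAt_chart_lieExp_zero w)

/-- A smooth one-parameter subgroup is the exponential of its initial velocity. -/
theorem eq_lieExp_of_add {γ : ℝ → G} (hγ : MDifferentiableAt 𝓘(ℝ, ℝ) (𝓡 d) γ 0)
    (hadd : ∀ s t, γ (s + t) = γ s * γ t) {w : EuclideanSpace ℝ (Fin d)}
    (hw : HasDerivAt (fun t => extChartAt (𝓡 d) (1 : G) (γ t)) w 0) (t : ℝ) :
    γ t = lieExp (t • (show GroupLieAlgebra (𝓡 d) G from w)) := by
  have h0 : γ 0 = 1 := by simpa using hadd 0 0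
  let w' : GroupLieAlgebra (𝓡 d) G :=
    show EuclideanSpace ℝ (Fin d) from (mfderiv 𝓘(ℝ, ℝ) (𝓡 d) γ 0) (1 : ℝ)
  have hd : HasMFDerivAt 𝓘(ℝ, ℝ) (𝓡 d) γ 0
      ((1 : ℝ →L[ℝ] ℝ).smulRight (show TangentSpace (𝓡 d) (γ 0) from w')) := by
    refine hγ.hasMFDerivAt.congr_mfderiv ?_
    ext
    exact (one_smul ℝ (show EuclideanSpace ℝ (Fin d) from w')).symm
  have hint : IsMIntegralCurve (I := 𝓡 d) γ (mulInvariantVectorField w') := by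
    intro s
    have hs : HasMFDerivAt 𝓘(ℝ, ℝ) 𝓘(ℝ, ℝ) (fun t : ℝ => t - s) s (ContinuousLinearMap.id ℝ ℝ) :=
      ((hasFDerivAt_id s).sub_const s).hasMFDerivAt
    have hd' := hd
    rw [← sub_self s] at hd'
    have h1 := HasMFDerivAt.comp (g := γ) (f := fun t : ℝ => t - s) s hd' hs
    have h2 := (mdifferentiableAt_mul_left' (d := d) (γ s) (γ (s - s))).hasMFDerivAt.comp s h1
    have e : γ = (fun x => γ s * x) ∘ γ ∘ (fun t => t - s) := by
      ext t; simp [← hadd]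
    have h3 := h2.congr_of_eventuallyEq (Eventually.of_forall (congrFun e))
    refine h3.congr_mfderiv ?_
    ext
    change (mfderiv (𝓡 d) (𝓡 d) (fun x : G => γ s * x) (γ (s - s)))
      ((1 : ℝ) • (show EuclideanSpace ℝ (Fin d) from w')) =
        (1 : ℝ) • (show EuclideanSpace ℝ (Fin d) from
          mfderiv (𝓡 d) (𝓡 d) (fun x : G => γ s * x) 1 w')
    rw [one_smul, one_smul, sub_self, h0]
  have hww : w = w' := by
    have := HasMFDerivAt.hasDerivAt_of_curve (F := extChartAt (𝓡 d) (1 : G)) (c := γ) (t := 0)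
      (by rw [h0]; exact mdifferentiableAt_chart (mem_extChartAt_source _)) h0 hd
    rw [tderiv_chart_one] at this
    exact hw.unique this
  subst hww
  exact (lieExp_eq_of_isMIntegralCurve hint h0 t).symm

/-- Conjugation is a smooth automorphism, so it carries one-parameter subgroups to one-parameter
subgroups, and these are determined by their velocity at 0. -/
theorem conj_lieExp (g : G) (t : ℝ) (v : GroupLieAlgebra (𝓡 d) G) :
    g * lieExp (t • v) * g⁻¹ =
      lieExp (t • (show GroupLieAlgebra (𝓡 d) G from lieAd g v)) := by
  refine eq_lieExp_of_add (γ := fun t => g * lieExp (t • v) * g⁻¹) ?_ (fun s t => ?_)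
    (hasDerivAt_chart_conj_lieExp g v) t
  · exact ((contMDiff_conj g).comp (contMDiff_lieExp_smul v)).mdifferentiableAt (by simp)
  · simp [lieExp_add_smul, mul_assoc]

theorem lieAd_mul (g h : G) : (lieAd (g * h) : EuclideanSpace ℝ (Fin d) →L[ℝ] _) =
    (lieAd g).comp (lieAd h) := by
  ext1 v
  refine eq_of_lieExp_eq (G := G) fun t => ?_
  have h1 := conj_lieExp (g * h) t (show GroupLieAlgebra (𝓡 d) G from v)
  have h2 := conj_lieExp h t (show GroupLieAlgebra (𝓡 d) G from v)
  have h3 := conj_lieExp g t (show GroupLieAlgebra (𝓡 d) G from lieAd h v)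
  refine h1.symm.trans (Eq.trans ?_ h3)
  rw [← h2]; simp [mul_assoc]

end LieTheory

/-! ### The bracket as the derivative of the adjoint representation -/

section LieTheory
open VectorField

variable {d : ℕ} {G : Type u} [Group G] [TopologicalSpace G]
  [ChartedSpace (EuclideanSpace ℝ (Fin d)) G] 

/-- The Lie bracket on the model space. -/
def lieBr (G : Type u) [Group G] [TopologicalSpace G] [ChartedSpace (EuclideanSpace ℝ (Fin d)) G]
    (v w : EuclideanSpace ℝ (Fin d)) : EuclideanSpace ℝ (Fin d) :=
  show GroupLieAlgebra (𝓡 d) G from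
    ⁅(show GroupLieAlgebra (𝓡 d) G from v), (show GroupLieAlgebra (𝓡 d) G from w)⁆

variable [LieGroup (𝓡 d) ∞ G]

theorem hasFDerivAt_fderiv_mulChart :
    HasFDerivAt (fderiv ℝ (mulChart d G))
      (fderiv ℝ (fderiv ℝ (mulChart d G)) (extChartAt (𝓡 d) (1 : G) 1, extChartAt (𝓡 d) (1 : G) 1))
      (extChartAt (𝓡 d) (1 : G) 1, extChartAt (𝓡 d) (1 : G) 1) := by
  have h : ContDiffAt ℝ ∞ (mulChart d G)
    (extChartAt (𝓡 d) (1 : G) 1, extChartAt (𝓡 d) (1 : G) 1) :=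
    eventually_contDiffAt_mulChart.self_of_nhds
  have h1 : ContDiffAt ℝ ∞ (fderiv ℝ (mulChart d G)) _ := h.fderiv_right (by simp)
  exact (h1.differentiableAt (by simp)).hasFDerivAt

variable [T2Space G]

theorem hasDerivAt_chart_lieExp_mul {g : G} (hg : g ∈ (extChartAt (𝓡 d) (1 : G)).source)
    (v : GroupLieAlgebra (𝓡 d) G) :
    HasDerivAt (fun s : ℝ => extChartAt (𝓡 d) (1 : G) (lieExp (s • v) * g))
      (fderiv ℝ (mulChart d G) (extChartAt (𝓡 d) (1 : G) 1, extChartAt (𝓡 d) (1 : G) g)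
        ((show EuclideanSpace ℝ (Fin d) from v), 0)) 0 := by
  set φ := extChartAt (𝓡 d) (1 : G) with hφ
  have hsymm : φ.symm (φ 1) = 1 := extChartAt_to_inv _
  have hΘ : ContDiffAt ℝ ∞ (mulChart d G) (φ 1, φ g) := by
    refine contDiffAt_mulChart (mem_extChartAt_target _) (φ.map_source hg) ?_
    rw [← hφ, φ.left_inv hg, hsymm, one_mul]; exact hg
  have hc : HasDerivAt (fun s : ℝ => (φ (lieExp (s • v)), φ g))
      ((show EuclideanSpace ℝ (Fin d) from v), 0) 0 :=
    (hasDerivAt_chart_lieExp_zero v).prodMk (hasDerivAt_const _ _)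
  have h1 := (hΘ.differentiableAt (by simp)).hasFDerivAt
  have e0 : (φ (lieExp ((0 : ℝ) • v)), φ g) = (φ 1, φ g) := by rw [zero_smul, lieExp_zero]
  rw [← e0] at h1
  have h2 := h1.comp_hasDerivAt (0 : ℝ) hc
  rw [e0] at h2
  refine h2.congr_of_eventuallyEq ?_
  filter_upwards [eventually_lieExp_mem_source v] with s hs
  simp only [Function.comp_apply, mulChart, ← hφ]
  rw [φ.left_inv hg, φ.left_inv hs]

/-- Both sides are the velocity at s = 0 of the one curve g exp(sv) = exp(s Ad_g v) g.
Differentiating this relation in g at 1 later produces ad from Ad. -/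
theorem fderiv_mulChart_lieAd {g : G} (hg : g ∈ (extChartAt (𝓡 d) (1 : G)).source)
    (v : EuclideanSpace ℝ (Fin d)) :
    fderiv ℝ (mulChart d G) (extChartAt (𝓡 d) (1 : G) 1, extChartAt (𝓡 d) (1 : G) g)
        (lieAd g v, 0) =
      fderiv ℝ (mulChart d G) (extChartAt (𝓡 d) (1 : G) g, extChartAt (𝓡 d) (1 : G) 1) (0, v) := by
  have h1 := hasDerivAt_chart_lieExp_mul hg (show GroupLieAlgebra (𝓡 d) G from lieAd g v)
  have h2 := hasDerivAt_chart_mul_lieExp hg (show GroupLieAlgebra (𝓡 d) G from v)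
  refine h1.unique (h2.congr_of_eventuallyEq (Eventually.of_forall fun s => ?_))
  have := conj_lieExp g s (show GroupLieAlgebra (𝓡 d) G from v)
  simp only [← this, inv_mul_cancel_right]

/-- The bracket of invariant fields is computed on their pullbacks along the chart; this makes the
pullbacks explicit in terms of the multiplication. -/
theorem mpullbackWithin_mulInvariantVectorField (v : GroupLieAlgebra (𝓡 d) G)
    {y : EuclideanSpace ℝ (Fin d)} (hy : y ∈ (extChartAt (𝓡 d) (1 : G)).target) :
    (mpullbackWithin 𝓘(ℝ, EuclideanSpace ℝ (Fin d)) (𝓡 d) (extChartAt (𝓡 d) (1 : G)).symm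
      (mulInvariantVectorField v) (range (𝓡 d)) y : EuclideanSpace ℝ (Fin d)) =
      fderiv ℝ (mulChart d G) (y, extChartAt (𝓡 d) (1 : G) 1)
        (0, (show EuclideanSpace ℝ (Fin d) from v)) := by
  set φ := extChartAt (𝓡 d) (1 : G) with hφ
  have hg : φ.symm y ∈ φ.source := φ.map_target hy
  have hinv := ContinuousLinearMap.inverse_eq
    (mfderivWithin_extChartAt_symm_comp_mfderiv_extChartAt hy)
    (mfderiv_extChartAt_comp_mfderivWithin_extChartAt_symm hy)
  have h1 : HasDerivAt (fun s : ℝ => φ (φ.symm y * lieExp (s • v)))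
      (tderiv φ (φ.symm y) (mulInvariantVectorField v (φ.symm y))) 0 := by
    have e0 : φ.symm y * lieExp ((0 : ℝ) • v) = φ.symm y := by rw [zero_smul, lieExp_zero, mul_one]
    have := HasMFDerivAt.hasDerivAt_of_curve (F := φ) (t := 0) (by rw [e0]; exact mdifferentiableAt_chart hg)
      e0 (IsMIntegralCurve.mul_left (isMIntegralCurve_lieExp v) (φ.symm y) 0)
    have key : ∀ h, h = φ.symm y → (tderiv φ (φ.symm y) (mulInvariantVectorField v h) =
        tderiv φ (φ.symm y) (mulInvariantVectorField v (φ.symm y))) := by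
      rintro h rfl; rfl
    exact this.congr_deriv (key _ e0)
  have h2 := hasDerivAt_chart_mul_lieExp hg v
  rw [← hφ, φ.right_inv hy] at h2
  rw [← h1.unique h2]
  change (mfderivWithin 𝓘(ℝ, EuclideanSpace ℝ (Fin d)) (𝓡 d) φ.symm (range (𝓡 d)) y).inverse
    (mulInvariantVectorField v (φ.symm y)) = _
  rw [hinv]
  rfl

theorem fderiv_mulChart_snd_one (v : EuclideanSpace ℝ (Fin d)) :
    fderiv ℝ (mulChart d G) (extChartAt (𝓡 d) (1 : G) 1, extChartAt (𝓡 d) (1 : G) 1) (0, v) = v := by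
  have h := hasDerivAt_chart_mul_lieExp (mem_extChartAt_source (I := 𝓡 d) (1 : G))
    (show GroupLieAlgebra (𝓡 d) G from v)
  simp only [one_mul] at h
  exact h.unique (hasDerivAt_chart_lieExp_zero _)

theorem fderiv_mulChart_fst_one (v : EuclideanSpace ℝ (Fin d)) :
    fderiv ℝ (mulChart d G) (extChartAt (𝓡 d) (1 : G) 1, extChartAt (𝓡 d) (1 : G) 1) (v, 0) = v := by
  have h := hasDerivAt_chart_lieExp_mul (mem_extChartAt_source (I := 𝓡 d) (1 : G))
    (show GroupLieAlgebra (𝓡 d) G from v)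
  simp only [mul_one] at h
  exact h.unique (hasDerivAt_chart_lieExp_zero _)

/-- The Lie bracket is the antisymmetrised second derivative of the multiplication. -/
theorem lieBr_eq_fderiv_fderiv_mulChart (v w : EuclideanSpace ℝ (Fin d)) :
    lieBr G v w =
      fderiv ℝ (fderiv ℝ (mulChart d G)) (extChartAt (𝓡 d) (1 : G) 1, extChartAt (𝓡 d) (1 : G) 1)
        (v, 0) (0, w) -
      fderiv ℝ (fderiv ℝ (mulChart d G)) (extChartAt (𝓡 d) (1 : G) 1, extChartAt (𝓡 d) (1 : G) 1)
        (w, 0) (0, v) := by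
  set φ := extChartAt (𝓡 d) (1 : G) with hφ
  set a := φ 1 with ha
  let Y : EuclideanSpace ℝ (Fin d) → EuclideanSpace ℝ (Fin d) → EuclideanSpace ℝ (Fin d) :=
    fun v y => fderiv ℝ (mulChart d G) (y, a) (0, v)
  have hY : ∀ v, HasFDerivAt (Y v) (((ContinuousLinearMap.apply ℝ (EuclideanSpace ℝ (Fin d))
      ((0 : EuclideanSpace ℝ (Fin d)), v)).comp (fderiv ℝ (fderiv ℝ (mulChart d G)) (a, a))).comp
        (ContinuousLinearMap.inl ℝ _ _)) a := by
    intro v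
    have h1 : HasFDerivAt (fun y : EuclideanSpace ℝ (Fin d) => (y, a))
      (ContinuousLinearMap.inl ℝ _ _) a := (hasFDerivAt_id a).prodMk (hasFDerivAt_const a a)
    have h2 := HasFDerivAt.comp (f := fun y => (y, a)) a hasFDerivAt_fderiv_mulChart h1
    exact (ContinuousLinearMap.apply ℝ (EuclideanSpace ℝ (Fin d))
      ((0 : EuclideanSpace ℝ (Fin d)), v)).hasFDerivAt.comp a h2
  have hV : ∀ v : GroupLieAlgebra (𝓡 d) G, (mpullbackWithin 𝓘(ℝ, EuclideanSpace ℝ (Fin d)) (𝓡 d) φ.symm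
      (mulInvariantVectorField v) (range (𝓡 d)) : EuclideanSpace ℝ (Fin d) →
        EuclideanSpace ℝ (Fin d)) =ᶠ[𝓝 a] Y v := by
    intro v
    filter_upwards [extChartAt_target_mem_nhds (I := 𝓡 d) (1 : G)] with y hy
    exact mpullbackWithin_mulInvariantVectorField v hy
  have h1 : lieBr G v w = lieBracket ℝ (Y v) (Y w) a := by
    rw [← Filter.EventuallyEq.lieBracket_vectorField_eq (hV v) (hV w)]
    refine (mlieBracketWithin_apply (s := univ)).trans ?_
    rw [mfderiv_extChartAt_self]
    refine (DFunLike.congr_fun ContinuousLinearMap.inverse_id _).trans ?_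
    rw [preimage_univ, univ_inter, ModelWithCorners.range_eq_univ]
    exact congrFun lieBracketWithin_univ a
  rw [h1, lieBracket_eq]
  simp only [(hY _).fderiv]
  have e : ∀ v, Y v a = v := fun v => fderiv_mulChart_snd_one v
  simp [e]

/-- The derivative of the adjoint representation is the Lie bracket. -/
theorem hasDerivAt_lieAd_lieExp (v w : EuclideanSpace ℝ (Fin d)) :
    HasDerivAt (fun t : ℝ => lieAd (lieExp (t • (show GroupLieAlgebra (𝓡 d) G from v))) w)
      (lieBr G v w) 0 := by
  set φ := extChartAt (𝓡 d) (1 : G) with hφ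
  set a := φ 1 with ha
  set B := fderiv ℝ (fderiv ℝ (mulChart d G)) (a, a) with hB
  let V := EuclideanSpace ℝ (Fin d)
  have hsymm : IsSymmSndFDerivAt ℝ (mulChart d G) (a, a) :=
    (eventually_contDiffAt_mulChart (d := d) (G := G)).self_of_nhds.isSymmSndFDerivAt
      (by simp; norm_cast)
  have hφv := hasDerivAt_chart_lieExp_zero (show GroupLieAlgebra (𝓡 d) G from v)
  have h0 : φ (lieExp ((0 : ℝ) • (show GroupLieAlgebra (𝓡 d) G from v))) = a := by rw [zero_smul, lieExp_zero]
  let P : ℝ → (V →L[ℝ] V) := fun t =>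
    (fderiv ℝ (mulChart d G) (a, φ (lieExp (t • (show GroupLieAlgebra (𝓡 d) G from v))))).comp (ContinuousLinearMap.inl ℝ V V)
  let R : ℝ → V := fun t => fderiv ℝ (mulChart d G) (φ (lieExp (t • (show GroupLieAlgebra (𝓡 d) G from v))), a) (0, w)
  have hP : HasDerivAt P ((B (0, v)).comp (ContinuousLinearMap.inl ℝ V V)) 0 := by
    have hc : HasDerivAt (fun t : ℝ => (a, φ (lieExp (t • (show GroupLieAlgebra (𝓡 d) G from v))))) ((0 : V), v) 0 :=
      (hasDerivAt_const _ _).prodMk hφv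
    have hf := hasFDerivAt_fderiv_mulChart (d := d) (G := G)
    have e0 : (a, φ (lieExp ((0 : ℝ) • (show GroupLieAlgebra (𝓡 d) G from v)))) = (a, a) := by rw [h0]
    rw [← hφ, ← ha, ← hB, ← e0] at hf
    have := hf.comp_hasDerivAt (0 : ℝ) hc
    exact ((ContinuousLinearMap.compL ℝ V (V × V) V).flip
      (ContinuousLinearMap.inl ℝ V V)).hasFDerivAt.comp_hasDerivAt 0 this
  have hR : HasDerivAt R (B (v, 0) (0, w)) 0 := by
    have hc : HasDerivAt (fun t : ℝ => (φ (lieExp (t • (show GroupLieAlgebra (𝓡 d) G from v))), a)) (v, (0 : V)) 0 :=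
      hφv.prodMk (hasDerivAt_const _ _)
    have hf := hasFDerivAt_fderiv_mulChart (d := d) (G := G)
    have e0 : (φ (lieExp ((0 : ℝ) • (show GroupLieAlgebra (𝓡 d) G from v))), a) = (a, a) := by rw [h0]
    rw [← hφ, ← ha, ← hB, ← e0] at hf
    have := hf.comp_hasDerivAt (0 : ℝ) hc
    exact (ContinuousLinearMap.apply ℝ V ((0 : V), w)).hasFDerivAt.comp_hasDerivAt 0 this
  have hP0 : P 0 = 1 := by
    ext1 x
    simp only [P, h0]
    exact fderiv_mulChart_fst_one x
  have hR0 : R 0 = w := by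
    simp only [R, h0]
    exact fderiv_mulChart_snd_one _
  -- For small t, Ad_{exp(tv)} w = P(t)⁻¹ R(t) by `fderiv_mulChart_lieAd`. Since P(0) = 1, the
  -- derivative of P⁻¹ at 0 is -P'(0).
  have hI : HasDerivAt (fun t => Ring.inverse (P t))
      (-((B (0, v)).comp (ContinuousLinearMap.inl ℝ V V))) 0 := by
    have h1 := hasFDerivAt_ringInverse (𝕜 := ℝ) (1 : (V →L[ℝ] V)ˣ)
    rw [Units.val_one, ← hP0] at h1
    have := h1.comp_hasDerivAt (0 : ℝ) hP
    refine this.congr_deriv ?_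
    ext1 x
    simp
  have hIR := hI.clm_apply hR
  rw [hP0, hR0, Ring.inverse_one] at hIR
  have hev : (fun t : ℝ => lieAd (lieExp (t • (show GroupLieAlgebra (𝓡 d) G from v))) w) =ᶠ[𝓝 0]
      fun t => Ring.inverse (P t) (R t) := by
    have hu : ∀ᶠ t in 𝓝 (0 : ℝ), IsUnit (P t) := by
      refine hP.continuousAt.eventually (Units.isOpen.mem_nhds ?_)
      rw [hP0]; exact isUnit_one
    filter_upwards [hu, eventually_lieExp_mem_source (show GroupLieAlgebra (𝓡 d) G from v)] with t ht hs
    have h1 : P t (lieAd (lieExp (t • (show GroupLieAlgebra (𝓡 d) G from v))) w) = R t := fderiv_mulChart_lieAd hs w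
    rw [← h1, ← mul_apply_eq_comp, Ring.inverse_mul_cancel _ ht,
      one_apply_eq_self]
  refine (hIR.congr_of_eventuallyEq hev).congr_deriv ?_
  rw [lieBr_eq_fderiv_fderiv_mulChart, ← hφ, ← ha, ← hB]
  -- Symmetry of the second derivative turns the term coming from P⁻¹ into the swapped term of the
  -- bracket formula.
  have hs : B (0, v) (w, 0) = B (w, 0) (0, v) := hsymm.eq _ _
  simp only [one_apply_eq_self, neg_apply,
    ContinuousLinearMap.comp_apply, ContinuousLinearMap.inl_apply]
  rw [hs]
  abel

end LieTheory

/-! ### Nilpotency of the adjoint action -/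

section LieTheory
open scoped commutatorElement

/-- Pointwise derivatives of a curve of operators on a finite-dimensional space give a derivative. -/
theorem hasDerivAt_clm_of_apply {V W : Type*} [NormedAddCommGroup V] [NormedSpace ℝ V]
    [NormedAddCommGroup W] [NormedSpace ℝ W] [FiniteDimensional ℝ V] {f : ℝ → V →L[ℝ] W} {t : ℝ}
    {D : V → W} (h : ∀ w, HasDerivAt (fun s => f s w) (D w) t) :
    ∃ D' : V →L[ℝ] W, (∀ w, D' w = D w) ∧ HasDerivAt f D' t := by
  let b := Module.finBasis ℝ V
  let c : Fin (Module.finrank ℝ V) → V →L[ℝ] ℝ := fun j => LinearMap.toContinuousLinearMap (b.coord j)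
  have e : ∀ g : V →L[ℝ] W, g = ∑ j, (c j).smulRight (g (b j)) := by
    intro g
    ext w
    conv_lhs => rw [← b.sum_repr w, map_sum]
    simp [c]
  have h1 : HasDerivAt f (∑ j, (c j).smulRight (D (b j))) t := by
    have : f = fun s => ∑ j, (c j).smulRight (f s (b j)) := funext fun s => e _
    rw [this]
    refine HasDerivAt.fun_sum fun j _ => ?_
    exact (ContinuousLinearMap.smulRightL ℝ V W (c j)).hasFDerivAt.comp_hasDerivAt t (h (b j))
  refine ⟨_, fun w => ?_, h1⟩
  exact (h1.clm_apply (hasDerivAt_const t w)).unique (by simpa using h w) |> fun h => by simpa using h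

/-- A differentiable one-parameter group of operators is an exponential. -/
theorem eq_exp_of_mul {A : Type*} [NormedRing A] [NormedAlgebra ℝ A] [CompleteSpace A]
    {f : ℝ → A} {D : A} (h0 : f 0 = 1) (hmul : ∀ s t, f (s + t) = f s * f t)
    (hD : HasDerivAt f D 0) (t : ℝ) : f t = NormedSpace.exp (t • D) := by
  have hf : ∀ t, HasDerivAt f (f t * D) t := by
    intro t
    have h1 : HasDerivAt (fun s => f t * f s) (f t * D) (t - t) := by
      rw [sub_self]; exact hD.const_mul (f t)
    have := HasDerivAt.comp_sub_const t t h1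
    simpa [← hmul] using this
  have hconst : ∀ t, HasDerivAt (fun t => f t * NormedSpace.exp (t • -D)) 0 t := by
    intro t
    refine ((hf t).mul (hasDerivAt_exp_smul_const' (𝕂 := ℝ) (-D) t)).congr_deriv ?_
    simp [mul_assoc]
  have h2 := is_const_of_deriv_eq_zero (fun t => (hconst t).differentiableAt)
    (fun t => (hconst t).deriv) t 0
  simp only [h0, zero_smul, NormedSpace.exp_zero, mul_one] at h2
  have h3 : NormedSpace.exp (t • -D) * NormedSpace.exp (t • D) = 1 := by
    rw [smul_neg]
    let _ : NormedAlgebra ℚ A := NormedAlgebra.restrictScalars ℚ ℝ A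
    have hu := NormedSpace.exp_add_of_commute ((Commute.refl (t • D)).neg_left)
    rw [neg_add_cancel, NormedSpace.exp_zero] at hu
    exact hu.symm
  calc f t = f t * (NormedSpace.exp (t • -D) * NormedSpace.exp (t • D)) := by rw [h3, mul_one]
    _ = _ := by rw [← mul_assoc, h2, one_mul]

/-- D is the limit of the slopes t⁻¹(f(t) - 1), all of whose k-th powers vanish. -/
theorem pow_eq_zero_of_hasDerivAt {A : Type*} [NormedRing A] [NormedAlgebra ℝ A]
    {f : ℝ → A} {D : A} (h0 : f 0 = 1) (hD : HasDerivAt f D 0) {k : ℕ}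
    (hk : ∀ t, (f t - 1) ^ k = 0) : D ^ k = 0 := by
  rw [hasDerivAt_iff_tendsto_slope] at hD
  refine tendsto_nhds_unique (hD.pow k) ?_
  refine tendsto_const_nhds.congr fun t => ?_
  rw [slope_def_module, h0, smul_pow, hk, smul_zero]

variable {d : ℕ} {G : Type u} [Group G] [TopologicalSpace G]
  [ChartedSpace (EuclideanSpace ℝ (Fin d)) G] [LieGroup (𝓡 d) ∞ G] [T2Space G]

theorem lieExp_zero_smul (v : GroupLieAlgebra (𝓡 d) G) : lieExp ((0 : ℝ) • v) = (1 : G) := by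
  rw [zero_smul, lieExp_zero]

theorem exists_lieAd_lieExp (v : EuclideanSpace ℝ (Fin d)) :
    ∃ D : EuclideanSpace ℝ (Fin d) →L[ℝ] EuclideanSpace ℝ (Fin d), (∀ w, D w = lieBr G v w) ∧
      HasDerivAt (fun t : ℝ => lieAd (lieExp (t • (show GroupLieAlgebra (𝓡 d) G from v)))) D 0 ∧
      ∀ t : ℝ, lieAd (lieExp (t • (show GroupLieAlgebra (𝓡 d) G from v))) =
        NormedSpace.exp (t • D) := by
  obtain ⟨D, hD, hd⟩ := hasDerivAt_clm_of_apply (fun w => hasDerivAt_lieAd_lieExp (G := G) v w)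
  refine ⟨D, hD, hd, fun t => eq_exp_of_mul ?_ (fun s t => ?_) hd t⟩
  · rw [zero_smul, lieExp_zero, lieAd_one]; rfl
  · rw [lieExp_add_smul, lieAd_mul]; rfl

/-- Composition of a function with a curve through the identity. -/
theorem hasDerivAt_comp_curve {E : Type*} [NormedAddCommGroup E] [NormedSpace ℝ E]
    {F : G → E} (hF : MDifferentiableAt (𝓡 d) 𝓘(ℝ, E) F 1) {c : ℝ → G}
    (hc : ContinuousAt c 0) (h1 : c 0 = 1) {w : EuclideanSpace ℝ (Fin d)}
    (hw : HasDerivAt (fun t => extChartAt (𝓡 d) (1 : G) (c t)) w 0) :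
    HasDerivAt (fun t => F (c t)) (tderiv F 1 w) 0 := by
  set φ := extChartAt (𝓡 d) (1 : G) with hφ
  have hsymm : φ.symm (φ 1) = 1 := extChartAt_to_inv _
  have hs : MDifferentiableAt 𝓘(ℝ, EuclideanSpace ℝ (Fin d)) (𝓡 d) φ.symm (φ 1) :=
    ((contMDiffOn_extChartAt_symm (I := 𝓡 d) (n := ∞) (1 : G)).contMDiffAt
      ((isOpen_extChartAt_target (I := 𝓡 d) (1 : G)).mem_nhds
        (mem_extChartAt_target _))).mdifferentiableAt (by simp)
  have hFs : DifferentiableAt ℝ (F ∘ φ.symm) (φ 1) := by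
    rw [← mdifferentiableAt_iff_differentiableAt]
    exact MDifferentiableAt.comp (φ 1) (by rwa [hsymm]) hs
  have key : ∀ (c : ℝ → G) (w : EuclideanSpace ℝ (Fin d)), ContinuousAt c 0 → c 0 = 1 →
      HasDerivAt (fun t => φ (c t)) w 0 →
      HasDerivAt (fun t => F (c t)) (fderiv ℝ (F ∘ φ.symm) (φ 1) w) 0 := by
    intro c w hc h1 hw
    have h2 := hFs.hasFDerivAt
    rw [← h1] at h2
    have h3 := HasFDerivAt.comp_hasDerivAt (f := fun t => φ (c t)) (0 : ℝ) h2 hw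
    rw [h1] at h3
    refine h3.congr_of_eventuallyEq ?_
    have : ∀ᶠ t in 𝓝 (0 : ℝ), c t ∈ φ.source := hc.eventually
      ((isOpen_extChartAt_source (I := 𝓡 d) (1 : G)).mem_nhds
        (by rw [h1]; exact mem_extChartAt_source _))
    filter_upwards [this] with t ht
    simp [φ.left_inv ht]
  refine (key c w hc h1 hw).congr_deriv ?_
  have h4 := key _ w (continuous_lieExp_smul (show GroupLieAlgebra (𝓡 d) G from w)).continuousAt
    (by rw [zero_smul, lieExp_zero])
    (hasDerivAt_chart_lieExp_zero (show GroupLieAlgebra (𝓡 d) G from w))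
  exact h4.unique (hasDerivAt_comp_lieExp hF _)

/-- The commutator is (g c g⁻¹) c⁻¹; the derivative of the multiplication at the identity is
addition, so the velocities Ad_g w and -w add. -/
theorem hasDerivAt_chart_commutator {c : ℝ → G} (g : G)
    (hc : ContinuousAt c 0) (h1 : c 0 = 1) {w : EuclideanSpace ℝ (Fin d)}
    (hw : HasDerivAt (fun t => extChartAt (𝓡 d) (1 : G) (c t)) w 0) :
    HasDerivAt (fun t => extChartAt (𝓡 d) (1 : G) ⁅g, c t⁆) ((lieAd g - 1) w) 0 := by
  set φ := extChartAt (𝓡 d) (1 : G) with hφ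
  have : IsTopologicalGroup G := topologicalGroup_of_lieGroup (𝓡 d) ∞
  have ha := hasDerivAt_comp_curve ((contMDiffAt_chart_conj g).mdifferentiableAt (by simp)) hc h1 hw
  have hinv : MDifferentiableAt (𝓡 d) 𝓘(ℝ, EuclideanSpace ℝ (Fin d)) (fun x : G => φ x⁻¹) 1 := by
    refine ContMDiffAt.mdifferentiableAt (n := ∞) ?_ (by simp)
    refine ContMDiffAt.comp (1 : G) (contMDiffAt_extChartAt' ?_) (contMDiff_inv (𝓡 d) ∞).contMDiffAt
    simp
  have hti : ∀ v : EuclideanSpace ℝ (Fin d), tderiv (fun x : G => φ x⁻¹) 1 v = -v := by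
    intro v
    have h2 := hasDerivAt_comp_lieExp hinv v
    have h3 : HasDerivAt (fun t : ℝ => φ (lieExp (t • (show GroupLieAlgebra (𝓡 d) G from v))))
      v (-0) := by
      rw [neg_zero]
      exact hasDerivAt_chart_lieExp_zero (show GroupLieAlgebra (𝓡 d) G from v)
    have h4 := HasDerivAt.scomp (0 : ℝ) h3 (hasDerivAt_neg (0 : ℝ))
    rw [neg_smul, one_smul] at h4
    refine h2.unique (h4.congr_of_eventuallyEq (Eventually.of_forall fun t => ?_))
    exact congrArg φ (lieExp_neg_smul t (show GroupLieAlgebra (𝓡 d) G from v)).symm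
  have hb := hasDerivAt_comp_curve hinv hc h1 hw
  rw [hti] at hb
  have hΘ := ((eventually_contDiffAt_mulChart (d := d) (G := G)).self_of_nhds.differentiableAt
    (by simp)).hasFDerivAt
  have e0 : ((φ (g * c 0 * g⁻¹), φ (c 0)⁻¹) : _ × _) = (φ 1, φ 1) := by simp [h1]
  rw [← hφ, ← e0] at hΘ
  have h5 := hΘ.comp_hasDerivAt (0 : ℝ) (ha.prodMk hb)
  rw [e0] at h5
  have hs1 : ∀ᶠ t in 𝓝 (0 : ℝ), g * c t * g⁻¹ ∈ φ.source :=
    ((continuousAt_const.mul hc).mul continuousAt_const).eventually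
      ((isOpen_extChartAt_source (I := 𝓡 d) (1 : G)).mem_nhds (by simp [h1]))
  have hs2 : ∀ᶠ t in 𝓝 (0 : ℝ), (c t)⁻¹ ∈ φ.source :=
    hc.inv.eventually ((isOpen_extChartAt_source (I := 𝓡 d) (1 : G)).mem_nhds (by simp [h1]))
  refine (h5.congr_of_eventuallyEq ?_).congr_deriv ?_
  · filter_upwards [hs1, hs2] with t ht1 ht2
    simp only [Function.comp_apply, mulChart, ← hφ]
    rw [φ.left_inv ht1, φ.left_inv ht2, commutatorElement_def]
  · change fderiv ℝ (mulChart d G) (φ 1, φ 1) (lieAd g w, -w) = _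
    have e1 : (lieAd g w, -w) = (lieAd g w, 0) + ((0 : EuclideanSpace ℝ (Fin d)), -w) := by simp
    rw [e1, map_add, fderiv_mulChart_fst_one, fderiv_mulChart_snd_one]
    simp [sub_eq_add_neg]

/-- Iterating y ↦ [g, y] k times sends a one-parameter subgroup into the k-th term of the lower
central series, which is trivial, whereas the velocity of the resulting curve is (Ad_g - 1)^k v. -/
theorem exists_lieAd_sub_one_pow_eq_zero [Group.IsNilpotent G] :
    ∃ k : ℕ, ∀ g : G,
      (lieAd g - 1 : EuclideanSpace ℝ (Fin d) →L[ℝ] EuclideanSpace ℝ (Fin d)) ^ k = 0 := by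
  obtain ⟨k, hk⟩ := Subgroup.nilpotent_iff_lowerCentralSeries.1 ‹Group.IsNilpotent G›
  refine ⟨k, fun g => ?_⟩
  have : IsTopologicalGroup G := topologicalGroup_of_lieGroup (𝓡 d) ∞
  ext1 v
  let c : ℕ → ℝ → G := fun n t => (fun y => ⁅g, y⁆)^[n] (lieExp (t • (show GroupLieAlgebra (𝓡 d) G from v)))
  have hmem : ∀ n t, c n t ∈ (⊤ : Subgroup G).lowerCentralSeries n := by
    intro n t
    induction n with
    | zero => trivial
    | succ n ih =>
      simp only [c, Function.iterate_succ_apply'] at ih ⊢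
      -- The lower central series has its own term as the first entry of the commutator; inversion
      -- swaps the entries.
      rw [Subgroup.lowerCentralSeries_succ, ← commutatorElement_inv]
      exact inv_mem (Subgroup.commutator_mem_commutator ih trivial)
  have hd : ∀ n, ContinuousAt (c n) 0 ∧ c n 0 = 1 ∧
      HasDerivAt (fun t => extChartAt (𝓡 d) (1 : G) (c n t)) (((lieAd g - 1) ^ n) v) 0 := by
    intro n
    induction n with
    | zero =>
      refine ⟨(continuous_lieExp_smul _).continuousAt, ?_, ?_⟩
      · exact lieExp_zero_smul (show GroupLieAlgebra (𝓡 d) G from v)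
      · exact hasDerivAt_chart_lieExp_zero (show GroupLieAlgebra (𝓡 d) G from v)
    | succ n ih =>
      obtain ⟨h1, h2, h3⟩ := ih
      have e : c (n + 1) = fun t => ⁅g, c n t⁆ := by
        ext t; simp only [c, Function.iterate_succ_apply']
      refine ⟨?_, ?_, ?_⟩
      · rw [e]
        simp only [commutatorElement_def]
        exact ((continuousAt_const.mul h1).mul continuousAt_const).mul h1.inv
      · rw [e]; simp [h2]
      · rw [e, pow_succ', mul_apply_eq_comp]
        exact hasDerivAt_chart_commutator g h1 h2 h3
  have h1 : ∀ t, c k t = 1 := fun t => by simpa [hk] using hmem k t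
  have h2 := (hd k).2.2
  simp only [h1] at h2
  exact h2.unique (hasDerivAt_const _ _)

theorem isNilpotent_of_lieAd [Group.IsNilpotent G] (v : EuclideanSpace ℝ (Fin d))
    {D : EuclideanSpace ℝ (Fin d) →L[ℝ] EuclideanSpace ℝ (Fin d)}
    (hD : HasDerivAt (fun t : ℝ => lieAd (lieExp (t • (show GroupLieAlgebra (𝓡 d) G from v)))) D 0) :
    IsNilpotent D := by
  obtain ⟨k, hk⟩ := exists_lieAd_sub_one_pow_eq_zero (d := d) (G := G)
  refine ⟨k, ?_⟩
  refine pow_eq_zero_of_hasDerivAt ?_ hD fun t => hk _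
  rw [zero_smul, lieExp_zero, lieAd_one]; rfl

end LieTheory

/-! ### Strictly lower triangular operators and the frame matrix -/

section StrictLower

variable {d : ℕ}

/-- A strictly lower triangular operator on `ℝ^d`. -/
def IsStrictLower (T : (Fin d → ℝ) →L[ℝ] (Fin d → ℝ)) : Prop :=
  ∀ (j : ℕ) (v : Fin d → ℝ), (∀ i : Fin d, (i : ℕ) < j → v i = 0) →
    ∀ i : Fin d, (i : ℕ) < j + 1 → T v i = 0

namespace IsStrictLower

variable {S T : (Fin d → ℝ) →L[ℝ] (Fin d → ℝ)}

theorem zero : IsStrictLower (0 : (Fin d → ℝ) →L[ℝ] (Fin d → ℝ)) := fun _ _ _ _ _ => rfl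

theorem add (hS : IsStrictLower S) (hT : IsStrictLower T) : IsStrictLower (S + T) := by
  intro j v hv i hi
  simp [hS j v hv i hi, hT j v hv i hi]

theorem smul (c : ℝ) (hT : IsStrictLower T) : IsStrictLower (c • T) := by
  intro j v hv i hi
  simp [hT j v hv i hi]

theorem neg (hT : IsStrictLower T) : IsStrictLower (-T) := by
  intro j v hv i hi
  simp [hT j v hv i hi]

theorem mul (hS : IsStrictLower S) (hT : IsStrictLower T) : IsStrictLower (S * T) := by
  intro j v hv i hi
  exact hS j (T v) (fun i hi => hT j v hv i (by omega)) i hi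

theorem sum {ι : Type*} (s : Finset ι) {f : ι → (Fin d → ℝ) →L[ℝ] (Fin d → ℝ)}
    (h : ∀ i ∈ s, IsStrictLower (f i)) : IsStrictLower (∑ i ∈ s, f i) := by
  classical
  induction s using Finset.induction_on with
  | empty => simpa using zero
  | insert a s ha ih =>
    rw [Finset.sum_insert ha]
    exact (h a (by simp)).add (ih fun i hi => h i (by simp [hi]))

theorem pow_apply_eq_zero (hT : IsStrictLower T) (n : ℕ) (v : Fin d → ℝ) (i : Fin d)
    (hi : (i : ℕ) < n) : (T ^ n) v i = 0 := by
  induction n generalizing i with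
  | zero => omega
  | succ n ih =>
    rw [pow_succ']
    exact hT n ((T ^ n) v) ih i hi

theorem pow_eq_zero (hT : IsStrictLower T) {n : ℕ} (hn : d ≤ n) : T ^ n = 0 := by
  ext v i
  exact hT.pow_apply_eq_zero n v i (i.2.trans_le hn)

theorem pow (hT : IsStrictLower T) {n : ℕ} (hn : n ≠ 0) : IsStrictLower (T ^ n) := by
  obtain ⟨n, rfl⟩ := Nat.exists_eq_succ_of_ne_zero hn
  clear hn
  induction n with
  | zero => simpa using hT
  | succ n ih => rw [pow_succ]; exact ih.mul hT

theorem mul_of_sub_one (hS : IsStrictLower (S - 1)) (hT : IsStrictLower (T - 1)) :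
    IsStrictLower (S * T - 1) := by
  have : S * T - 1 = (S - 1) * (T - 1) + (S - 1) + (T - 1) := by
    simp only [sub_mul, mul_sub, one_mul, mul_one]; abel
  rw [this]
  exact ((hS.mul hT).add hS).add hT

theorem list_prod_sub_one (l : List ((Fin d → ℝ) →L[ℝ] (Fin d → ℝ)))
    (h : ∀ S ∈ l, IsStrictLower (S - 1)) : IsStrictLower (l.prod - 1) := by
  induction l with
  | nil => simpa using zero
  | cons a l ih =>
    rw [List.prod_cons]
    exact mul_of_sub_one (h a (by simp)) (ih fun S hS => h S (by simp [hS]))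

theorem det_eq_one (hT : IsStrictLower (T - 1)) : T.det = 1 := by
  have hdet : T.det = (LinearMap.toMatrix' (T : (Fin d → ℝ) →ₗ[ℝ] (Fin d → ℝ))).det := by
    rw [LinearMap.det_toMatrix']
  have hent : ∀ i j : Fin d, i ≤ j →
      LinearMap.toMatrix' (T : (Fin d → ℝ) →ₗ[ℝ] (Fin d → ℝ)) i j = if i = j then 1 else 0 := by
    intro i j hij
    have := hT j (Pi.single j 1) (fun k hk => by
      rw [Pi.single_eq_of_ne]; rintro rfl; omega) i (by have : (i : ℕ) ≤ j := hij; omega)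
    rw [sub_apply, Pi.sub_apply, sub_eq_zero] at this
    rw [LinearMap.toMatrix'_apply]
    change T (Pi.single j 1) i = _
    rw [this]
    simp [Pi.single_apply]
  rw [hdet, Matrix.det_of_isLowerTriangular]
  · exact Finset.prod_eq_one fun i _ => by simp [hent i i le_rfl]
  · intro i j hij
    have hij' : i < j := hij
    rw [hent i j hij'.le, if_neg hij'.ne]

/-- An operator which preserves the flag of tails and is nilpotent is strictly lower triangular. -/
theorem of_isNilpotent
    (hS : ∀ (j : ℕ) (v : Fin d → ℝ), (∀ i : Fin d, (i : ℕ) < j → v i = 0) →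
      ∀ i : Fin d, (i : ℕ) < j → S v i = 0) (hn : IsNilpotent S) : IsStrictLower S := by
  have hpow : ∀ (n j : ℕ) (v : Fin d → ℝ), (∀ i : Fin d, (i : ℕ) < j → v i = 0) →
      ∀ i : Fin d, (i : ℕ) < j → (S ^ n) v i = 0 := by
    intro n
    induction n with
    | zero => intro j v hv; simpa using hv
    | succ n ih => intro j v hv; rw [pow_succ']; exact hS j _ (ih j v hv)
  -- On vectors starting at position j, S acts on coordinate j by its diagonal entry. So the
  -- diagonal entries of S^n are n-th powers, and nilpotency kills them.
  have hdiag : ∀ (j : Fin d) (v : Fin d → ℝ), (∀ i : Fin d, (i : ℕ) < j → v i = 0) →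
      S v j = S (Pi.single j 1) j * v j := by
    intro j v hv
    have h1 := hS (j + 1) (v - v j • Pi.single j 1) (fun i hi => by
      rcases Nat.lt_succ_iff_lt_or_eq.1 hi with h | h
      · have : i ≠ j := by rintro rfl; omega
        simp [hv i h, this]
      · have : i = j := Fin.ext h
        subst this; simp) j (Nat.lt_succ_self _)
    rw [map_sub, map_smul, Pi.sub_apply, Pi.smul_apply, smul_eq_mul, sub_eq_zero] at h1
    rw [h1, mul_comm]
  have hsingle : ∀ j : Fin d, ∀ i : Fin d, (i : ℕ) < j → (Pi.single j (1 : ℝ) : Fin d → ℝ) i = 0 := by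
    intro j i hi
    rw [Pi.single_eq_of_ne]; rintro rfl; omega
  have hdiag0 : ∀ j : Fin d, S (Pi.single j 1) j = 0 := by
    intro j
    obtain ⟨n, hn⟩ := hn
    have h1 : ∀ n : ℕ, (S ^ n) (Pi.single j 1) j = (S (Pi.single j 1) j) ^ n := by
      intro n
      induction n with
      | zero => simp
      | succ n ih =>
        rw [pow_succ', pow_succ', ← ih]
        exact hdiag j _ (hpow n j _ (hsingle j))
    have h2 := h1 n
    rw [hn] at h2
    exact _root_.pow_eq_zero_iff (M₀ := ℝ) (n := n) (by rintro rfl; simp at h2) |>.1 h2.symm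
  intro j v hv i hi
  rcases Nat.lt_succ_iff_lt_or_eq.1 hi with h | h
  · exact hS j v hv i h
  · rw [hdiag i v (by rw [h]; exact hv), hdiag0, zero_mul]

end IsStrictLower

/-- The exponential series of a nilpotent operator. -/
def expPoly (A : (Fin d → ℝ) →L[ℝ] (Fin d → ℝ)) (s : ℝ) : (Fin d → ℝ) →L[ℝ] (Fin d → ℝ) :=
  ∑ n ∈ Finset.range d, (s ^ n * (n.factorial : ℝ)⁻¹) • A ^ n

theorem exp_eq_expPoly {A : (Fin d → ℝ) →L[ℝ] (Fin d → ℝ)} (hA : IsStrictLower A) (s : ℝ) :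
    NormedSpace.exp (s • A) = expPoly A s := by
  rw [NormedSpace.exp_eq_tsum ℝ, expPoly]
  simp only [smul_pow, smul_smul]
  rw [tsum_eq_sum (s := Finset.range d)]
  · exact Finset.sum_congr rfl fun n _ => by rw [mul_comm]
  · intro n hn
    rw [hA.pow_eq_zero (by simpa using hn), smul_zero]

theorem isStrictLower_expPoly_sub_one {A : (Fin d → ℝ) →L[ℝ] (Fin d → ℝ)} (hA : IsStrictLower A)
    (s : ℝ) : IsStrictLower (expPoly A s - 1) := by
  rcases Nat.eq_zero_or_pos d with rfl | hd
  · intro j v hv i; exact i.elim0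
  · obtain ⟨k, rfl⟩ := Nat.exists_eq_succ_of_ne_zero hd.ne'
    rw [expPoly, Finset.sum_range_succ']
    simp only [pow_zero, Nat.factorial_zero, Nat.cast_one, inv_one, mul_one, one_smul,
      add_sub_cancel_right]
    exact IsStrictLower.sum _ fun n _ => (hA.pow (Nat.succ_ne_zero n)).smul _

variable (A : Fin d → (Fin d → ℝ) →L[ℝ] (Fin d → ℝ))

/-- The product of the first `j` exponentials. -/
def preMat (t : Fin d → ℝ) (j : ℕ) : (Fin d → ℝ) →L[ℝ] (Fin d → ℝ) :=
  ((List.ofFn fun i => expPoly (A i) (t i)).take j).prod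

/-- The matrix expressing the coordinate vector fields in terms of the right-invariant ones. -/
def frameMat (t : Fin d → ℝ) : (Fin d → ℝ) →L[ℝ] (Fin d → ℝ) :=
  ∑ j : Fin d, (ContinuousLinearMap.proj (R := ℝ) (φ := fun _ : Fin d => ℝ) j).smulRight
    (preMat A t j (Pi.single j 1))

/-- The inverse of `frameMat`. -/
def invFrame (t : Fin d → ℝ) : (Fin d → ℝ) →L[ℝ] (Fin d → ℝ) :=
  ∑ n ∈ Finset.range d, (1 - frameMat A t) ^ n

variable {A}

theorem isStrictLower_preMat_sub_one (hA : ∀ i, IsStrictLower (A i)) (t : Fin d → ℝ) (j : ℕ) :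
    IsStrictLower (preMat A t j - 1) := by
  refine IsStrictLower.list_prod_sub_one _ fun S hS => ?_
  obtain ⟨i, rfl⟩ := List.mem_ofFn.1 (List.mem_of_mem_take hS)
  exact isStrictLower_expPoly_sub_one (hA i) (t i)

theorem isStrictLower_frameMat_sub_one (hA : ∀ i, IsStrictLower (A i)) (t : Fin d → ℝ) :
    IsStrictLower (frameMat A t - 1) := by
  intro j v hv i hi
  have e : (frameMat A t - 1) v = ∑ k, v k • (preMat A t k - 1) (Pi.single k 1) := by
    have hv' : v = ∑ k, v k • (Pi.single k 1 : Fin d → ℝ) := by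
      ext i; simp [Finset.sum_apply, Pi.single_apply]
    simp only [frameMat, sub_apply, sum_apply,
      ContinuousLinearMap.smulRight_apply, ContinuousLinearMap.proj_apply, smul_sub,
      Finset.sum_sub_distrib, one_apply_eq_self, ← hv']
  rw [e, Finset.sum_apply]
  refine Finset.sum_eq_zero fun k _ => ?_
  rw [Pi.smul_apply]
  by_cases hk : (k : ℕ) < j
  · rw [hv k hk, zero_smul]
  · rw [isStrictLower_preMat_sub_one hA t k k (Pi.single k 1) (fun l hl => by
      rw [Pi.single_eq_of_ne]; rintro rfl; omega) i (by omega), smul_zero]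

/-- The frame matrix is 1 - L with L strictly lower triangular and L^d = 0, so the Neumann series
stops after d terms and the inverse is polynomial in the frame. -/
theorem frameMat_mul_invFrame (hA : ∀ i, IsStrictLower (A i)) (t : Fin d → ℝ) :
    frameMat A t * invFrame A t = 1 := by
  have h := mul_neg_geom_sum (1 - frameMat A t) d
  have hL : IsStrictLower (1 - frameMat A t) := by
    rw [← neg_sub]; exact (isStrictLower_frameMat_sub_one hA t).neg
  rwa [sub_sub_cancel, hL.pow_eq_zero le_rfl, sub_zero] at h

theorem invFrame_mul_frameMat (hA : ∀ i, IsStrictLower (A i)) (t : Fin d → ℝ) :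
    invFrame A t * frameMat A t = 1 := by
  have h := geom_sum_mul_neg (1 - frameMat A t) d
  have hL : IsStrictLower (1 - frameMat A t) := by
    rw [← neg_sub]; exact (isStrictLower_frameMat_sub_one hA t).neg
  rwa [sub_sub_cancel, hL.pow_eq_zero le_rfl, sub_zero] at h

theorem isStrictLower_invFrame_sub_one (hA : ∀ i, IsStrictLower (A i)) (t : Fin d → ℝ) :
    IsStrictLower (invFrame A t - 1) := by
  have hL : IsStrictLower (1 - frameMat A t) := by
    rw [← neg_sub]; exact (isStrictLower_frameMat_sub_one hA t).neg
  rcases Nat.eq_zero_or_pos d with rfl | hd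
  · intro j v hv i; exact i.elim0
  · obtain ⟨k, rfl⟩ := Nat.exists_eq_succ_of_ne_zero hd.ne'
    rw [invFrame, Finset.sum_range_succ', pow_zero, add_sub_cancel_right]
    exact IsStrictLower.sum _ fun n _ => hL.pow (Nat.succ_ne_zero n)

end StrictLower

/-! ### The ordered product and the adjoint action in coordinates -/

section MalcevCoordinates

variable {d : ℕ} {G : Type u} [Group G] [TopologicalSpace G]
  [ChartedSpace (EuclideanSpace ℝ (Fin d)) G]

/-- The coordinates with respect to a basis of the Lie algebra. -/
def basisEquiv (X : Module.Basis (Fin d) ℝ (GroupLieAlgebra (𝓡 d) G)) :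
    EuclideanSpace ℝ (Fin d) ≃L[ℝ] (Fin d → ℝ) :=
  LinearEquiv.toContinuousLinearEquiv
    (show EuclideanSpace ℝ (Fin d) ≃ₗ[ℝ] (Fin d → ℝ) from X.equivFun)

/-- The exponential map in coordinates with respect to a basis. -/
def coExp (X : Module.Basis (Fin d) ℝ (GroupLieAlgebra (𝓡 d) G)) (v : Fin d → ℝ) : G :=
  lieExp (show GroupLieAlgebra (𝓡 d) G from (basisEquiv X).symm v)

/-- The adjoint representation in coordinates with respect to a basis. -/
def coAd (X : Module.Basis (Fin d) ℝ (GroupLieAlgebra (𝓡 d) G)) (g : G) :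
    (Fin d → ℝ) →L[ℝ] (Fin d → ℝ) :=
  ((basisEquiv X : EuclideanSpace ℝ (Fin d) →L[ℝ] (Fin d → ℝ)).comp (lieAd g)).comp
    ((basisEquiv X).symm : (Fin d → ℝ) →L[ℝ] EuclideanSpace ℝ (Fin d))

/-- The operator `ad X_i` in coordinates with respect to the basis `X`. -/
def adMat (X : Module.Basis (Fin d) ℝ (GroupLieAlgebra (𝓡 d) G)) (i : Fin d) :
    (Fin d → ℝ) →L[ℝ] (Fin d → ℝ) :=
  ∑ j : Fin d, (ContinuousLinearMap.proj (R := ℝ) (φ := fun _ : Fin d => ℝ) j).smulRight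
    (X.equivFun ⁅X i, X j⁆)

theorem basisEquiv_symm_single (X : Module.Basis (Fin d) ℝ (GroupLieAlgebra (𝓡 d) G)) (i : Fin d) :
    (basisEquiv X).symm (Pi.single i 1) = (X i : EuclideanSpace ℝ (Fin d)) := by
  have h : X.equivFun.symm (Pi.single i 1) = X i := by
    rw [Module.Basis.equivFun_symm_apply]
    rw [Finset.sum_eq_single i]
    · rw [Pi.single_eq_same, one_smul]
    · intro j _ hj
      rw [Pi.single_eq_of_ne hj, zero_smul]
    · simp
  exact h

theorem coExp_smul (X : Module.Basis (Fin d) ℝ (GroupLieAlgebra (𝓡 d) G)) (s : ℝ) (v : Fin d → ℝ) :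
    coExp X (s • v) =
      lieExp (s • (show GroupLieAlgebra (𝓡 d) G from (basisEquiv X).symm v)) := by
  rw [coExp, map_smul]; rfl

theorem coExp_smul_single (X : Module.Basis (Fin d) ℝ (GroupLieAlgebra (𝓡 d) G)) (s : ℝ)
    (i : Fin d) : coExp X (s • Pi.single i 1) = lieExp (s • X i) := by
  rw [coExp_smul, basisEquiv_symm_single]

variable [LieGroup (𝓡 d) ∞ G]

theorem coAd_one (X : Module.Basis (Fin d) ℝ (GroupLieAlgebra (𝓡 d) G)) : coAd X (1 : G) = 1 := by
  ext1 v
  simp [coAd, lieAd_one]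

variable [T2Space G]
  (X : Module.Basis (Fin d) ℝ (GroupLieAlgebra (𝓡 d) G))

theorem coExp_zero : coExp X 0 = 1 := by
  have := coExp_smul X 0 0
  rwa [zero_smul, lieExp_zero_smul] at this

theorem coExp_add_smul (s t : ℝ) (v : Fin d → ℝ) :
    coExp X ((s + t) • v) = coExp X (s • v) * coExp X (t • v) := by
  simp only [coExp_smul]
  exact lieExp_add_smul _ _ _

theorem conj_coExp (g : G) (v : Fin d → ℝ) :
    g * coExp X v * g⁻¹ = coExp X (coAd X g v) := by
  have h := conj_lieExp g 1 (show GroupLieAlgebra (𝓡 d) G from (basisEquiv X).symm v)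
  rw [one_smul, one_smul] at h
  rw [coExp, h, coExp, coAd]
  simp

theorem coAd_mul (g h : G) : coAd X (g * h) = coAd X g * coAd X h := by
  ext1 v
  simp [coAd, lieAd_mul]

theorem coAd_list_prod (l : List G) : coAd X l.prod = (l.map (coAd X)).prod := by
  induction l with
  | nil => simp [coAd_one]
  | cons a l ih => simp [coAd_mul, ih]

/-- The second conjunct carries powers of ad from the model space to coordinates, so that nilpotency
proved there passes to `adMat`. -/
theorem hasDerivAt_coAd_lieExp (i : Fin d) :
    HasDerivAt (fun t : ℝ => coAd X (lieExp (t • X i))) (adMat X i) 0 ∧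
      ∀ D, HasDerivAt (fun t : ℝ => lieAd (lieExp (t • X i))) D 0 →
        ∀ n, (adMat X i) ^ n =
          ((basisEquiv X : EuclideanSpace ℝ (Fin d) →L[ℝ] (Fin d → ℝ)).comp (D ^ n)).comp
    ((basisEquiv X).symm : (Fin d → ℝ) →L[ℝ] EuclideanSpace ℝ (Fin d)) := by
  obtain ⟨D, hD, hd, -⟩ := exists_lieAd_lieExp (G := G) (X i)
  have e : adMat X i = ((basisEquiv X : EuclideanSpace ℝ (Fin d) →L[ℝ] (Fin d → ℝ)).comp D).comp
    ((basisEquiv X).symm : (Fin d → ℝ) →L[ℝ] EuclideanSpace ℝ (Fin d)) := by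
    refine ContinuousLinearMap.coe_injective ((Pi.basisFun ℝ (Fin d)).ext fun j => ?_)
    have h1 : adMat X i (Pi.single j 1) = X.equivFun ⁅X i, X j⁆ := by
      simp only [adMat, sum_apply, ContinuousLinearMap.smulRight_apply,
        ContinuousLinearMap.proj_apply]
      rw [Finset.sum_eq_single j]
      · rw [Pi.single_eq_same, one_smul]
      · intro k _ hk
        rw [Pi.single_eq_of_ne hk, zero_smul]
      · simp
    rw [Pi.basisFun_apply]
    change adMat X i (Pi.single j 1) = basisEquiv X (D ((basisEquiv X).symm (Pi.single j 1)))
    rw [h1, basisEquiv_symm_single]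
    exact congrArg (basisEquiv X) (hD (show EuclideanSpace ℝ (Fin d) from X j)).symm
  refine ⟨?_, fun D' hD' n => ?_⟩
  · rw [e]
    exact ((ContinuousLinearMap.compL ℝ (Fin d → ℝ) _ (Fin d → ℝ)).flip
      ((basisEquiv X).symm : (Fin d → ℝ) →L[ℝ] EuclideanSpace ℝ (Fin d))).hasFDerivAt.comp_hasDerivAt
        (0 : ℝ) ((ContinuousLinearMap.compL ℝ _ _ (Fin d → ℝ)
          (basisEquiv X : EuclideanSpace ℝ (Fin d) →L[ℝ] (Fin d → ℝ))).hasFDerivAt.comp_hasDerivAt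
            (0 : ℝ) hd)
  · rw [hD'.unique hd]
    induction n with
    | zero => ext1 v; simp
    | succ n ih =>
      rw [pow_succ, ih, e]
      ext1 v
      simp [pow_succ]

theorem coAd_lieExp (i : Fin d) (t : ℝ) :
    coAd X (lieExp (t • X i)) = NormedSpace.exp (t • adMat X i) := by
  refine eq_exp_of_mul (f := fun t => coAd X (lieExp (t • X i))) ?_ (fun s t => ?_)
    (hasDerivAt_coAd_lieExp X i).1 t
  · rw [lieExp_zero_smul, coAd_one]
  · rw [lieExp_add_smul, coAd_mul]

/-- The ideal condition makes ad X_i preserve the tails, hence lower triangular; nilpotency of the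
group then removes its diagonal. -/
theorem isStrictLower_adMat [Group.IsNilpotent G]
    (hX : ∀ j : ℕ, ∀ v : GroupLieAlgebra (𝓡 d) G,
      ∀ w ∈ Submodule.span ℝ (X '' {i : Fin d | j ≤ (i : ℕ)}),
        ⁅v, w⁆ ∈ Submodule.span ℝ (X '' {i : Fin d | j ≤ (i : ℕ)})) (i : Fin d) :
    IsStrictLower (adMat X i) := by
  refine IsStrictLower.of_isNilpotent ?_ ?_
  · intro j v hv k hk
    have hspan : ∀ w ∈ Submodule.span ℝ (X '' {i : Fin d | j ≤ (i : ℕ)}), X.equivFun w k = 0 := by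
      intro w hw
      induction hw using Submodule.span_induction with
      | mem x hx =>
        obtain ⟨l, hl, rfl⟩ := hx
        have : l ≠ k := by rintro rfl; exact absurd hk (not_lt.2 hl)
        simp [this]
      | zero => simp
      | add x y _ _ hx hy => rw [map_add, Pi.add_apply, hx, hy, add_zero]
      | smul a x _ hx => rw [map_smul, Pi.smul_apply, hx, smul_zero]
    simp only [adMat, sum_apply, ContinuousLinearMap.smulRight_apply,
      ContinuousLinearMap.proj_apply, Finset.sum_apply, Pi.smul_apply]
    refine Finset.sum_eq_zero fun l _ => ?_
    by_cases hl : (l : ℕ) < j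
    · rw [hv l hl, zero_smul]
    · rw [hspan _ (hX j _ _ (Submodule.subset_span ⟨l, not_lt.1 hl, rfl⟩)), smul_zero]
  · obtain ⟨D, -, hd, -⟩ := exists_lieAd_lieExp (G := G) (X i)
    obtain ⟨k, hk⟩ := isNilpotent_of_lieAd _ hd
    refine ⟨k, ?_⟩
    rw [(hasDerivAt_coAd_lieExp X i).2 D hd, hk]
    ext1 v
    simp

/-- Perturbing one coordinate of the ordered product is a left multiplication. -/
theorem expProd_add_single (hA : ∀ i, IsStrictLower (adMat X i)) (t : Fin d → ℝ) (j : Fin d)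
    (s : ℝ) :
    expProd X (t + s • Pi.single j 1) =
      coExp X (s • (frameMat (adMat X) t (Pi.single j 1))) * expProd X t := by
  set l := List.ofFn fun i => lieExp (t i • X i) with hl
  have hlen : l.length = d := by simp [hl]
  have hset : (List.ofFn fun i => lieExp ((t + s • (Pi.single j 1 : Fin d → ℝ)) i • X i)) =
      l.set j (lieExp (s • X j) * lieExp (t j • X j)) := by
    refine List.ext_getElem (by simp [hl]) fun n h1 h2 => ?_
    simp only [hl, List.getElem_ofFn, List.getElem_set]
    split_ifs with h
    · subst h
      simp [add_smul, ← lieExp_add_smul, add_comm]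
    · have : (⟨n, by simpa using h1⟩ : Fin d) ≠ j := by
        intro e; exact h (by rw [← e])
      simp [this]
  -- Column j is X_j conjugated by the factors that precede the j-th: an extra exp(s X_j) must be
  -- moved past exactly these to reach the far left.
  have hframe : frameMat (adMat X) t (Pi.single j 1) = coAd X (l.take j).prod (Pi.single j 1) := by
    have h1 : frameMat (adMat X) t (Pi.single j 1) = preMat (adMat X) t j (Pi.single j 1) := by
      simp only [frameMat, sum_apply, ContinuousLinearMap.smulRight_apply,
        ContinuousLinearMap.proj_apply]
      rw [Finset.sum_eq_single j]
      · rw [Pi.single_eq_same, one_smul]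
      · intro k _ hk
        rw [Pi.single_eq_of_ne hk, zero_smul]
      · simp
    rw [h1, preMat, coAd_list_prod, List.map_take, hl, List.map_ofFn]
    congr 4
    ext1 i
    rw [Function.comp_apply, coAd_lieExp, exp_eq_expPoly (hA i)]
  have hprod : expProd X t = (l.take j).prod * (lieExp (t j • X j) * (l.drop (j + 1)).prod) := by
    rw [expProd, ← hl]
    have h1 : l.drop j = lieExp (t j • X j) :: l.drop (j + 1) := by
      rw [List.drop_eq_getElem_cons (by rw [hlen]; exact j.2)]
      simp [hl]
    conv_lhs => rw [← List.take_append_drop j l, List.prod_append, h1, List.prod_cons]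
  rw [hframe, ← map_smul, ← conj_coExp, coExp_smul_single, hprod, expProd, hset, List.prod_set,
    if_pos (by rw [hlen]; exact j.2)]
  simp [mul_assoc]

theorem contMDiff_expProd : ContMDiff 𝓘(ℝ, Fin d → ℝ) (𝓡 d) ∞ (expProd X) := by
  have key : ∀ l : List (Fin d), ContMDiff 𝓘(ℝ, Fin d → ℝ) (𝓡 d) ∞
      fun t : Fin d → ℝ => (l.map fun i => lieExp (t i • X i)).prod := by
    intro l
    induction l with
    | nil => simpa using contMDiff_const
    | cons i l ih =>
      simp only [List.map_cons, List.prod_cons]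
      refine ContMDiff.mul ?_ ih
      exact (contMDiff_lieExp_smul (X i)).comp
        (ContDiff.contMDiff (by fun_prop : ContDiff ℝ ∞ fun t : Fin d → ℝ => t i))
  have := key (List.finRange d)
  simp only [← List.ofFn_eq_map] at this
  exact this

theorem expProd_zero : expProd X 0 = 1 := by
  rw [expProd]
  refine List.prod_eq_one fun x hx => ?_
  obtain ⟨i, rfl⟩ := List.mem_ofFn.1 hx
  exact lieExp_zero_smul _

end MalcevCoordinates

/-! ### Smoothness of Mal'cev coordinates and invariant fields -/

section MalcevCoordinates

variable {d : ℕ} {G : Type u} [Group G] [TopologicalSpace G]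
  [ChartedSpace (EuclideanSpace ℝ (Fin d)) G]
  {X : Module.Basis (Fin d) ℝ (GroupLieAlgebra (𝓡 d) G)}

theorem coords_expProd (hX : ∀ g : G, ∃! t : Fin d → ℝ, expProd X t = g) (t : Fin d → ℝ) :
    coords X (expProd X t) = t :=
  Function.leftInverse_invFun (fun _ t' h => (hX (expProd X t')).unique h rfl) t

theorem expProd_coords (hX : ∀ g : G, ∃! t : Fin d → ℝ, expProd X t = g) (g : G) :
    expProd X (coords X g) = g :=
  Function.rightInverse_invFun (fun g => (hX g).exists) g

variable [LieGroup (𝓡 d) ∞ G] [T2Space G]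

theorem hasDerivAt_coExp_mul {E : Type*} [NormedAddCommGroup E] [NormedSpace ℝ E]
    (X : Module.Basis (Fin d) ℝ (GroupLieAlgebra (𝓡 d) G)) {F : G → E} {h : G}
    (hF : MDifferentiableAt (𝓡 d) 𝓘(ℝ, E) F h) (v : Fin d → ℝ) :
    HasDerivAt (fun s : ℝ => F (coExp X (s • v) * h))
      (tderiv (fun x => F (x * h)) (1 : G) ((basisEquiv X).symm v)) 0 := by
  have hm : MDifferentiableAt (𝓡 d) 𝓘(ℝ, E) (fun x => F (x * h)) (1 : G) :=
    MDifferentiableAt.comp (g := F) (1 : G) (by rwa [one_mul]) (mdifferentiableAt_mul_right' h 1)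
  simp only [coExp_smul]
  exact hasDerivAt_comp_lieExp hm _

/-- It suffices to check coordinate directions, where `expProd_add_single` replaces the coordinate
line by a left translation. Thus `frameMat` converts coordinate fields into right-invariant ones. -/
theorem fderiv_comp_expProd {E : Type*} [NormedAddCommGroup E] [NormedSpace ℝ E]
    (hA : ∀ i, IsStrictLower (adMat X i))
    {F : G → E} {t : Fin d → ℝ} (hF : MDifferentiableAt (𝓡 d) 𝓘(ℝ, E) F (expProd X t)) :
    HasFDerivAt (fun t => F (expProd X t))
      (((tderiv (fun x => F (x * expProd X t)) (1 : G)).comp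
        ((basisEquiv X).symm : (Fin d → ℝ) →L[ℝ] EuclideanSpace ℝ (Fin d))).comp
          (frameMat (adMat X) t)) t := by
  have hd : DifferentiableAt ℝ (fun t => F (expProd X t)) t := by
    rw [← mdifferentiableAt_iff_differentiableAt]
    exact MDifferentiableAt.comp t hF ((contMDiff_expProd X).mdifferentiableAt (by simp))
  refine hd.hasFDerivAt.congr_fderiv ?_
  refine ContinuousLinearMap.coe_injective ((Pi.basisFun ℝ (Fin d)).ext fun j => ?_)
  rw [Pi.basisFun_apply]
  have h1 := hasDerivAt_coExp_mul X hF (frameMat (adMat X) t (Pi.single j 1))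
  simp only [← expProd_add_single X hA t j] at h1
  have hline : HasDerivAt (fun s : ℝ => t + s • (Pi.single j 1 : Fin d → ℝ)) (Pi.single j 1) 0 := by
    simpa using ((hasDerivAt_id (0 : ℝ)).smul_const (Pi.single j 1 : Fin d → ℝ)).const_add t
  have h2 : HasFDerivAt (fun t => F (expProd X t)) (fderiv ℝ (fun t => F (expProd X t)) t)
      (t + (0 : ℝ) • (Pi.single j 1 : Fin d → ℝ)) := by
    rw [zero_smul, add_zero]; exact hd.hasFDerivAt
  have h3 := HasFDerivAt.comp_hasDerivAt (f := fun s : ℝ => t + s • (Pi.single j 1 : Fin d → ℝ))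
    (0 : ℝ) h2 hline
  exact h3.unique h1

/-- Multiplying back by g⁻¹ and applying the chart at 1 recovers the chart at 1, whose derivative is
the identity, so the derivative in question has a left inverse. -/
theorem injective_tderiv_chart_mul (g : G) :
    Function.Injective (tderiv (d := d) (fun x : G => extChartAt (𝓡 d) g (x * g)) (1 : G)) := by
  set ψ := extChartAt (𝓡 d) g with hψ
  set φ := extChartAt (𝓡 d) (1 : G) with hφ
  let H : EuclideanSpace ℝ (Fin d) → EuclideanSpace ℝ (Fin d) := fun y => φ (ψ.symm y * g⁻¹)
  have hsymm : ψ.symm (ψ g) = g := extChartAt_to_inv _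
  have hs : ContMDiffAt 𝓘(ℝ, EuclideanSpace ℝ (Fin d)) (𝓡 d) ∞ ψ.symm (ψ g) :=
    (contMDiffOn_extChartAt_symm (I := 𝓡 d) (n := ∞) g).contMDiffAt
      ((isOpen_extChartAt_target (I := 𝓡 d) g).mem_nhds (mem_extChartAt_target _))
  have hH : DifferentiableAt ℝ H (ψ g) := by
    rw [← mdifferentiableAt_iff_differentiableAt]
    refine ContMDiffAt.mdifferentiableAt (n := ∞) ?_ (by simp)
    refine ContMDiffAt.comp (ψ g) (contMDiffAt_extChartAt' ?_) (hs.mul contMDiffAt_const)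
    rw [hsymm]; simp
  have hF : MDifferentiableAt (𝓡 d) 𝓘(ℝ, EuclideanSpace ℝ (Fin d)) ψ g :=
    mdifferentiableAt_extChartAt (by simp)
  have hF1 : MDifferentiableAt (𝓡 d) 𝓘(ℝ, EuclideanSpace ℝ (Fin d)) (fun x => ψ (x * g)) (1 : G) :=
    MDifferentiableAt.comp (g := ψ) (1 : G) (by rwa [one_mul]) (mdifferentiableAt_mul_right' g 1)
  have : IsTopologicalGroup G := topologicalGroup_of_lieGroup (𝓡 d) ∞
  have hinv : ∀ v : EuclideanSpace ℝ (Fin d),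
      fderiv ℝ H (ψ g) (tderiv (fun x : G => ψ (x * g)) (1 : G) v) = v := by
    intro v
    let v' : GroupLieAlgebra (𝓡 d) G := v
    have h1 := hasDerivAt_comp_lieExp hF1 v'
    have h2 : HasFDerivAt H (fderiv ℝ H (ψ g)) (ψ (lieExp ((0 : ℝ) • v') * g)) := by
      rw [lieExp_zero_smul, one_mul]; exact hH.hasFDerivAt
    have h3 := h2.comp_hasDerivAt (0 : ℝ) h1
    refine h3.unique ((hasDerivAt_chart_lieExp_zero v').congr_of_eventuallyEq ?_)
    have hc : ContinuousAt (fun s : ℝ => lieExp (s • v') * g) 0 :=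
      (continuous_lieExp_smul v').continuousAt.mul continuousAt_const
    have hev : ∀ᶠ s : ℝ in 𝓝 0, lieExp (s • v') * g ∈ ψ.source := hc.eventually
      ((isOpen_extChartAt_source (I := 𝓡 d) g).mem_nhds (by
        simp only [lieExp_zero_smul, one_mul]; exact mem_extChartAt_source _))
    filter_upwards [hev] with s hs
    simp only [Function.comp_apply, H]
    rw [ψ.left_inv hs, mul_inv_cancel_right]
  intro v w hvw
  rw [← hinv v, hvw, hinv]

/-- In a chart the derivative of `expProd X` is injective, as a composition of injective maps, hence
an isomorphism by dimension. The inverse function theorem gives a smooth local inverse, which agrees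
with `coords X` because `expProd X` is bijective. -/
theorem contMDiff_coords (hA : ∀ i, IsStrictLower (adMat X i))
    (hX : ∀ g : G, ∃! t : Fin d → ℝ, expProd X t = g) :
    ContMDiff (𝓡 d) 𝓘(ℝ, Fin d → ℝ) ∞ (coords X) := by
  have hinj : Function.Injective (expProd X) := fun t t' h => (hX (expProd X t')).unique h rfl
  have hleft : ∀ t, coords X (expProd X t) = t := Function.leftInverse_invFun hinj
  intro g
  obtain ⟨t, ht, -⟩ := hX g
  set ψ := extChartAt (𝓡 d) g with hψ
  have hF : MDifferentiableAt (𝓡 d) 𝓘(ℝ, EuclideanSpace ℝ (Fin d)) ψ (expProd X t) := by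
    rw [ht]; exact mdifferentiableAt_extChartAt (by simp)
  have hd := fderiv_comp_expProd hA hF
  set L := ((tderiv (fun x => ψ (x * expProd X t)) (1 : G)).comp
        ((basisEquiv X).symm : (Fin d → ℝ) →L[ℝ] EuclideanSpace ℝ (Fin d))).comp
          (frameMat (adMat X) t) with hL
  have hLinj : Function.Injective L := by
    have h1 : Function.Injective (frameMat (adMat X) t) := by
      intro v w hvw
      have := congrArg (invFrame (adMat X) t) hvw
      rwa [← mul_apply_eq_comp, ← mul_apply_eq_comp, invFrame_mul_frameMat hA,
        one_apply_eq_self, one_apply_eq_self] at this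
    have h2 := injective_tderiv_chart_mul (d := d) g
    rw [← hψ] at h2
    rw [hL, ht]
    exact (h2.comp (basisEquiv X).symm.injective).comp h1
  let e : (Fin d → ℝ) ≃L[ℝ] EuclideanSpace ℝ (Fin d) :=
    (LinearEquiv.ofInjectiveOfFinrankEq (L : (Fin d → ℝ) →ₗ[ℝ] EuclideanSpace ℝ (Fin d)) hLinj
      (by simp)).toContinuousLinearEquiv
  have he : (e : (Fin d → ℝ) →L[ℝ] EuclideanSpace ℝ (Fin d)) = L := by
    ext1 v; rfl
  have hf : ContDiffAt ℝ ∞ (fun t => ψ (expProd X t)) t := by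
    rw [← contMDiffAt_iff_contDiffAt]
    refine ContMDiffAt.comp t (contMDiffAt_extChartAt' ?_) (contMDiff_expProd X).contMDiffAt
    rw [ht]; simp
  rw [← he] at hd
  have hloc := hf.to_localInverse hd (by simp)
  have hstrict := hf.hasStrictFDerivAt' hd (by simp)
  have hright := hstrict.eventually_right_inverse
  set ℓ := hstrict.localInverse (fun t => ψ (expProd X t)) e t with hℓ
  rw [ht] at hright
  have hψc : ContinuousAt ψ g := continuousAt_extChartAt g
  have hℓ0 : ℓ (ψ g) = t := by
    have := hstrict.localInverse_apply_image
    rwa [ht] at this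
  have hloc' : ContDiffAt ℝ ∞ ℓ (ψ g) := by
    have := hloc
    rwa [ht] at this
  have hcomp : ContinuousAt (fun g' => expProd X (ℓ (ψ g'))) g :=
    ((contMDiff_expProd X).continuous.continuousAt).comp (hloc'.continuousAt.comp hψc)
  have hsrc : ∀ᶠ g' in 𝓝 g, expProd X (ℓ (ψ g')) ∈ ψ.source := hcomp.eventually
    ((isOpen_extChartAt_source (I := 𝓡 d) g).mem_nhds (by
      simp only [hℓ0, ht]; exact mem_extChartAt_source _))
  have hψm : ContMDiffAt (𝓡 d) 𝓘(ℝ, EuclideanSpace ℝ (Fin d)) ∞ ψ g :=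
    contMDiffAt_extChartAt' (by simp)
  refine (ContMDiffAt.comp g hloc'.contMDiffAt hψm).congr_of_eventuallyEq ?_
  filter_upwards [hψc.eventually hright, hsrc, extChartAt_source_mem_nhds (I := 𝓡 d) g]
    with g' h1 h2 h3
  have h4 : expProd X (ℓ (ψ g')) = g' := ψ.injOn h2 h3 h1
  rw [Function.comp_apply, ← hleft (ℓ (ψ g')), h4]

/-- For F = `coords X`, `fderiv_comp_expProd` expresses the identity as this derivative composed
with `frameMat`. So the columns of `invFrame` are the right-invariant fields in coordinates. -/
theorem tderiv_coords_mul (hA : ∀ i, IsStrictLower (adMat X i))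
    (hX : ∀ g : G, ∃! t : Fin d → ℝ, expProd X t = g) (h : G) (v : Fin d → ℝ) :
    tderiv (fun x => coords X (x * h)) (1 : G) ((basisEquiv X).symm v) =
      invFrame (adMat X) (coords X h) v := by
  have h1 := fderiv_comp_expProd hA (F := coords X) (t := coords X h)
    ((contMDiff_coords hA hX).mdifferentiableAt (by simp))
  simp only [coords_expProd hX, expProd_coords hX] at h1
  have h2 := h1.unique (hasFDerivAt_id _)
  have h3 := DFunLike.congr_fun h2 (invFrame (adMat X) (coords X h) v)
  simp only [ContinuousLinearMap.comp_apply] at h3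
  rw [← mul_apply_eq_comp, frameMat_mul_invFrame hA, one_apply_eq_self] at h3
  exact h3

theorem hasDerivAt_coords_coExp_mul (hA : ∀ i, IsStrictLower (adMat X i))
    (hX : ∀ g : G, ∃! t : Fin d → ℝ, expProd X t = g) (h : G) (v : Fin d → ℝ) (s : ℝ) :
    HasDerivAt (fun s : ℝ => coords X (coExp X (s • v) * h))
      (invFrame (adMat X) (coords X (coExp X (s • v) * h)) v) s := by
  have h1 := hasDerivAt_coExp_mul X (F := coords X)
    ((contMDiff_coords hA hX).mdifferentiableAt (by simp)) (h := coExp X (s • v) * h) v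
  rw [tderiv_coords_mul hA hX, ← sub_self s] at h1
  have h2 := HasDerivAt.comp_sub_const s s h1
  simp only [← mul_assoc, ← coExp_add_smul, sub_add_cancel] at h2
  exact h2

end MalcevCoordinates

/-! ### Haar measure in Mal'cev coordinates -/

section MalcevMeasure

variable {d : ℕ} {G : Type u} [Group G] [TopologicalSpace G]
  [ChartedSpace (EuclideanSpace ℝ (Fin d)) G]
  {X : Module.Basis (Fin d) ℝ (GroupLieAlgebra (𝓡 d) G)}

/-- Left translation in Mal'cev coordinates. -/
def coTrans (X : Module.Basis (Fin d) ℝ (GroupLieAlgebra (𝓡 d) G)) (g : G) (t : Fin d → ℝ) :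
    Fin d → ℝ :=
  coords X (g * expProd X t)

theorem coTrans_coTrans (hX : ∀ g : G, ∃! t : Fin d → ℝ, expProd X t = g) (g h : G)
    (t : Fin d → ℝ) : coTrans X g (coTrans X h t) = coTrans X (g * h) t := by
  simp only [coTrans, expProd_coords hX, mul_assoc]

theorem coTrans_one (hX : ∀ g : G, ∃! t : Fin d → ℝ, expProd X t = g) (t : Fin d → ℝ) :
    coTrans X 1 t = t := by
  simp only [coTrans, one_mul, coords_expProd hX]

variable [LieGroup (𝓡 d) ∞ G] [T2Space G]

theorem isStrictLower_coAd_sub_one (hA : ∀ i, IsStrictLower (adMat X i))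
    (hX : ∀ g : G, ∃! t : Fin d → ℝ, expProd X t = g) (g : G) :
    IsStrictLower (coAd X g - 1) := by
  rw [← expProd_coords hX g, expProd, coAd_list_prod]
  refine IsStrictLower.list_prod_sub_one _ fun S hS => ?_
  obtain ⟨x, hx, rfl⟩ := List.mem_map.1 hS
  obtain ⟨i, rfl⟩ := List.mem_ofFn.1 hx
  rw [coAd_lieExp, exp_eq_expPoly (hA i)]
  exact isStrictLower_expPoly_sub_one (hA i) _

theorem contMDiff_coords_mul_left (hA : ∀ i, IsStrictLower (adMat X i))
    (hX : ∀ g : G, ∃! t : Fin d → ℝ, expProd X t = g) (g : G) :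
    ContMDiff (𝓡 d) 𝓘(ℝ, Fin d → ℝ) ∞ (fun x => coords X (g * x)) :=
  (contMDiff_coords hA hX).comp contMDiff_mul_left

/-- Left translation by g sends the right-invariant field of v to that of Ad_g v. Reading from the
right, the factors pass to invariant fields, apply Ad_g, and return to coordinates at the image
point. -/
theorem hasFDerivAt_coTrans (hA : ∀ i, IsStrictLower (adMat X i))
    (hX : ∀ g : G, ∃! t : Fin d → ℝ, expProd X t = g) (g : G) (t : Fin d → ℝ) :
    HasFDerivAt (coTrans X g)
      (invFrame (adMat X) (coTrans X g t) * coAd X g * frameMat (adMat X) t) t := by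
  have hF : MDifferentiableAt (𝓡 d) 𝓘(ℝ, Fin d → ℝ) (fun x => coords X (g * x)) (expProd X t) :=
    (contMDiff_coords_mul_left hA hX g).mdifferentiableAt (by simp)
  refine (fderiv_comp_expProd hA hF).congr_fderiv ?_
  ext1 v
  have h1 := hasDerivAt_coExp_mul X hF (frameMat (adMat X) t v)
  have h2 := hasDerivAt_coords_coExp_mul hA hX (g * expProd X t)
    (coAd X g (frameMat (adMat X) t v)) 0
  rw [zero_smul, coExp_zero, one_mul] at h2
  refine h1.unique (h2.congr_of_eventuallyEq (Eventually.of_forall fun s => ?_))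
  have h3 := conj_coExp X g (s • frameMat (adMat X) t v)
  simp only [map_smul] at h3
  simp only [← h3, mul_assoc, inv_mul_cancel_left]

theorem det_hasFDerivAt_coTrans (hA : ∀ i, IsStrictLower (adMat X i))
    (hX : ∀ g : G, ∃! t : Fin d → ℝ, expProd X t = g) (g : G) (t : Fin d → ℝ) :
    (invFrame (adMat X) (coTrans X g t) * coAd X g * frameMat (adMat X) t).det = 1 :=
  IsStrictLower.det_eq_one (IsStrictLower.mul_of_sub_one (IsStrictLower.mul_of_sub_one
    (isStrictLower_invFrame_sub_one hA _) (isStrictLower_coAd_sub_one hA hX g))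
    (isStrictLower_frameMat_sub_one hA t))

theorem continuous_coTrans (hA : ∀ i, IsStrictLower (adMat X i))
    (hX : ∀ g : G, ∃! t : Fin d → ℝ, expProd X t = g) (g : G) : Continuous (coTrans X g) :=
  continuous_iff_continuousAt.2 fun t => (hasFDerivAt_coTrans hA hX g t).continuousAt

/-- The Jacobian is a product of three unipotent lower triangular operators, so it has determinant 1
and the change of variables formula has no weight. -/
theorem map_coTrans_volume (hA : ∀ i, IsStrictLower (adMat X i))
    (hX : ∀ g : G, ∃! t : Fin d → ℝ, expProd X t = g) (g : G) :
    Measure.map (coTrans X g) (volume : Measure (Fin d → ℝ)) = volume := by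
  ext s hs
  rw [Measure.map_apply (continuous_coTrans hA hX g).measurable hs]
  have h1 : coTrans X g ⁻¹' s = coTrans X g⁻¹ '' s := by
    ext t
    constructor
    · intro ht
      exact ⟨_, ht, by rw [coTrans_coTrans hX, inv_mul_cancel, coTrans_one hX]⟩
    · rintro ⟨t, ht, rfl⟩
      rwa [mem_preimage, coTrans_coTrans hX, mul_inv_cancel, coTrans_one hX]
  have hinj : Function.Injective (coTrans X g⁻¹) := by
    refine Function.LeftInverse.injective (g := coTrans X g) fun t => ?_
    rw [coTrans_coTrans hX, mul_inv_cancel, coTrans_one hX]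
  rw [h1, ← lintegral_abs_det_fderiv_eq_addHaar_image volume hs
    (fun t _ => (hasFDerivAt_coTrans hA hX g⁻¹ t).hasFDerivWithinAt) hinj.injOn]
  simp [det_hasFDerivAt_coTrans hA hX]

/-- Mal'cev coordinates as a homeomorphism. -/
def expProdHomeomorph (hA : ∀ i, IsStrictLower (adMat X i))
    (hX : ∀ g : G, ∃! t : Fin d → ℝ, expProd X t = g) : (Fin d → ℝ) ≃ₜ G where
  toFun := expProd X
  invFun := coords X
  left_inv := coords_expProd hX
  right_inv := expProd_coords hX
  continuous_toFun := (contMDiff_expProd X).continuous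
  continuous_invFun := (contMDiff_coords hA hX).continuous

variable [MeasurableSpace G] [BorelSpace G]

theorem isHaarMeasure_map_expProd (hA : ∀ i, IsStrictLower (adMat X i))
    (hX : ∀ g : G, ∃! t : Fin d → ℝ, expProd X t = g) :
    (Measure.map (expProd X) (volume : Measure (Fin d → ℝ))).IsHaarMeasure := by
  have : IsTopologicalGroup G := topologicalGroup_of_lieGroup (𝓡 d) ∞
  have hE : Measurable (expProd X) := (contMDiff_expProd X).continuous.measurable
  have h1 : IsFiniteMeasureOnCompacts (Measure.map (expProd X) (volume : Measure (Fin d → ℝ))) :=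
    Measure.IsFiniteMeasureOnCompacts.map volume (expProdHomeomorph hA hX)
  have h2 : (Measure.map (expProd X) (volume : Measure (Fin d → ℝ))).IsOpenPosMeasure :=
    (contMDiff_expProd X).continuous.isOpenPosMeasure_map (expProdHomeomorph hA hX).surjective
  have h3 : (Measure.map (expProd X) (volume : Measure (Fin d → ℝ))).IsMulLeftInvariant := by
    refine ⟨fun g => ?_⟩
    have hg : Measurable (fun x : G => g * x) := (continuous_const_mul g).measurable
    have hT := (continuous_coTrans hA hX g).measurable
    rw [Measure.map_map hg hE]
    conv_rhs => rw [← map_coTrans_volume hA hX g, Measure.map_map hE hT]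
    congr 1
    ext t
    simp only [Function.comp_apply, coTrans, expProd_coords hX]
  exact { }

theorem exists_eq_smul_map_expProd [SecondCountableTopology G] (hA : ∀ i, IsStrictLower (adMat X i))
    (hX : ∀ g : G, ∃! t : Fin d → ℝ, expProd X t = g) (μ : Measure G) [μ.IsHaarMeasure] :
    ∃ c : ℝ≥0∞, c ≠ 0 ∧ c ≠ ⊤ ∧
      μ = c • Measure.map (expProd X) (volume : Measure (Fin d → ℝ)) := by
  have : IsTopologicalGroup G := topologicalGroup_of_lieGroup (𝓡 d) ∞
  have : LocallyCompactSpace G := (expProdHomeomorph hA hX).symm.isClosedEmbedding.locallyCompactSpace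
  have := isHaarMeasure_map_expProd hA hX
  refine ⟨Measure.haarScalarFactor μ (Measure.map (expProd X) volume), ?_, by simp, ?_⟩
  · have := Measure.haarScalarFactor_pos_of_isHaarMeasure μ (Measure.map (expProd X) volume)
    simpa using this.ne'
  · exact Measure.isMulLeftInvariant_eq_smul _ _

/-- The box has Lebesgue volume 1, so conditioning divides out exactly the unknown Haar scalar c. -/
theorem nilMeasure_eq [SecondCountableTopology G] (hA : ∀ i, IsStrictLower (adMat X i))
    (hX : ∀ g : G, ∃! t : Fin d → ℝ, expProd X t = g) (μ : Measure G) [μ.IsHaarMeasure] :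
    nilMeasure X μ = Measure.map (expProd X)
      ((volume : Measure (Fin d → ℝ)).restrict (Set.univ.pi fun _ => Ico (-(1 / 2)) (1 / 2))) := by
  obtain ⟨c, hc0, hc, rfl⟩ := exists_eq_smul_map_expProd hA hX μ
  have hE : Measurable (expProd X) := (contMDiff_expProd X).continuous.measurable
  have hpre : expProd X ⁻¹' fundDomain X = Set.univ.pi fun _ => Ico (-(1 / 2)) (1 / 2) := by
    ext t
    simp [fundDomain, coords_expProd hX]
  have hD : MeasurableSet (fundDomain X) := by
    have : fundDomain X = coords X ⁻¹' (Set.univ.pi fun _ => Ico (-(1 / 2)) (1 / 2)) := by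
      ext t
      simp [fundDomain]
    rw [this]
    exact (contMDiff_coords hA hX).continuous.measurable
      (MeasurableSet.univ_pi fun _ => measurableSet_Ico)
  have hvol : (c • Measure.map (expProd X) (volume : Measure (Fin d → ℝ))) (fundDomain X) = c := by
    rw [Measure.smul_apply, Measure.map_apply hE hD, hpre, Real.volume_pi_Ico]
    norm_num
  rw [nilMeasure, ProbabilityTheory.cond, hvol, Measure.restrict_smul, smul_smul,
    ENNReal.inv_mul_cancel hc0 hc, one_smul, Measure.restrict_map hE hD, hpre]

end MalcevMeasure

/-! ### Uniqueness of representatives in the fundamental domain -/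

section FundamentalDomain

variable {d : ℕ} {G : Type u} [Group G] [TopologicalSpace G]
  [ChartedSpace (EuclideanSpace ℝ (Fin d)) G] [LieGroup (𝓡 d) ∞ G] [T2Space G]
  {X : Module.Basis (Fin d) ℝ (GroupLieAlgebra (𝓡 d) G)}

/-- Along s ↦ g exp(s X_k) the coordinates move with velocity `invFrame` · Ad_g e_k. As both
operators are unipotent, this is e_k up to positions beyond k, so coordinates i ≤ k change as in
ℝ^d. -/
theorem coords_mul_lieExp (hA : ∀ i, IsStrictLower (adMat X i))
    (hX : ∀ g : G, ∃! t : Fin d → ℝ, expProd X t = g) (g : G) (k i : Fin d)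
    (hik : (i : ℕ) < k + 1) (s : ℝ) :
    coords X (g * lieExp (s • X k)) i = coords X g i + s * (Pi.single k 1 : Fin d → ℝ) i := by
  have h1 : ∀ s : ℝ, g * coExp X (s • Pi.single k 1) =
      coExp X (s • coAd X g (Pi.single k 1)) * g := fun s => by
    rw [← map_smul, ← conj_coExp, inv_mul_cancel_right]
  have h2 : ∀ s : ℝ, HasDerivAt (fun s : ℝ => coords X (g * coExp X (s • Pi.single k 1)) i -
      s * (Pi.single k 1 : Fin d → ℝ) i) 0 s := fun s => by
    have h3 := hasDerivAt_pi.1 (hasDerivAt_coords_coExp_mul hA hX g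
      (coAd X g (Pi.single k 1)) s) i
    simp only [← h1] at h3
    refine (h3.sub ((hasDerivAt_id s).mul_const _)).congr_deriv ?_
    rw [one_mul, ← mul_apply_eq_comp]
    have h4 := IsStrictLower.mul_of_sub_one
      (isStrictLower_invFrame_sub_one hA (coords X (g * coExp X (s • Pi.single k 1))))
      (isStrictLower_coAd_sub_one hA hX g) k (Pi.single k 1)
      (fun l hl => Pi.single_eq_of_ne (by rintro rfl; omega) _) i hik
    simpa using h4
  have h5 := is_const_of_deriv_eq_zero (fun s => (h2 s).differentiableAt)
    (fun s => (h2 s).deriv) s 0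
  simp only [zero_smul, coExp_zero, mul_one, zero_mul, sub_zero, coExp_smul_single] at h5
  linarith

/-- Multiply by the factors of h one at a time: those before i are trivial, the i-th adds its
parameter, and the later ones leave coordinate i alone. -/
theorem coords_mul_of_forall_lt (hA : ∀ i, IsStrictLower (adMat X i))
    (hX : ∀ g : G, ∃! t : Fin d → ℝ, expProd X t = g) (g h : G) (i : Fin d)
    (hh : ∀ k < i, coords X h k = 0) :
    coords X (g * h) i = coords X g i + coords X h i := by
  set t := coords X h with ht
  have key : ∀ (l : List (Fin d)) (g : G),
      coords X (g * (l.map fun k => lieExp (t k • X k)).prod) i =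
        coords X g i + (l.map fun k => t k * (Pi.single k 1 : Fin d → ℝ) i).sum := by
    intro l
    induction l with
    | nil => simp
    | cons k l ih =>
      intro g
      rw [List.map_cons, List.prod_cons, ← mul_assoc, ih, List.map_cons, List.sum_cons, ← add_assoc]
      congr 1
      by_cases hk : k < i
      · rw [hh k hk, lieExp_zero_smul, mul_one, zero_mul, add_zero]
      · exact coords_mul_lieExp hA hX g k i (by rw [not_lt] at hk; exact Nat.lt_succ_of_le hk) _
  have h1 := key (List.finRange d) g
  simp only [← List.ofFn_eq_map] at h1
  change coords X (g * expProd X t) i = _ at h1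
  rw [ht, expProd_coords hX, ← ht] at h1
  rw [h1, List.sum_ofFn]
  simp [Pi.single_apply]

/-- Coordinates of γ vanish one after another: once the earlier ones are 0, the next is an integer
that is the difference of two numbers in [-1/2, 1/2). -/
theorem eq_one_of_mem_fundDomain (hA : ∀ i, IsStrictLower (adMat X i)) {Γ : Subgroup G}
    (hX : IsMalcevBasis Γ X) {g γ : G} (hγ : γ ∈ Γ) (hg : g ∈ fundDomain X)
    (hgγ : g * γ ∈ fundDomain X) : γ = 1 := by
  have hZ : ∀ i, ∃ n : ℤ, coords X γ i = n := by
    rw [← hX.mem_lattice_iff, expProd_coords hX.existsUnique_coord]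
    exact hγ
  have h0 : ∀ n : ℕ, ∀ i : Fin d, (i : ℕ) < n → coords X γ i = 0 := by
    intro n
    induction n with
    | zero => intro i hi; omega
    | succ n ih =>
      intro i hi
      have h1 := coords_mul_of_forall_lt hA hX.existsUnique_coord g γ i
        (fun k hk => ih k (by have : (k : ℕ) < i := hk; omega))
      obtain ⟨z, hz⟩ := hZ i
      have h2 := hg i
      have h3 := hgγ i
      rw [h1, hz] at h3
      rw [hz]
      have h4 : (-1 : ℝ) < z := by linarith [h2.2, h3.1]
      have h5 : (z : ℝ) < 1 := by linarith [h2.1, h3.2]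
      have h6 : -1 < z := by exact_mod_cast h4
      have h7 : z < 1 := by exact_mod_cast h5
      have : z = 0 := by omega
      simp [this]
  have : coords X γ = 0 := funext fun i => h0 d i i.2
  rw [← expProd_coords hX.existsUnique_coord γ, this, expProd_zero]

theorem eq_of_mem_fundDomain (hA : ∀ i, IsStrictLower (adMat X i)) {Γ : Subgroup G}
    (hX : IsMalcevBasis Γ X) {g h : G} (hg : g ∈ fundDomain X) (hh : h ∈ fundDomain X)
    (hgh : (g : G ⧸ Γ) = h) : g = h := by
  have h1 := eq_one_of_mem_fundDomain hA hX (QuotientGroup.eq.1 hgh) hg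
    (by rwa [mul_inv_cancel_left])
  exact inv_mul_eq_one.1 h1

end FundamentalDomain

/-! ### Geometric bounds for partial derivatives -/

section DerivBound

variable {d : ℕ} {E E' : Type*} [NormedAddCommGroup E] [NormedSpace ℝ E]
  [NormedAddCommGroup E'] [NormedSpace ℝ E']

/-- The `j`-th partial derivative. -/
def pderiv (j : Fin d) (f : (Fin d → ℝ) → E) (t : Fin d → ℝ) : E :=
  fderiv ℝ f t (Pi.single j 1)

theorem contDiff_pderiv {f : (Fin d → ℝ) → E} (hf : ContDiff ℝ ∞ f) (j : Fin d) :
    ContDiff ℝ ∞ (pderiv j f) :=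
  (hf.fderiv_right (m := ∞) (by simp)).clm_apply contDiff_const

/-- On the unit ball, all partial derivatives of order `n ≤ r` are at most `B * Λ ^ n`. -/
def DerivBound : ℕ → ℝ → ℝ → ((Fin d → ℝ) → E) → Prop
  | 0, B, _, f => ∀ t, ‖t‖ ≤ 1 → ‖f t‖ ≤ B
  | r + 1, B, Λ, f => (∀ t, ‖t‖ ≤ 1 → ‖f t‖ ≤ B) ∧ ∀ j, DerivBound r (B * Λ) Λ (pderiv j f)

namespace DerivBound

variable {r : ℕ} {B B' Λ Λ' : ℝ} {f g : (Fin d → ℝ) → E}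

theorem norm_le (h : DerivBound r B Λ f) : ∀ t, ‖t‖ ≤ 1 → ‖f t‖ ≤ B := by
  cases r with
  | zero => exact h
  | succ r => exact h.1

theorem nonneg (h : DerivBound r B Λ f) : 0 ≤ B :=
  (norm_nonneg _).trans (h.norm_le 0 (by simp))

theorem mono (h : DerivBound r B Λ f) (hΛ : 0 ≤ Λ) (hB : B ≤ B') (hL : Λ ≤ Λ') :
    DerivBound r B' Λ' f := by
  induction r generalizing f B B' with
  | zero => exact fun t ht => (h t ht).trans hB
  | succ r ih =>
    refine ⟨fun t ht => (h.1 t ht).trans hB, fun j => ih (h.2 j) ?_⟩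
    have := h.nonneg
    have := this.trans hB
    gcongr

theorem of_succ (h : DerivBound (r + 1) B Λ f) : DerivBound r B Λ f := by
  induction r generalizing f B with
  | zero => exact h.1
  | succ r ih => exact ⟨h.1, fun j => ih (h.2 j)⟩

theorem const (c : E) (hΛ : 0 ≤ Λ) : DerivBound r ‖c‖ Λ fun _ : Fin d → ℝ => c := by
  have h0 : ∀ j, pderiv j (fun _ : Fin d → ℝ => c) = fun _ => 0 := fun j => by
    ext t; simp [pderiv]
  have hz : ∀ r B, 0 ≤ B → DerivBound r B Λ fun _ : Fin d → ℝ => (0 : E) := by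
    intro r
    induction r with
    | zero => intro B hB t _; simpa
    | succ r ih =>
      refine fun B hB => ⟨fun t _ => by simpa, fun j => ?_⟩
      have : pderiv j (fun _ : Fin d → ℝ => (0 : E)) = fun _ => 0 := by ext t; simp [pderiv]
      rw [this]
      exact ih _ (by positivity)
  cases r with
  | zero => exact fun t _ => le_rfl
  | succ r =>
    refine ⟨fun t _ => le_rfl, fun j => ?_⟩
    rw [h0]
    exact hz _ _ (by positivity)

theorem add (hf : ContDiff ℝ ∞ f) (hg : ContDiff ℝ ∞ g) (h : DerivBound r B Λ f)
    (h' : DerivBound r B' Λ g) : DerivBound r (B + B') Λ fun t => f t + g t := by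
  induction r generalizing f g B B' with
  | zero => exact fun t ht => (norm_add_le _ _).trans (add_le_add (h t ht) (h' t ht))
  | succ r ih =>
    refine ⟨fun t ht => (norm_add_le _ _).trans (add_le_add (h.1 t ht) (h'.1 t ht)), fun j => ?_⟩
    have e : pderiv j (fun t => f t + g t) = fun t => pderiv j f t + pderiv j g t := by
      ext1 t
      rw [pderiv, fderiv_fun_add (hf.differentiable (by simp) t) (hg.differentiable (by simp) t)]
      rfl
    rw [e, add_mul]
    exact ih (contDiff_pderiv hf j) (contDiff_pderiv hg j) (h.2 j) (h'.2 j)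

theorem sum {ι : Type*} (s : Finset ι) {f : ι → (Fin d → ℝ) → E} (hΛ : 0 ≤ Λ)
    (hf : ∀ i ∈ s, ContDiff ℝ ∞ (f i)) (h : ∀ i ∈ s, DerivBound r B Λ (f i)) :
    DerivBound r (s.card * B) Λ fun t => ∑ i ∈ s, f i t := by
  classical
  induction s using Finset.induction_on with
  | empty => simpa using const (r := r) (d := d) (0 : E) hΛ
  | insert a s ha ih =>
    simp only [Finset.sum_insert ha]
    rw [Finset.card_insert_of_notMem ha]
    have e : ((s.card + 1 : ℕ) : ℝ) * B = B + s.card * B := by push_cast; ring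
    rw [e]
    exact add (hf a (by simp)) (ContDiff.sum fun i hi => hf i (by simp [hi])) (h a (by simp))
      (ih (fun i hi => hf i (by simp [hi])) fun i hi => h i (by simp [hi]))

theorem clm_comp (L : E →L[ℝ] E') (hf : ContDiff ℝ ∞ f) (h : DerivBound r B Λ f) :
    DerivBound r (‖L‖ * B) Λ fun t => L (f t) := by
  have hb : ∀ B, (∀ t, ‖t‖ ≤ 1 → ‖f t‖ ≤ B) → ∀ t, ‖t‖ ≤ 1 → ‖L (f t)‖ ≤ ‖L‖ * B :=
    fun B hB t ht => (L.le_opNorm _).trans (by gcongr; exact hB t ht)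
  induction r generalizing f B with
  | zero => exact hb B h
  | succ r ih =>
    refine ⟨hb B h.1, fun j => ?_⟩
    have e : pderiv j (fun t => L (f t)) = fun t => L (pderiv j f t) := by
      ext1 t
      have := (L.hasFDerivAt.comp t (hf.differentiable (by simp) t).hasFDerivAt).fderiv
      exact DFunLike.congr_fun this _
    rw [e, mul_assoc]
    refine ih (contDiff_pderiv hf j) (h.2 j) fun B hB t ht => ?_
    exact (L.le_opNorm _).trans (by gcongr; exact hB t ht)

section Algebra

variable {𝔸 : Type*} [NormedRing 𝔸] [NormedAlgebra ℝ 𝔸] {a b : (Fin d → ℝ) → 𝔸}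

/-- The Leibniz rule bounds order-n derivatives by B B' Σ (n choose k) Λ^k Λ'^(n-k) = B B' (Λ +
Λ')^n. The rates add and no combinatorial factor remains, which is the reason for bounds of this
geometric form. -/
theorem mul (hf : ContDiff ℝ ∞ a) (hg : ContDiff ℝ ∞ b)
    (h : DerivBound r B Λ a) (h' : DerivBound r B' Λ' b) :
    DerivBound r (B * B') (Λ + Λ') fun t => a t * b t := by
  have hb : ∀ (B B' : ℝ) (a b : (Fin d → ℝ) → 𝔸), (∀ t, ‖t‖ ≤ 1 → ‖a t‖ ≤ B) →
      (∀ t, ‖t‖ ≤ 1 → ‖b t‖ ≤ B') → ∀ t, ‖t‖ ≤ 1 → ‖a t * b t‖ ≤ B * B' :=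
    fun B B' a b h h' t ht => (norm_mul_le _ _).trans
      (mul_le_mul (h t ht) (h' t ht) (norm_nonneg _) ((norm_nonneg _).trans (h t ht)))
  induction r generalizing a b B B' with
  | zero => exact hb _ _ _ _ h h'
  | succ r ih =>
    refine ⟨hb _ _ _ _ h.1 h'.1, fun j => ?_⟩
    have e : pderiv j (fun t => a t * b t) = fun t => a t * pderiv j b t + pderiv j a t * b t := by
      ext1 t
      rw [pderiv, fderiv_fun_mul' (hf.differentiable (by simp) t) (hg.differentiable (by simp) t)]
      simp [pderiv]
    have e' : B * B' * (Λ + Λ') = B * (B' * Λ') + B * Λ * B' := by ring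
    rw [e, e']
    exact add (hf.mul (contDiff_pderiv hg j)) ((contDiff_pderiv hf j).mul hg)
      (ih hf (contDiff_pderiv hg j) h.of_succ (h'.2 j))
      (ih (contDiff_pderiv hf j) hg (h.2 j) h'.of_succ)

theorem pow (h1 : ‖(1 : 𝔸)‖ ≤ 1) (hf : ContDiff ℝ ∞ a) (h : DerivBound r B Λ a) (n : ℕ) :
    DerivBound r (B ^ n) (n * Λ) fun t => a t ^ n := by
  induction n with
  | zero => simpa using (const (r := r) (d := d) (1 : 𝔸) le_rfl).mono le_rfl h1 le_rfl
  | succ n ih =>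
    simp only [pow_succ]
    have e : ((n + 1 : ℕ) : ℝ) * Λ = n * Λ + Λ := by push_cast; ring
    rw [e]
    exact mul (hf.pow n) hf ih h

theorem list_prod (h1 : ‖(1 : 𝔸)‖ ≤ 1) (l : List ((Fin d → ℝ) → 𝔸))
    (hf : ∀ a ∈ l, ContDiff ℝ ∞ a) (h : ∀ a ∈ l, DerivBound r B Λ a) :
    ContDiff ℝ ∞ (fun t => (l.map fun a => a t).prod) ∧
      DerivBound r (B ^ l.length) (l.length * Λ) fun t => (l.map fun a => a t).prod := by
  induction l with
  | nil => exact ⟨contDiff_const, by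
      simpa using (const (r := r) (d := d) (1 : 𝔸) le_rfl).mono le_rfl h1 le_rfl⟩
  | cons a l ih =>
    obtain ⟨h1, h2⟩ := ih (fun a ha => hf a (by simp [ha])) fun a ha => h a (by simp [ha])
    simp only [List.map_cons, List.prod_cons, List.length_cons]
    have e : ((l.length + 1 : ℕ) : ℝ) * Λ = Λ + l.length * Λ := by push_cast; ring
    rw [e, pow_succ']
    exact ⟨(hf a (by simp)).mul h1,
      mul (hf a (by simp)) h1 (h a (by simp)) h2⟩

end Algebra

/-- A function of one coordinate. -/
theorem comp_proj {u : ℝ → ℝ} (hu : ContDiff ℝ ∞ u) (hB : 0 ≤ B) (hΛ : 0 ≤ Λ) (j : Fin d)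
    (h : ∀ n ≤ r, ∀ x, |x| ≤ 1 → |iteratedDeriv n u x| ≤ B * Λ ^ n) :
    DerivBound r B Λ fun t : Fin d → ℝ => u (t j) := by
  have hb : ∀ B (u : ℝ → ℝ), (∀ x, |x| ≤ 1 → |u x| ≤ B) → ∀ t : Fin d → ℝ, ‖t‖ ≤ 1 →
      ‖u (t j)‖ ≤ B := fun B u h t ht => h _ ((norm_le_pi_norm t j).trans ht)
  induction r generalizing u B with
  | zero => exact hb _ _ fun x hx => by simpa using h 0 le_rfl x hx
  | succ r ih =>
    refine ⟨hb _ _ fun x hx => by simpa using h 0 (by simp) x hx, fun i => ?_⟩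
    have e : pderiv i (fun t : Fin d → ℝ => u (t j)) =
        fun t => (Pi.single i 1 : Fin d → ℝ) j • deriv u (t j) := by
      ext1 t
      have h1 := ((hu.differentiable (by simp) (t j)).hasDerivAt).comp_hasFDerivAt t
        (ContinuousLinearMap.proj (R := ℝ) (φ := fun _ : Fin d => ℝ) j).hasFDerivAt
      have h2 := DFunLike.congr_fun h1.fderiv (Pi.single i 1)
      refine h2.trans ?_
      simp [mul_comm]
    have hu' : ContDiff ℝ ∞ (deriv u) := (contDiff_infty_iff_deriv.1 hu).2
    have h1 := ih (B := B * Λ) hu' (by positivity) fun n hn x hx => by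
      have := h (n + 1) (by omega) x hx
      rw [iteratedDeriv_succ'] at this
      rwa [mul_assoc, ← pow_succ']
    rw [e]
    have h2 := clm_comp ((Pi.single i 1 : Fin d → ℝ) j • ContinuousLinearMap.id ℝ ℝ)
      (hu'.comp (contDiff_apply ℝ ℝ j)) h1
    refine h2.mono hΛ ?_ le_rfl
    have h3 : ‖(Pi.single i 1 : Fin d → ℝ) j • ContinuousLinearMap.id ℝ ℝ‖ ≤ 1 := by
      rw [norm_smul, ContinuousLinearMap.norm_id, mul_one, Pi.single_apply]
      split_ifs <;> simp
    calc _ ≤ 1 * (B * Λ) := by gcongr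
      _ = _ := one_mul _

end DerivBound

end DerivBound

/-! ### Bounds for the frame and for iterated frame derivatives -/

section FrameBounds

variable {d : ℕ}

theorem norm_one_clm_le : ‖(1 : (Fin d → ℝ) →L[ℝ] (Fin d → ℝ))‖ ≤ 1 :=
  ContinuousLinearMap.norm_id_le

/-- On the unit ball t ↦ t_i A has bound M and rate 1; its n-th power has bound M^n and rate n, and
only powers n < d occur. -/
theorem derivBound_expPoly (A : (Fin d → ℝ) →L[ℝ] (Fin d → ℝ)) {M : ℝ} (hM : 1 ≤ M)
    (hA : ‖A‖ ≤ M) (r : ℕ) (i : Fin d) :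
    ContDiff ℝ ∞ (fun t : Fin d → ℝ => expPoly A (t i)) ∧
      DerivBound r (d * M ^ d) d fun t : Fin d → ℝ => expPoly A (t i) := by
  have h0 : ContDiff ℝ ∞ (fun t : Fin d → ℝ => t i) := contDiff_apply ℝ ℝ i
  have hc : DerivBound r 1 1 fun t : Fin d → ℝ => t i := by
    refine DerivBound.comp_proj (u := fun x => x) contDiff_id zero_le_one zero_le_one i
      fun n _ x hx => ?_
    rcases n with _ | n
    · simpa using hx
    · rw [iteratedDeriv_succ', deriv_id'']
      rcases n with _ | n
      · simp
      · simp [iteratedDeriv_succ']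
  let L : ℝ →L[ℝ] ((Fin d → ℝ) →L[ℝ] (Fin d → ℝ)) := (ContinuousLinearMap.id ℝ ℝ).smulRight A
  have hL : ‖L‖ ≤ M := by
    refine (ContinuousLinearMap.norm_smulRight_apply _ _).le.trans ?_
    rw [ContinuousLinearMap.norm_id, one_mul]
    exact hA
  have hs : ContDiff ℝ ∞ fun t : Fin d → ℝ => L (t i) := L.contDiff.comp h0
  have h1 : DerivBound r M 1 fun t : Fin d → ℝ => L (t i) :=
    (DerivBound.clm_comp L h0 hc).mono zero_le_one (by rwa [mul_one]) le_rfl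
  have h2 : ∀ n ∈ Finset.range d,
      ContDiff ℝ ∞ (fun t : Fin d → ℝ => (t i ^ n * (n.factorial : ℝ)⁻¹) • A ^ n) ∧
      DerivBound r (M ^ d) d fun t : Fin d → ℝ => (t i ^ n * (n.factorial : ℝ)⁻¹) • A ^ n := by
    intro n hn
    have hn' : n ≤ d := (Finset.mem_range.1 hn).le
    have h3 := DerivBound.pow norm_one_clm_le hs h1 n
    have e : (fun t : Fin d → ℝ => (t i ^ n * (n.factorial : ℝ)⁻¹) • A ^ n) =
        fun t => ((n.factorial : ℝ)⁻¹ • ContinuousLinearMap.id ℝ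
          ((Fin d → ℝ) →L[ℝ] (Fin d → ℝ))) (L (t i) ^ n) := by
      ext1 t
      simp [L, smul_pow, smul_smul]
    rw [e]
    refine ⟨(ContinuousLinearMap.contDiff _).comp (hs.pow n), ?_⟩
    refine (DerivBound.clm_comp _ (hs.pow n) h3).mono (by positivity) ?_ ?_
    · have h4 : ‖(n.factorial : ℝ)⁻¹ • ContinuousLinearMap.id ℝ
          ((Fin d → ℝ) →L[ℝ] (Fin d → ℝ))‖ ≤ 1 := by
        have : (1 : ℝ) ≤ n.factorial := by exact_mod_cast n.factorial_pos
        refine ContinuousLinearMap.opNorm_le_bound _ zero_le_one fun P => ?_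
        change ‖(n.factorial : ℝ)⁻¹ • P‖ ≤ _
        rw [norm_smul, norm_inv, Real.norm_natCast]
        gcongr
        exact inv_le_one_of_one_le₀ this
      calc _ ≤ 1 * M ^ n := by gcongr
        _ ≤ M ^ d := by rw [one_mul]; exact pow_le_pow_right₀ hM hn'
    · rw [mul_one]; exact_mod_cast hn'
  have h5 := DerivBound.sum (Finset.range d) (by positivity) (fun n hn => (h2 n hn).1)
    fun n hn => (h2 n hn).2
  rw [Finset.card_range] at h5
  exact ⟨ContDiff.sum fun n hn => (h2 n hn).1, h5⟩

theorem derivBound_preMat {A : Fin d → (Fin d → ℝ) →L[ℝ] (Fin d → ℝ)} {M : ℝ} (hM : 1 ≤ M)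
    (hA : ∀ i, ‖A i‖ ≤ M) (r : ℕ) (j : ℕ) :
    ContDiff ℝ ∞ (fun t => preMat A t j) ∧
      DerivBound r (((d + 1) * M ^ d) ^ d) (d * d) fun t => preMat A t j := by
  set l : List ((Fin d → ℝ) → ((Fin d → ℝ) →L[ℝ] (Fin d → ℝ))) :=
    (List.ofFn fun i => fun t : Fin d → ℝ => expPoly (A i) (t i)).take j with hl
  have hlen : l.length ≤ d := by
    rw [hl, List.length_take, List.length_ofFn]; exact min_le_right _ _
  have hmem : ∀ a ∈ l, ContDiff ℝ ∞ a ∧ DerivBound r ((d + 1) * M ^ d) d a := by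
    intro a ha
    obtain ⟨i, rfl⟩ := List.mem_ofFn.1 (List.mem_of_mem_take ha)
    obtain ⟨h1, h2⟩ := derivBound_expPoly (A i) hM (hA i) r i
    exact ⟨h1, h2.mono (by positivity) (by gcongr; linarith) le_rfl⟩
  obtain ⟨h1, h2⟩ := DerivBound.list_prod norm_one_clm_le l
    (fun a ha => (hmem a ha).1) fun a ha => (hmem a ha).2
  have e : (fun t => preMat A t j) = fun t => (l.map fun a => a t).prod := by
    ext1 t
    rw [preMat, hl, List.map_take, List.map_ofFn]
    rfl
  rw [e]
  have hone : (1 : ℝ) ≤ (d + 1) * M ^ d :=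
    one_le_mul_of_one_le_of_one_le (by simp) (one_le_pow₀ hM)
  exact ⟨h1, h2.mono (by positivity) (pow_le_pow_right₀ hone hlen) (by gcongr)⟩

/-- Three nested operations each raise M to a d-th power and multiply the rate by d: the
exponentials, the products of at most d of them, and the powers in the Neumann series. This is the
origin of Q^{d³}. -/
theorem derivBound_invFrame {A : Fin d → (Fin d → ℝ) →L[ℝ] (Fin d → ℝ)} {M : ℝ} (hM : 1 ≤ M)
    (hA : ∀ i, ‖A i‖ ≤ M) (r : ℕ) :
    ContDiff ℝ ∞ (invFrame A) ∧
      DerivBound r ((d + 1) * ((d + 1) * ((d + 1) * M ^ d) ^ d) ^ d) (d * (d * d)) (invFrame A) := by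
  have hone : (1 : ℝ) ≤ (d + 1) * M ^ d :=
    one_le_mul_of_one_le_of_one_le (by simp) (one_le_pow₀ hM)
  have hone' : (1 : ℝ) ≤ ((d + 1) * M ^ d) ^ d := one_le_pow₀ hone
  set B := ((d + 1) * M ^ d) ^ d with hB
  -- L j sends P to v ↦ v_j P e_j, the operator that contributes the j-th column of the frame
  -- matrix.
  let L : Fin d → ((Fin d → ℝ) →L[ℝ] (Fin d → ℝ)) →L[ℝ] ((Fin d → ℝ) →L[ℝ] (Fin d → ℝ)) := fun j =>
    (ContinuousLinearMap.smulRightL ℝ (Fin d → ℝ) (Fin d → ℝ)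
      (ContinuousLinearMap.proj (R := ℝ) (φ := fun _ : Fin d => ℝ) j)).comp
        (ContinuousLinearMap.apply ℝ (Fin d → ℝ) (Pi.single j 1))
  have hL : ∀ j, ‖L j‖ ≤ 1 := fun j => by
    refine ContinuousLinearMap.opNorm_le_bound _ zero_le_one fun P => ?_
    refine (ContinuousLinearMap.norm_smulRight_apply _ _).le.trans ?_
    refine mul_le_mul ?_ ?_ (norm_nonneg _) zero_le_one
    · refine ContinuousLinearMap.opNorm_le_bound _ zero_le_one fun v => ?_
      rw [one_mul]; exact norm_le_pi_norm v j
    · refine (P.le_opNorm _).trans ?_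
      rw [Pi.norm_single, norm_one, mul_one]
  have h1 : ∀ j ∈ Finset.univ, ContDiff ℝ ∞ (fun t => L j (preMat A t (j : ℕ))) ∧
      DerivBound r B (d * d) fun t => L j (preMat A t (j : ℕ)) := fun j _ => by
    obtain ⟨h2, h3⟩ := derivBound_preMat hM hA r j
    refine ⟨(L j).contDiff.comp h2, (DerivBound.clm_comp (L j) h2 h3).mono (by positivity) ?_ le_rfl⟩
    calc _ ≤ 1 * B := by gcongr; exact hL j
      _ = B := one_mul _
  have h4 : ContDiff ℝ ∞ (frameMat A) := ContDiff.sum fun j hj => (h1 j hj).1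
  have h5 : DerivBound r (d * B) (d * d) (frameMat A) := by
    have := DerivBound.sum Finset.univ (by positivity) (fun j hj => (h1 j hj).1)
      fun j hj => (h1 j hj).2
    rw [Finset.card_univ, Fintype.card_fin] at this
    exact this
  have h6 : ContDiff ℝ ∞ fun t => 1 + -frameMat A t := contDiff_const.add h4.neg
  have h7 : DerivBound r ((d + 1) * B) (d * d) fun t => 1 + -frameMat A t := by
    have h8 := DerivBound.clm_comp (-ContinuousLinearMap.id ℝ _) h4 h5
    have h9 := DerivBound.add contDiff_const h4.neg (DerivBound.const (r := r)
      (1 : (Fin d → ℝ) →L[ℝ] (Fin d → ℝ)) (by positivity)) h8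
    refine h9.mono (by positivity) ?_ le_rfl
    have : ‖-ContinuousLinearMap.id ℝ ((Fin d → ℝ) →L[ℝ] (Fin d → ℝ))‖ ≤ 1 := by
      refine ContinuousLinearMap.opNorm_le_bound _ zero_le_one fun P => ?_
      change ‖-P‖ ≤ _
      rw [norm_neg, one_mul]
    calc _ ≤ 1 + 1 * (d * B) := by gcongr; exact norm_one_clm_le
      _ ≤ _ := by linarith
  have h10 : ∀ n ∈ Finset.range d, DerivBound r (((d + 1) * B) ^ d) (d * (d * d))
      fun t => (1 - frameMat A t) ^ n := fun n hn => by
    simp only [sub_eq_add_neg]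
    have hn' : n ≤ d := (Finset.mem_range.1 hn).le
    refine (DerivBound.pow norm_one_clm_le h6 h7 n).mono (by positivity) ?_
      (by gcongr)
    exact pow_le_pow_right₀ (one_le_mul_of_one_le_of_one_le (by simp) hone') hn'
  have h11 : ∀ n ∈ Finset.range d, ContDiff ℝ ∞ fun t => (1 - frameMat A t) ^ n := fun n _ => by
    simp only [sub_eq_add_neg]
    exact h6.pow n
  refine ⟨ContDiff.sum h11, ?_⟩
  have := DerivBound.sum (Finset.range d) (by positivity) h11 h10
  rw [Finset.card_range] at this
  exact this.mono (by positivity) (by gcongr; linarith) le_rfl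

/-- The derivative along the right-invariant vector field of the `i`-th basis vector, in Mal'cev
coordinates. -/
def frameDeriv (A : Fin d → (Fin d → ℝ) →L[ℝ] (Fin d → ℝ)) (i : Fin d) (f : (Fin d → ℝ) → ℝ)
    (t : Fin d → ℝ) : ℝ :=
  fderiv ℝ f t (invFrame A t (Pi.single i 1))

theorem contDiff_frameDeriv {A : Fin d → (Fin d → ℝ) →L[ℝ] (Fin d → ℝ)}
    (i : Fin d) {f : (Fin d → ℝ) → ℝ} (hf : ContDiff ℝ ∞ f) : ContDiff ℝ ∞ (frameDeriv A i f) := by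
  have hA : ContDiff ℝ ∞ (invFrame A) :=
    (derivBound_invFrame (M := 1 + ∑ i, ‖A i‖) (by simp; positivity) (fun i => by
      have := Finset.single_le_sum (f := fun i => ‖A i‖) (fun i _ => norm_nonneg _)
        (Finset.mem_univ i)
      linarith) 0).1
  exact (hf.fderiv_right (m := ∞) (by simp)).clm_apply (hA.clm_apply contDiff_const)

theorem frameDeriv_eq_sum (A : Fin d → (Fin d → ℝ) →L[ℝ] (Fin d → ℝ)) (i : Fin d)
    (f : (Fin d → ℝ) → ℝ) :
    frameDeriv A i f = fun t => ∑ j, invFrame A t (Pi.single i 1) j * pderiv j f t := by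
  ext1 t
  have hv : ∀ v : Fin d → ℝ, v = ∑ k, v k • (Pi.single k 1 : Fin d → ℝ) := fun v => by
    ext i; simp [Finset.sum_apply, Pi.single_apply]
  rw [frameDeriv]
  conv_lhs => rw [hv (invFrame A t (Pi.single i 1))]
  simp [pderiv]

/-- A frame derivative is a sum of d products of a frame entry with a partial of f. The partial uses
up one order and has bound B Λ; the rates add in the product. -/
theorem derivBound_frameDeriv {A : Fin d → (Fin d → ℝ) →L[ℝ] (Fin d → ℝ)} {r : ℕ} {BV R B Λ : ℝ}
    (hA : ContDiff ℝ ∞ (invFrame A)) (hV : DerivBound r BV R (invFrame A)) (hR : 0 ≤ R)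
    (hΛ : 0 ≤ Λ) (i : Fin d) {f : (Fin d → ℝ) → ℝ} (hf : ContDiff ℝ ∞ f)
    (h : DerivBound (r + 1) B Λ f) :
    DerivBound r (d * (BV * (B * Λ))) (R + Λ) (frameDeriv A i f) := by
  let L : Fin d → ((Fin d → ℝ) →L[ℝ] (Fin d → ℝ)) →L[ℝ] ℝ := fun j =>
    (ContinuousLinearMap.proj (R := ℝ) (φ := fun _ : Fin d => ℝ) j).comp
      (ContinuousLinearMap.apply ℝ (Fin d → ℝ) (Pi.single i 1))
  have hL : ∀ j, ‖L j‖ ≤ 1 := fun j => by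
    refine ContinuousLinearMap.opNorm_le_bound _ zero_le_one fun P => ?_
    rw [one_mul]
    refine (norm_le_pi_norm (P (Pi.single i 1)) j).trans ((P.le_opNorm _).trans ?_)
    rw [Pi.norm_single, norm_one, mul_one]
  have h1 : ∀ j ∈ Finset.univ, ContDiff ℝ ∞ (fun t => L j (invFrame A t) * pderiv j f t) ∧
      DerivBound r (BV * (B * Λ)) (R + Λ) fun t => L j (invFrame A t) * pderiv j f t := fun j _ => by
    have h2 : ContDiff ℝ ∞ fun t => L j (invFrame A t) := (L j).contDiff.comp hA
    have h3 : DerivBound r BV R fun t => L j (invFrame A t) := by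
      refine (DerivBound.clm_comp (L j) hA hV).mono hR ?_ le_rfl
      have := hV.nonneg
      calc _ ≤ 1 * BV := by gcongr; exact hL j
        _ = BV := one_mul _
    exact ⟨h2.mul (contDiff_pderiv hf j), h3.mul h2 (contDiff_pderiv hf j) (h.2 j)⟩
  have h4 := DerivBound.sum Finset.univ (by positivity) (fun j hj => (h1 j hj).1)
    fun j hj => (h1 j hj).2
  rw [Finset.card_univ, Fintype.card_fin] at h4
  rw [frameDeriv_eq_sum]
  exact h4

theorem contDiff_foldr_frameDeriv {A : Fin d → (Fin d → ℝ) →L[ℝ] (Fin d → ℝ)} (l : List (Fin d))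
    {f : (Fin d → ℝ) → ℝ} (hf : ContDiff ℝ ∞ f) : ContDiff ℝ ∞ (l.foldr (frameDeriv A) f) := by
  induction l with
  | nil => exact hf
  | cons i l ih => exact contDiff_frameDeriv i ih

theorem support_foldr_frameDeriv {A : Fin d → (Fin d → ℝ) →L[ℝ] (Fin d → ℝ)} (l : List (Fin d))
    {f : (Fin d → ℝ) → ℝ} {S : Set (Fin d → ℝ)} (hS : IsClosed S) (hf : Function.support f ⊆ S) :
    Function.support (l.foldr (frameDeriv A) f) ⊆ S := by
  induction l with
  | nil => exact hf
  | cons i l ih =>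
    intro t ht
    have h1 : fderiv ℝ (l.foldr (frameDeriv A) f) t ≠ 0 := fun h => ht (by
      simp [frameDeriv, h])
    exact closure_minimal ih hS (support_fderiv_subset ℝ h1)

/-- Each application raises the rate by R and multiplies the bound by d · BV times the current rate.
With at most m applications the rate stays below Λ + m R, so one factor serves for all of them. -/
theorem derivBound_foldr_frameDeriv {A : Fin d → (Fin d → ℝ) →L[ℝ] (Fin d → ℝ)} {BV R B Λ : ℝ}
    (hA : ContDiff ℝ ∞ (invFrame A)) (hV : ∀ r, DerivBound r BV R (invFrame A)) (hR : 0 ≤ R)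
    (hΛ : 0 ≤ Λ) {f : (Fin d → ℝ) → ℝ} (hf : ContDiff ℝ ∞ f) {m : ℕ} (l : List (Fin d)) {r : ℕ}
    (hm : r + l.length ≤ m) (h : DerivBound (r + l.length) B Λ f) :
    DerivBound r (B * (d * BV * (Λ + m * R)) ^ l.length) (Λ + l.length * R)
      (l.foldr (frameDeriv A) f) := by
  have hBV := (hV 0).nonneg
  induction l generalizing r with
  | nil => simpa using h
  | cons i l ih =>
    rw [List.length_cons] at *
    have h1 := ih (r := r + 1) (by omega) (by convert h using 1; omega)
    have h2 := derivBound_frameDeriv hA (hV r) hR (by positivity) i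
      (contDiff_foldr_frameDeriv l hf) h1
    have hB := h.nonneg
    refine h2.mono (by positivity) ?_ (by push_cast; linarith)
    have hlm : (l.length : ℝ) ≤ m := by exact_mod_cast (by omega : l.length ≤ m)
    calc _ = B * (d * BV * (Λ + m * R)) ^ l.length * (d * BV * (Λ + l.length * R)) := by ring
      _ ≤ B * (d * BV * (Λ + m * R)) ^ l.length * (d * BV * (Λ + m * R)) := by gcongr
      _ = _ := by rw [pow_succ]; ring

end FrameBounds

/-! ### Bumps with controlled derivatives up to order m -/

section Bump

/-- The average of `f` over a window of length `2 * δ`. -/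
def windowAvg (δ : ℝ) (f : ℝ → ℝ) (x : ℝ) : ℝ := (2 * δ)⁻¹ * ∫ y in (-δ)..δ, f (x + y)

/-- The central difference quotient. -/
def centralDiff (δ : ℝ) (f : ℝ → ℝ) (x : ℝ) : ℝ := (2 * δ)⁻¹ * (f (x + δ) - f (x - δ))

variable {δ : ℝ} {f : ℝ → ℝ}

/-- The derivative of the average uses only values of f, so one averaging pays for one derivative at
the price 1/δ. -/
theorem hasDerivAt_windowAvg (hf : Continuous f) (δ x : ℝ) :
    HasDerivAt (windowAvg δ f) (centralDiff δ f x) x := by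
  have h1 : windowAvg δ f = fun x => (2 * δ)⁻¹ * ((∫ y in (0)..(x + δ), f y) -
      ∫ y in (0)..(x - δ), f y) := by
    ext1 x
    rw [windowAvg, intervalIntegral.integral_comp_add_left,
      intervalIntegral.integral_interval_sub_left (hf.intervalIntegrable _ _)
        (hf.intervalIntegrable _ _), sub_eq_add_neg]
  rw [h1]
  refine HasDerivAt.const_mul _ (HasDerivAt.sub ?_ ?_)
  · exact HasDerivAt.comp_add_const x δ (hf.integral_hasStrictDerivAt 0 (x + δ)).hasDerivAt
  · exact HasDerivAt.comp_sub_const x δ (hf.integral_hasStrictDerivAt 0 (x - δ)).hasDerivAt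

theorem contDiff_windowAvg (hf : ContDiff ℝ ∞ f) (δ : ℝ) : ContDiff ℝ ∞ (windowAvg δ f) := by
  rw [contDiff_infty_iff_deriv]
  refine ⟨fun x => (hasDerivAt_windowAvg hf.continuous δ x).differentiableAt, ?_⟩
  have : deriv (windowAvg δ f) = centralDiff δ f :=
    funext fun x => (hasDerivAt_windowAvg hf.continuous δ x).deriv
  rw [this]
  unfold centralDiff
  fun_prop

theorem abs_windowAvg_le {B : ℝ} (hδ : 0 < δ) (h : ∀ x, |f x| ≤ B) (x : ℝ) :
    |windowAvg δ f x| ≤ B := by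
  have h1 := intervalIntegral.norm_integral_le_of_norm_le_const (a := -δ) (b := δ)
    (f := fun y => f (x + y)) (C := B) fun y _ => h _
  have h2 : |δ - -δ| = 2 * δ := by rw [abs_of_pos (by linarith)]; ring
  rw [h2, Real.norm_eq_abs] at h1
  rw [windowAvg, abs_mul, abs_of_pos (by positivity)]
  calc _ ≤ (2 * δ)⁻¹ * (B * (2 * δ)) := by gcongr
    _ = B := by field_simp

theorem abs_centralDiff_le {B : ℝ} (hδ : 0 < δ) (h : ∀ x, |f x| ≤ B) (x : ℝ) :
    |centralDiff δ f x| ≤ B * δ⁻¹ := by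
  rw [centralDiff, abs_mul, abs_of_pos (by positivity)]
  calc _ ≤ (2 * δ)⁻¹ * (B + B) := by
        gcongr
        exact (abs_sub _ _).trans (add_le_add (h _) (h _))
    _ = B * δ⁻¹ := by field_simp; ring

theorem iteratedDeriv_centralDiff (hf : ContDiff ℝ ∞ f) (δ : ℝ) (n : ℕ) :
    iteratedDeriv n (centralDiff δ f) = centralDiff δ (iteratedDeriv n f) := by
  induction n generalizing f with
  | zero => simp
  | succ n ih =>
    have h1 : deriv (centralDiff δ f) = centralDiff δ (deriv f) := by
      ext1 x
      have h2 : ∀ y, HasDerivAt f (deriv f y) y := fun y =>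
        (hf.differentiable (by simp) y).hasDerivAt
      exact (((h2 (x + δ)).comp_add_const x δ).sub ((h2 (x - δ)).comp_sub_const x δ)
        |>.const_mul (2 * δ)⁻¹).deriv
    rw [iteratedDeriv_succ', h1, ih (contDiff_infty_iff_deriv.1 hf).2, iteratedDeriv_succ']

theorem windowAvg_nonneg (hδ : 0 < δ) (h : ∀ x, 0 ≤ f x) (x : ℝ) : 0 ≤ windowAvg δ f x :=
  mul_nonneg (by positivity) (intervalIntegral.integral_nonneg (by linarith) fun y _ => h _)

theorem support_windowAvg_subset {a : ℝ} (hδ : 0 < δ) (h : ∀ x, a < |x| → f x = 0) (x : ℝ)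
    (hx : a + δ < |x|) : windowAvg δ f x = 0 := by
  rw [windowAvg, intervalIntegral.integral_congr (g := fun _ => 0), intervalIntegral.integral_zero,
    mul_zero]
  intro y hy
  rw [uIcc_of_le (by linarith)] at hy
  refine h _ ?_
  have h1 : |y| ≤ δ := abs_le.2 hy
  have h2 := abs_sub_abs_le_abs_sub x (-y)
  rw [abs_neg, sub_neg_eq_add] at h2
  linarith

theorem integral_windowAvg (hδ : 0 < δ) (hf : Continuous f) (hc : HasCompactSupport f) :
    ∫ x, windowAvg δ f x = ∫ x, f x := by
  have hfi : Integrable f := hf.integrable_of_hasCompactSupport hc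
  have h1 : Integrable (Function.uncurry fun y x => f (x + y))
      ((volume.restrict (uIoc (-δ) δ)).prod volume) := by
    have hm : AEStronglyMeasurable (Function.uncurry fun y x => f (x + y))
        ((volume.restrict (uIoc (-δ) δ)).prod volume) :=
      Continuous.aestronglyMeasurable (by fun_prop)
    rw [integrable_prod_iff hm]
    refine ⟨Eventually.of_forall fun y => hfi.comp_add_right y, ?_⟩
    have : (fun y : ℝ => ∫ x, ‖Function.uncurry (fun y x => f (x + y)) (y, x)‖) =
        fun _ => ∫ x, ‖f x‖ := by
      ext1 y
      exact integral_add_right_eq_self (fun x => ‖f x‖) y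
    rw [this]
    exact integrableOn_const (by rw [uIoc_of_le (by linarith)]; simp)
  have h2 := intervalIntegral_integral_swap h1
  simp only [windowAvg]
  rw [integral_const_mul, ← h2]
  simp only [integral_add_right_eq_self]
  rw [intervalIntegral.integral_const, smul_eq_mul]
  field_simp
  ring

/-- Repeated averaging: a smooth bump whose first `m` derivatives are controlled. -/
theorem exists_bump_aux {a B : ℝ} (hδ : 0 < δ) (hf : ContDiff ℝ ∞ f) (h0 : ∀ x, 0 ≤ f x)
    (hB : ∀ x, |f x| ≤ B) (ha : ∀ x, a < |x| → f x = 0) (m : ℕ) :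
    ∃ u : ℝ → ℝ, ContDiff ℝ ∞ u ∧ (∀ x, 0 ≤ u x) ∧ (∀ x, a + m * δ < |x| → u x = 0) ∧
      ∫ x, u x = ∫ x, f x ∧ ∀ n ≤ m, ∀ x, |iteratedDeriv n u x| ≤ B * δ⁻¹ ^ n := by
  induction m with
  | zero =>
    refine ⟨f, hf, h0, by simpa using ha, rfl, fun n hn x => ?_⟩
    obtain rfl : n = 0 := by omega
    simpa using hB x
  | succ m ih =>
    obtain ⟨u, h1, h2, h3, h4, h5⟩ := ih
    have hc : HasCompactSupport u := by
      refine HasCompactSupport.intro (isCompact_closedBall 0 (a + m * δ)) fun x hx => h3 x ?_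
      simpa using hx
    refine ⟨windowAvg δ u, contDiff_windowAvg h1 δ, windowAvg_nonneg hδ h2, fun x hx => ?_, ?_,
      fun n hn x => ?_⟩
    · refine support_windowAvg_subset hδ h3 x ?_
      push_cast at hx
      linarith
    · rw [integral_windowAvg hδ h1.continuous hc, h4]
    · rcases n with _ | n
      · simpa using abs_windowAvg_le hδ (fun x => by simpa using h5 0 (by simp) x) x
      · have : deriv (windowAvg δ u) = centralDiff δ u :=
          funext fun x => (hasDerivAt_windowAvg h1.continuous δ x).deriv
        rw [iteratedDeriv_succ', this, iteratedDeriv_centralDiff h1, pow_succ, ← mul_assoc]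
        exact abs_centralDiff_le hδ (h5 n (by omega)) x

theorem exists_base_bump : ∃ w : ℝ → ℝ, ContDiff ℝ ∞ w ∧ (∀ x, 0 ≤ w x) ∧
    (∀ x, 1 < |x| → w x = 0) ∧ ∫ x, w x = 1 ∧ ∃ C, 0 < C ∧ ∀ x, |w x| ≤ C := by
  let φ : ContDiffBump (0 : ℝ) := ⟨1 / 2, 1, by norm_num, by norm_num⟩
  have h0 : ∀ x, 0 ≤ φ.normed volume x := fun x => φ.nonneg_normed x
  obtain ⟨C, hC⟩ := φ.continuous_normed (μ := volume) |>.bounded_above_of_compact_support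
    φ.hasCompactSupport_normed
  refine ⟨φ.normed volume, φ.contDiff_normed, h0, fun x hx => ?_, φ.integral_normed, |C| + 1,
    by positivity, fun x => (hC x).trans (by linarith [le_abs_self C])⟩
  by_contra hne
  have : x ∈ Function.support (φ.normed volume) := hne
  rw [φ.support_normed_eq] at this
  have h1 : |x| < 1 := by simpa using this
  linarith

/-- A bump of radius ε/4 is averaged m times over windows δ = ε/(4m); the support grows by m δ = ε/4
and the rate is 1/δ. The bump has to depend on m: a fixed function with n-th derivatives O(n)^n
would be analytic, hence not compactly supported. -/
theorem exists_bump : ∃ C : ℝ, 0 < C ∧ ∀ m : ℕ, 1 ≤ m → ∀ ε : ℝ, 0 < ε →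
    ∃ u : ℝ → ℝ, ContDiff ℝ ∞ u ∧ (∀ x, 0 ≤ u x) ∧ (∀ x, ε / 2 < |x| → u x = 0) ∧
      ∫ x, u x = 1 ∧ ∀ n ≤ m, ∀ x, |iteratedDeriv n u x| ≤ C / ε * (4 * m / ε) ^ n := by
  obtain ⟨w, h1, h2, h3, h4, C, hC, h5⟩ := exists_base_bump
  refine ⟨4 * C, by positivity, fun m hm ε hε => ?_⟩
  have hm' : (0 : ℝ) < m := by exact_mod_cast hm
  let f : ℝ → ℝ := fun x => 4 / ε * w (4 / ε * x)
  have hf : ContDiff ℝ ∞ f := contDiff_const.mul (h1.comp (contDiff_const.mul contDiff_id))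
  have hB : ∀ x, |f x| ≤ 4 * C / ε := fun x => by
    simp only [f]
    rw [abs_mul, abs_of_pos (by positivity : 0 < 4 / ε)]
    calc _ ≤ 4 / ε * C := by gcongr; exact h5 _
      _ = _ := by ring
  have ha : ∀ x, ε / 4 < |x| → f x = 0 := fun x hx => by
    simp only [f]
    rw [h3, mul_zero]
    rw [abs_mul, abs_of_pos (by positivity : 0 < 4 / ε)]
    calc (1 : ℝ) = 4 / ε * (ε / 4) := by field_simp
      _ < _ := by gcongr
  have hI : ∫ x, f x = 1 := by
    simp only [f]
    rw [integral_const_mul, Measure.integral_comp_mul_left, h4, abs_of_pos (by positivity)]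
    simp only [smul_eq_mul]
    field_simp
  have hδ : 0 < ε / (4 * m) := by positivity
  obtain ⟨u, g1, g2, g3, g4, g5⟩ := exists_bump_aux hδ hf
    (fun x => mul_nonneg (by positivity) (h2 _)) hB ha m
  refine ⟨u, g1, g2, fun x hx => g3 x ?_, g4.trans hI, fun n hn x => ?_⟩
  · have : ε / 4 + m * (ε / (4 * m)) = ε / 2 := by field_simp; norm_num
    rwa [this]
  · have := g5 n hn x
    rwa [inv_div] at this

/-- A smooth bump on `ℝ^d` with controlled derivatives. -/
theorem exists_box_bump (d : ℕ) : ∃ C : ℝ, 0 < C ∧ ∀ m : ℕ, 1 ≤ m → ∀ ε : ℝ, 0 < ε →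
    ∃ φ : (Fin d → ℝ) → ℝ, ContDiff ℝ ∞ φ ∧ (∀ t, 0 ≤ φ t) ∧
      Function.support φ ⊆ Metric.closedBall 0 (ε / 2) ∧ ∫ t, φ t = 1 ∧
      DerivBound m ((C / ε) ^ d) (d * (4 * m / ε)) φ := by
  obtain ⟨C, hC, H⟩ := exists_bump
  refine ⟨C, hC, fun m hm ε hε => ?_⟩
  obtain ⟨u, h1, h2, h3, h4, h5⟩ := H m hm ε hε
  have hs : ∀ j : Fin d, ContDiff ℝ ∞ fun t : Fin d → ℝ => u (t j) := fun j =>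
    h1.comp (contDiff_apply ℝ ℝ j)
  have hb : ∀ j : Fin d, DerivBound m (C / ε) (4 * m / ε) fun t : Fin d → ℝ => u (t j) := fun j =>
    DerivBound.comp_proj h1 (by positivity) (by positivity) j fun n hn x _ => h5 n hn x
  refine ⟨fun t => ∏ j, u (t j), contDiff_prod fun j _ => hs j,
    fun t => Finset.prod_nonneg fun j _ => h2 _, fun t ht => ?_, ?_, ?_⟩
  · rw [mem_closedBall_zero_iff, pi_norm_le_iff_of_nonneg (by positivity)]
    intro j
    by_contra hj
    exact ht (Finset.prod_eq_zero (Finset.mem_univ j) (h3 _ (not_le.1 hj)))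
  · rw [integral_fintype_prod_volume_eq_prod (f := fun _ => u)]
    simp [h4]
  · have h6 := (DerivBound.list_prod (r := m) (B := C / ε) (Λ := 4 * m / ε) (norm_one (α := ℝ)).le
      (List.ofFn fun j : Fin d => fun t : Fin d → ℝ => u (t j))
      (fun a ha => by obtain ⟨j, rfl⟩ := List.mem_ofFn.1 ha; exact hs j)
      fun a ha => by obtain ⟨j, rfl⟩ := List.mem_ofFn.1 ha; exact hb j).2
    rw [List.length_ofFn] at h6
    have e : (fun t : Fin d → ℝ => ∏ j, u (t j)) =
        fun t => ((List.ofFn fun j t => u (t j)).map fun a => a t).prod := by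
      ext1 t
      rw [List.map_ofFn, List.prod_ofFn]
      rfl
    rw [e]
    exact h6

end Bump

/-! ### Convolution on the group -/

section GroupConv

variable {d : ℕ} {G : Type u} [Group G] [TopologicalSpace G]
  [ChartedSpace (EuclideanSpace ℝ (Fin d)) G]

/-- The convolution of a function in Mal'cev coordinates with a function on the group. -/
def groupConv (X : Module.Basis (Fin d) ℝ (GroupLieAlgebra (𝓡 d) G)) (f : (Fin d → ℝ) → ℝ)
    (H : G → ℂ) (g : G) : ℂ :=
  ∫ t, f t • H ((expProd X t)⁻¹ * g)

variable {X : Module.Basis (Fin d) ℝ (GroupLieAlgebra (𝓡 d) G)} {f : (Fin d → ℝ) → ℝ} {H : G → ℂ}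

theorem norm_groupConv_le {B M ρ : ℝ} (hρ : 0 ≤ ρ)
    (hf : Function.support f ⊆ Metric.closedBall 0 ρ)
    (hB : ∀ t ∈ Metric.closedBall (0 : Fin d → ℝ) ρ, |f t| ≤ B) (hH : ∀ g, ‖H g‖ ≤ M) (g : G) :
    ‖groupConv X f H g‖ ≤ B * (2 * ρ) ^ d * M := by
  have h0 : ∀ t, t ∉ Metric.closedBall (0 : Fin d → ℝ) ρ → f t • H ((expProd X t)⁻¹ * g) = 0 :=
    fun t ht => by
      have : f t = 0 := by
        by_contra h; exact ht (hf h)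
      rw [this, zero_smul]
  have hvol : volume (Metric.closedBall (0 : Fin d → ℝ) ρ) = ENNReal.ofReal ((2 * ρ) ^ d) := by
    rw [Real.volume_pi_closedBall _ hρ, Fintype.card_fin]
  rw [groupConv, ← setIntegral_eq_integral_of_forall_compl_eq_zero h0]
  have hB0 : 0 ≤ B := (abs_nonneg _).trans (hB 0 (by simpa using hρ))
  have h1 := norm_setIntegral_le_of_norm_le_const (μ := volume) (C := B * M)
    (s := Metric.closedBall (0 : Fin d → ℝ) ρ) (f := fun t => f t • H ((expProd X t)⁻¹ * g))
    (by rw [hvol]; exact ENNReal.ofReal_lt_top) fun t ht => by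
      rw [norm_smul]
      exact mul_le_mul (hB t ht) (hH _) (norm_nonneg _) hB0
  rw [Measure.real, hvol, ENNReal.toReal_ofReal (by positivity)] at h1
  linarith

theorem norm_sub_groupConv_le {δ : ℝ} (hf : Integrable f) (h0 : ∀ t, 0 ≤ f t)
    (h1 : ∫ t, f t = 1) (g : G)
    (hi : Integrable fun t => f t • H ((expProd X t)⁻¹ * g))
    (hH : ∀ t ∈ Function.support f, ‖H g - H ((expProd X t)⁻¹ * g)‖ ≤ δ) :
    ‖H g - groupConv X f H g‖ ≤ δ := by
  have h2 : H g - groupConv X f H g = ∫ t, f t • (H g - H ((expProd X t)⁻¹ * g)) := by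
    simp only [smul_sub]
    rw [integral_sub (hf.smul_const _) hi, integral_smul_const, h1, one_smul, groupConv]
  rw [h2]
  calc _ ≤ ∫ t, f t * δ := by
        refine norm_integral_le_of_norm_le (hf.mul_const _) (Eventually.of_forall fun t => ?_)
        rw [norm_smul, Real.norm_of_nonneg (h0 t)]
        by_cases ht : f t = 0
        · simp [ht]
        · exact mul_le_mul_of_nonneg_left (hH t ht) (h0 t)
    _ = δ := by rw [integral_mul_const, h1, one_mul]

variable [LieGroup (𝓡 d) ∞ G] [T2Space G]

theorem continuous_inv_expProd_mul (hH : Continuous H) (g : G) :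
    Continuous fun t => H ((expProd X t)⁻¹ * g) := by
  have : IsTopologicalGroup G := topologicalGroup_of_lieGroup (𝓡 d) ∞
  exact hH.comp ((contMDiff_expProd X).continuous.inv.mul continuous_const)

theorem integrable_smul_inv_expProd_mul (hH : Continuous H) (hf : Continuous f)
    (hc : HasCompactSupport f) (g : G) :
    Integrable fun t => f t • H ((expProd X t)⁻¹ * g) :=
  (hf.smul (continuous_inv_expProd_mul hH g)).integrable_of_hasCompactSupport hc.smul_right

/-- The volume-preserving substitution t ↦ `coTrans X g t` moves the dependence on g from H, which
is merely continuous, to the kernel f. -/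
theorem groupConv_eq (hA : ∀ i, IsStrictLower (adMat X i))
    (hX : ∀ g : G, ∃! t : Fin d → ℝ, expProd X t = g) (hH : Continuous H) (hf : Continuous f)
    (g : G) :
    groupConv X f H g = ∫ t, f (coords X (g * expProd X t)) • H (expProd X t)⁻¹ := by
  have hT := continuous_coTrans hA hX g
  have hc : Continuous fun t => f t • H ((expProd X t)⁻¹ * g) :=
    hf.smul (continuous_inv_expProd_mul hH g)
  have h1 := integral_map (μ := volume) hT.aemeasurable hc.aestronglyMeasurable
  rw [map_coTrans_volume hA hX] at h1
  rw [groupConv, h1]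
  congr 1
  ext1 t
  rw [coTrans, expProd_coords hX, mul_inv_rev, inv_mul_cancel_right]

/-- After `groupConv_eq` this is the value at 0 of a Euclidean convolution with a kernel depending
smoothly on p; for p near p₀ the kernels vanish off one compact set k, and H need only be locally
integrable. -/
theorem contDiff_groupConv_expProd (hA : ∀ i, IsStrictLower (adMat X i))
    (hX : ∀ g : G, ∃! t : Fin d → ℝ, expProd X t = g) (hH : Continuous H) (hf : ContDiff ℝ ∞ f)
    (hc : HasCompactSupport f) : ContDiff ℝ ∞ fun p => groupConv X f H (expProd X p) := by
  have : IsTopologicalGroup G := topologicalGroup_of_lieGroup (𝓡 d) ∞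
  have hE := (contMDiff_expProd X).continuous
  have hκ := contMDiff_coords hA hX
  -- A convolution at 0 evaluates its kernel at 0 - t, hence the sign of y.
  let φ : (Fin d → ℝ) → (Fin d → ℝ) → ℝ := fun p y => f (coords X (expProd X p * expProd X (-y)))
  have hφ : ContDiff ℝ ∞ ↿φ := by
    refine hf.comp ?_
    rw [← contMDiff_iff_contDiff]
    refine hκ.comp (ContMDiff.mul ?_ ?_)
    · exact (contMDiff_expProd X).comp (contDiff_fst.contMDiff)
    · exact (contMDiff_expProd X).comp (contDiff_snd.neg.contMDiff)
  rw [contDiff_iff_contDiffAt]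
  intro p₀
  let k : Set (Fin d → ℝ) := (fun q : (Fin d → ℝ) × (Fin d → ℝ) =>
    -coords X ((expProd X q.1)⁻¹ * expProd X q.2)) '' (Metric.closedBall p₀ 1 ×ˢ tsupport f)
  have hk : IsCompact k := by
    refine ((isCompact_closedBall p₀ 1).prod hc).image ?_
    exact (hκ.continuous.comp ((hE.comp continuous_fst).inv.mul (hE.comp continuous_snd))).neg
  have hgs : ∀ p, ∀ y, p ∈ Metric.ball p₀ 1 → y ∉ k → φ p y = 0 := by
    intro p y hp hy
    by_contra hne
    refine hy ⟨(p, coords X (expProd X p * expProd X (-y))),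
      ⟨Metric.ball_subset_closedBall hp, subset_tsupport _ hne⟩, ?_⟩
    simp only [expProd_coords hX, inv_mul_cancel_left, coords_expProd hX, neg_neg]
  have hloc : LocallyIntegrable (fun t => H (expProd X t)⁻¹) (volume : Measure (Fin d → ℝ)) :=
    (hH.comp hE.inv).locallyIntegrable
  have h1 := contDiffOn_convolution_right_with_param (n := ⊤)
    (ContinuousLinearMap.lsmul ℝ ℝ (E := ℂ)).flip Metric.isOpen_ball hk hgs hloc hφ.contDiffOn
  have h2 : ContDiffAt ℝ ∞ (fun p => convolution (fun t => H (expProd X t)⁻¹) (φ p)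
      (ContinuousLinearMap.lsmul ℝ ℝ (E := ℂ)).flip volume 0) p₀ := by
    have h3 := h1.contDiffAt (x := (p₀, 0))
      ((Metric.isOpen_ball.prod isOpen_univ).mem_nhds (by simp))
    have h4 : ∀ Ψ : (Fin d → ℝ) × (Fin d → ℝ) → ℂ, ContDiffAt ℝ ∞ Ψ (p₀, 0) →
        ContDiffAt ℝ ∞ (fun p => Ψ (p, 0)) p₀ := fun Ψ hΨ =>
      hΨ.comp p₀ (contDiffAt_id.prodMk contDiffAt_const)
    exact h4 _ h3
  refine h2.congr_of_eventuallyEq (Eventually.of_forall fun p => ?_)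
  simp only [groupConv_eq hA hX hH hf.continuous, convolution]
  congr 1
  ext1 t
  simp [φ]

theorem contMDiff_groupConv (hA : ∀ i, IsStrictLower (adMat X i))
    (hX : ∀ g : G, ∃! t : Fin d → ℝ, expProd X t = g) (hH : Continuous H) (hf : ContDiff ℝ ∞ f)
    (hc : HasCompactSupport f) : ContMDiff (𝓡 d) 𝓘(ℝ, ℂ) ∞ (groupConv X f H) := by
  have h1 := (contDiff_groupConv_expProd hA hX hH hf hc).contMDiff.comp (contMDiff_coords hA hX)
  have h2 : (fun p => groupConv X f H (expProd X p)) ∘ coords X = groupConv X f H := by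
    ext1 g
    rw [Function.comp_apply, expProd_coords hX]
  rwa [h2] at h1

/-- Differentiate f(κ(exp(s X_i) g E(t))), E = `expProd X`, under the integral: coordinates move
along the i-th column of `invFrame`. All integrands with |s| ≤ 1 live on the compact set K, which
supplies the dominating function. -/
theorem hasDerivAt_groupConv (hA : ∀ i, IsStrictLower (adMat X i))
    (hX : ∀ g : G, ∃! t : Fin d → ℝ, expProd X t = g) (hH : Continuous H) (hf : ContDiff ℝ ∞ f)
    (hc : HasCompactSupport f) (i : Fin d) (g : G) :
    HasDerivAt (fun s : ℝ => groupConv X f H (lieExp (s • X i) * g))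
      (groupConv X (frameDeriv (adMat X) i f) H g) 0 := by
  have : IsTopologicalGroup G := topologicalGroup_of_lieGroup (𝓡 d) ∞
  have hE := (contMDiff_expProd X).continuous
  have hκ := (contMDiff_coords hA hX).continuous
  have hf' := contDiff_frameDeriv (A := adMat X) i hf
  have hs' : Function.support (frameDeriv (adMat X) i f) ⊆ tsupport f :=
    support_foldr_frameDeriv [i] (isClosed_tsupport f) (subset_tsupport f)
  have hc' : HasCompactSupport (frameDeriv (adMat X) i f) :=
    HasCompactSupport.of_support_subset_isCompact hc hs'
  obtain ⟨B, hB⟩ := hf'.continuous.bounded_above_of_compact_support hc'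
  have hexp : Continuous fun s : ℝ => lieExp (s • X i) := continuous_lieExp_smul _
  simp only [groupConv_eq hA hX hH hf.continuous, groupConv_eq hA hX hH hf'.continuous]
  let K : Set (Fin d → ℝ) := (fun q : ℝ × (Fin d → ℝ) =>
    coords X ((lieExp (q.1 • X i) * g)⁻¹ * expProd X q.2)) '' (Icc (-1) 1 ×ˢ tsupport f)
  have hK : IsCompact K := by
    refine (isCompact_Icc.prod hc).image ?_
    exact hκ.comp (((hexp.comp continuous_fst).mul continuous_const).inv.mul
      (hE.comp continuous_snd))
  have hHE : Continuous fun t => H (expProd X t)⁻¹ := hH.comp hE.inv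
  have hmeas : ∀ (φ : (Fin d → ℝ) → ℝ), Continuous φ → ∀ s : ℝ,
      Continuous fun t => φ (coords X (lieExp (s • X i) * g * expProd X t)) • H (expProd X t)⁻¹ :=
    fun φ hφ s => (hφ.comp (hκ.comp (continuous_const.mul hE))).smul hHE
  have hzero : ∀ φ : (Fin d → ℝ) → ℝ, Function.support φ ⊆ tsupport f → ∀ s ∈ Icc (-1 : ℝ) 1,
      ∀ t ∉ K, φ (coords X (lieExp (s • X i) * g * expProd X t)) = 0 := by
    intro φ hφ s hs t ht
    by_contra hne
    refine ht ⟨(s, coords X (lieExp (s • X i) * g * expProd X t)), ⟨hs, hφ hne⟩, ?_⟩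
    simp only [expProd_coords hX, inv_mul_cancel_left, coords_expProd hX]
  have hint : ∀ φ : (Fin d → ℝ) → ℝ, Continuous φ → Function.support φ ⊆ tsupport f →
      Integrable fun t => φ (coords X (lieExp ((0 : ℝ) • X i) * g * expProd X t)) •
        H (expProd X t)⁻¹ := fun φ hφ hs =>
    (hmeas φ hφ 0).integrable_of_hasCompactSupport (HasCompactSupport.intro hK fun t ht => by
      rw [hzero φ hs 0 (by simp) t ht, zero_smul])
  have key := hasDerivAt_integral_of_dominated_loc_of_deriv_le (𝕜 := ℝ) (μ := volume)
    (x₀ := (0 : ℝ)) (s := Metric.ball 0 1)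
    (F := fun s t => f (coords X (lieExp (s • X i) * g * expProd X t)) • H (expProd X t)⁻¹)
    (F' := fun s t => frameDeriv (adMat X) i f (coords X (lieExp (s • X i) * g * expProd X t)) •
      H (expProd X t)⁻¹)
    (bound := K.indicator fun t => B * ‖H (expProd X t)⁻¹‖)
    (Metric.ball_mem_nhds 0 one_pos)
    (Eventually.of_forall fun s => (hmeas f hf.continuous s).aestronglyMeasurable)
    (hint f hf.continuous (subset_tsupport f))
    (hmeas _ hf'.continuous 0).aestronglyMeasurable ?_ ?_ ?_
  · have h2 := key.2
    simp only [lieExp_zero_smul, one_mul] at h2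
    exact h2
  · refine Eventually.of_forall fun t s hs => ?_
    rw [mem_ball_zero_iff, Real.norm_eq_abs] at hs
    by_cases ht : t ∈ K
    · rw [indicator_of_mem ht, norm_smul]
      gcongr
      exact hB _
    · rw [indicator_of_notMem ht, hzero _ hs' s (abs_le.1 hs.le) t ht, zero_smul, norm_zero]
  · rw [integrable_indicator_iff hK.measurableSet]
    exact (continuous_const.mul hHE.norm).continuousOn.integrableOn_compact hK
  · refine Eventually.of_forall fun t s _ => HasDerivAt.smul_const ?_ _
    have h3 := hasDerivAt_coords_coExp_mul hA hX (g * expProd X t) (Pi.single i 1) s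
    simp only [coExp_smul_single, ← mul_assoc] at h3
    exact ((hf.differentiable (by simp) _).hasFDerivAt).comp_hasDerivAt s h3

end GroupConv

/-! ### Passing to the quotient -/

section Descend

theorem norm_le_supNorm {α : Type*} {F : α → ℂ} (hF : supNorm F ≠ ⊤) (x : α) :
    ‖F x‖ ≤ (supNorm F).toReal := by
  have := ENNReal.toReal_mono hF (le_iSup (fun x => ‖F x‖ₑ) x)
  simpa using this

variable {d : ℕ} {G : Type u} [Group G] [TopologicalSpace G]
  [ChartedSpace (EuclideanSpace ℝ (Fin d)) G]
  {X : Module.Basis (Fin d) ℝ (GroupLieAlgebra (𝓡 d) G)} {Γ : Subgroup G}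

/-- The function on `G/Γ` which on the fundamental domain is `φ` in Mal'cev coordinates. -/
def descend (X : Module.Basis (Fin d) ℝ (GroupLieAlgebra (𝓡 d) G)) (φ : (Fin d → ℝ) → ℝ)
    (x : G ⧸ Γ) : ℝ :=
  open Classical in
  if h : ∃ g ∈ fundDomain X, (g : G ⧸ Γ) = x then φ (coords X h.choose) else 0

theorem descend_nonneg {φ : (Fin d → ℝ) → ℝ} (hφ : ∀ t, 0 ≤ φ t) (x : G ⧸ Γ) :
    0 ≤ descend X φ x := by
  unfold descend
  split_ifs
  · exact hφ _
  · exact le_rfl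

theorem exists_of_descend_ne_zero {φ : (Fin d → ℝ) → ℝ} {x : G ⧸ Γ} (hx : descend X φ x ≠ 0) :
    ∃ g : G, (g : G ⧸ Γ) = x ∧ φ (coords X g) ≠ 0 := by
  unfold descend at hx
  split_ifs at hx with h
  · exact ⟨h.choose, h.choose_spec.2, hx⟩
  · exact absurd rfl hx

theorem mem_fundDomain_of_norm_lt {g : G} (hg : ‖coords X g‖ < 1 / 2) : g ∈ fundDomain X := by
  intro i
  have h1 := abs_lt.1 ((norm_le_pi_norm (coords X g) i).trans_lt hg)
  exact ⟨by linarith [h1.1], h1.2⟩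

theorem groupDist_le (x y : G) : groupDist X x y ≤ ‖coords X (x * y⁻¹)‖ₑ := by
  let c : ℕ → G := fun n => if n = 0 then x else y
  have h0 : c 0 = x := rfl
  have h1 : c 1 = y := rfl
  refine (iInf_le _ 1).trans ((iInf_le _ c).trans ((iInf_le _ h0).trans ((iInf_le _ h1).trans ?_)))
  simp [h0, h1]

theorem quotDist_le (g h : G) :
    quotDist X (g : G ⧸ Γ) ((h⁻¹ * g : G) : G ⧸ Γ) ≤ ‖coords X h‖ₑ := by
  refine (iInf_le _ g).trans ((iInf_le _ (h⁻¹ * g)).trans ((iInf_le _ rfl).trans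
    ((iInf_le _ rfl).trans ((groupDist_le _ _).trans ?_))))
  simp

theorem supNorm_le_lipNorm (F : G ⧸ Γ → ℂ) : supNorm F ≤ lipNorm X F := le_self_add

theorem norm_sub_inv_mul_le {F : G ⧸ Γ → ℂ} (hF : lipNorm X F ≠ ⊤) (g h : G) :
    ‖F (g : G ⧸ Γ) - F ((h⁻¹ * g : G) : G ⧸ Γ)‖ ≤ (lipNorm X F).toReal * ‖coords X h‖ := by
  set x : G ⧸ Γ := (g : G ⧸ Γ)
  set y : G ⧸ Γ := ((h⁻¹ * g : G) : G ⧸ Γ)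
  have h1 : ‖F x - F y‖ₑ / quotDist X x y ≤ lipNorm X F :=
    (le_iSup_of_le x (le_iSup (fun y => ‖F x - F y‖ₑ / quotDist X x y) y)).trans le_add_self
  have h2 : ‖F x - F y‖ₑ ≤ lipNorm X F * quotDist X x y := by
    -- No separation property of the distance is needed: a / 0 = ⊤ for a ≠ 0, so finiteness of the
    -- Lipschitz norm forces F x = F y here.
    by_cases h0 : quotDist X x y = 0
    · by_cases ha : ‖F x - F y‖ₑ = 0
      · rw [ha]; exact zero_le
      · rw [h0, ENNReal.div_zero ha] at h1
        exact absurd (top_le_iff.1 h1) hF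
    · exact (ENNReal.div_le_iff_le_mul (Or.inl h0) (Or.inl
        ((quotDist_le g h).trans_lt enorm_lt_top).ne)).1 h1
  have h3 : ‖F x - F y‖ₑ ≤ lipNorm X F * ‖coords X h‖ₑ :=
    h2.trans (mul_le_mul_right (quotDist_le g h) _)
  have h4 := ENNReal.toReal_mono (ENNReal.mul_ne_top hF enorm_ne_top) h3
  simpa using h4

variable [LieGroup (𝓡 d) ∞ G] [T2Space G]

theorem continuous_of_lipNorm_ne_top (hA : ∀ i, IsStrictLower (adMat X i))
    (hX : ∀ g : G, ∃! t : Fin d → ℝ, expProd X t = g) {F : G ⧸ Γ → ℂ} (hF : lipNorm X F ≠ ⊤) :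
    Continuous fun g : G => F (g : G ⧸ Γ) := by
  have : IsTopologicalGroup G := topologicalGroup_of_lieGroup (𝓡 d) ∞
  rw [continuous_iff_continuousAt]
  intro g
  rw [ContinuousAt, tendsto_iff_norm_sub_tendsto_zero]
  have h1 : Continuous fun g' : G => (lipNorm X F).toReal * ‖coords X (g' * g⁻¹)‖ :=
    continuous_const.mul ((contMDiff_coords hA hX).continuous.comp
      (continuous_id.mul continuous_const)).norm
  have h0 : coords X (1 : G) = 0 := by rw [← expProd_zero X, coords_expProd hX]
  have h2 := h1.tendsto g
  rw [mul_inv_cancel, h0, norm_zero, mul_zero] at h2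
  refine squeeze_zero (fun _ => norm_nonneg _) (fun g' => ?_) h2
  have h3 := norm_sub_inv_mul_le hF g' (g' * g⁻¹)
  rwa [mul_inv_rev, inv_inv, mul_assoc, inv_mul_cancel, mul_one] at h3

/-- Representatives in the box are unique, so the chosen one is g. That every coset has one is never
used; the default value 0 covers the rest. -/
theorem descend_mk (hA : ∀ i, IsStrictLower (adMat X i)) (hX : IsMalcevBasis Γ X)
    (φ : (Fin d → ℝ) → ℝ) {g : G} (hg : g ∈ fundDomain X) :
    descend X φ (g : G ⧸ Γ) = φ (coords X g) := by
  have h : ∃ h ∈ fundDomain X, (h : G ⧸ Γ) = (g : G ⧸ Γ) := ⟨g, hg, rfl⟩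
  rw [descend, dif_pos h, eq_of_mem_fundDomain hA hX h.choose_spec.1 hg h.choose_spec.2]

-- Near a coset meeting the open box, translate by γ into the box and read off φ. Any other point
-- lies outside S Γ, where S is the compact set of elements with coordinates in the ball of radius ρ
-- < 1/2; since Γ is closed, S Γ is closed and the function vanishes nearby.
open scoped Pointwise in
theorem isSmooth_descend (hA : ∀ i, IsStrictLower (adMat X i)) (hX : IsMalcevBasis Γ X)
    [DiscreteTopology Γ] {φ : (Fin d → ℝ) → ℝ} (hφ : ContDiff ℝ ∞ φ) {ρ : ℝ} (hρ : ρ < 1 / 2)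
    (hs : Function.support φ ⊆ Metric.closedBall 0 ρ) :
    IsSmooth d (descend X φ : G ⧸ Γ → ℝ) := by
  have : IsTopologicalGroup G := topologicalGroup_of_lieGroup (𝓡 d) ∞
  have hκ := contMDiff_coords hA hX.existsUnique_coord
  intro g₀
  by_cases hg : ∃ γ ∈ Γ, ‖coords X (g₀ * γ)‖ < 1 / 2
  · obtain ⟨γ, hγ, hlt⟩ := hg
    have h1 : ContMDiff (𝓡 d) 𝓘(ℝ, ℝ) ∞ fun g => φ (coords X (g * γ)) :=
      hφ.contMDiff.comp (hκ.comp contMDiff_mul_right)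
    refine h1.contMDiffAt.congr_of_eventuallyEq ?_
    have h2 : Continuous fun g => ‖coords X (g * γ)‖ :=
      (hκ.continuous.comp (continuous_mul_const γ)).norm
    filter_upwards [h2.continuousAt.eventually_lt continuousAt_const hlt] with g hg
    rw [← descend_mk hA hX φ (mem_fundDomain_of_norm_lt hg)]
    congr 1
    rw [QuotientGroup.eq, inv_mul_cancel_left]
    exact hγ
  · have hS : IsCompact (coords X ⁻¹' Metric.closedBall 0 ρ) := by
      have : coords X ⁻¹' Metric.closedBall 0 ρ = expProd X '' Metric.closedBall 0 ρ :=
        ((expProdHomeomorph hA hX.existsUnique_coord).toEquiv.image_eq_preimage_symm _).symm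
      rw [this]
      exact (isCompact_closedBall 0 ρ).image (contMDiff_expProd X).continuous
    have hΓ : IsClosed (Γ : Set G) := Subgroup.isClosed_of_discrete
    have hc : IsClosed ((coords X ⁻¹' Metric.closedBall 0 ρ) * (Γ : Set G)) :=
      hΓ.mul_left_of_isCompact hS
    have h0 : g₀ ∉ (coords X ⁻¹' Metric.closedBall 0 ρ) * (Γ : Set G) := by
      rintro ⟨s, hs, γ, hγ, rfl⟩
      refine hg ⟨γ⁻¹, Γ.inv_mem hγ, ?_⟩
      simp only [mul_inv_cancel_right]
      exact (mem_closedBall_zero_iff.1 hs).trans_lt hρ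
    refine (contMDiffAt_const (c := (0 : ℝ))).congr_of_eventuallyEq ?_
    filter_upwards [hc.isOpen_compl.mem_nhds h0] with g hg'
    by_contra hne
    obtain ⟨h, hh, hφh⟩ := exists_of_descend_ne_zero hne
    exact hg' ⟨h, hs hφh, h⁻¹ * g, QuotientGroup.eq.1 hh, mul_inv_cancel_left _ _⟩

/-- Each derivative passes onto the kernel, which stays smooth and keeps its compact support, so the
next one can follow. -/
theorem foldr_lieDeriv_eq (hA : ∀ i, IsStrictLower (adMat X i))
    (hX : ∀ g : G, ∃! t : Fin d → ℝ, expProd X t = g) {H : G → ℂ} (hH : Continuous H)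
    {f : (Fin d → ℝ) → ℝ} (hf : ContDiff ℝ ∞ f) (hc : HasCompactSupport f) {Φ : G ⧸ Γ → ℂ}
    (hΦ : ∀ g : G, Φ (g : G ⧸ Γ) = groupConv X f H g) (l : List (Fin d)) (g : G) :
    l.foldr (fun i f => lieDeriv (X i) f) Φ (g : G ⧸ Γ) =
      groupConv X (l.foldr (frameDeriv (adMat X)) f) H g := by
  induction l generalizing g with
  | nil => exact hΦ g
  | cons i l ih =>
    have hc' : HasCompactSupport (l.foldr (frameDeriv (adMat X)) f) :=
      HasCompactSupport.of_support_subset_isCompact hc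
        (support_foldr_frameDeriv l (isClosed_tsupport f) (subset_tsupport f))
    have h1 := hasDerivAt_groupConv hA hX hH (contDiff_foldr_frameDeriv (A := adMat X) l hf) hc' i g
    simp only [← ih] at h1
    exact h1.deriv

variable [MeasurableSpace G] [BorelSpace G] [SecondCountableTopology G]

/-- The support of φ lies inside the box, so the integral over the box is the integral over ℝ^d. -/
theorem integral_descend_smul (hA : ∀ i, IsStrictLower (adMat X i)) (hX : IsMalcevBasis Γ X)
    [DiscreteTopology Γ] (μ : Measure G) [μ.IsHaarMeasure]
    {φ : (Fin d → ℝ) → ℝ} (hφ : ContDiff ℝ ∞ φ) {ρ : ℝ} (hρ : ρ < 1 / 2)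
    (hs : Function.support φ ⊆ Metric.closedBall 0 ρ) {E : Type*} [NormedAddCommGroup E]
    [NormedSpace ℝ E] {H : G → E} (hH : Continuous H) :
    ∫ h, descend X φ (h : G ⧸ Γ) • H h ∂(nilMeasure X μ) = ∫ t, φ t • H (expProd X t) := by
  have hE := (contMDiff_expProd X).continuous
  have hcont : Continuous fun h : G => descend X φ (h : G ⧸ Γ) • H h :=
    (isSmooth_descend hA hX hφ hρ hs).continuous.smul hH
  have hbox : MeasurableSet (Set.univ.pi fun _ : Fin d => Ico (-(1 / 2) : ℝ) (1 / 2)) :=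
    MeasurableSet.univ_pi fun _ => measurableSet_Ico
  rw [nilMeasure_eq hA hX.existsUnique_coord, integral_map hE.aemeasurable
    hcont.aestronglyMeasurable]
  rw [setIntegral_congr_fun (g := fun t => φ t • H (expProd X t)) hbox]
  · refine setIntegral_eq_integral_of_forall_compl_eq_zero fun t ht => ?_
    have : φ t = 0 := by
      by_contra hne
      refine ht fun i _ => ?_
      have h1 := abs_lt.1 ((norm_le_pi_norm t i).trans_lt
        ((mem_closedBall_zero_iff.1 (hs hne)).trans_lt hρ))
      exact ⟨by linarith [h1.1], h1.2⟩
    rw [this, zero_smul]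
  · intro t ht
    have : expProd X t ∈ fundDomain X := fun i => by
      rw [coords_expProd hX.existsUnique_coord]; exact ht i (mem_univ i)
    simp only [descend_mk hA hX φ this, coords_expProd hX.existsUnique_coord]

theorem conv_descend (hA : ∀ i, IsStrictLower (adMat X i)) (hX : IsMalcevBasis Γ X)
    [DiscreteTopology Γ] (μ : Measure G) [μ.IsHaarMeasure]
    {φ : (Fin d → ℝ) → ℝ} (hφ : ContDiff ℝ ∞ φ) {ρ : ℝ} (hρ : ρ < 1 / 2)
    (hs : Function.support φ ⊆ Metric.closedBall 0 ρ) {F : G ⧸ Γ → ℂ}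
    (hF : Continuous fun g : G => F (g : G ⧸ Γ)) (g : G) :
    conv X μ F (descend X φ) (g : G ⧸ Γ) = groupConv X φ (fun g => F (g : G ⧸ Γ)) g := by
  have : IsTopologicalGroup G := topologicalGroup_of_lieGroup (𝓡 d) ∞
  exact integral_descend_smul hA hX μ hφ hρ hs
    (H := fun h => F ((h⁻¹ * g : G) : G ⧸ Γ))
    (hF.comp (continuous_inv.mul continuous_const))

end Descend

/-! ### Uniform approximation and the Sobolev bound -/

section Main

theorem DerivBound.of_le {d : ℕ} {E : Type*} [NormedAddCommGroup E] [NormedSpace ℝ E] {r r' : ℕ}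
    {B Λ : ℝ} {f : (Fin d → ℝ) → E} (h : DerivBound r B Λ f) (hr : r' ≤ r) :
    DerivBound r' B Λ f := by
  induction hr with
  | refl => exact h
  | step _ ih => exact ih h.of_succ

variable {d : ℕ} {G : Type u} [Group G] [TopologicalSpace G]
  [ChartedSpace (EuclideanSpace ℝ (Fin d)) G]
  {X : Module.Basis (Fin d) ℝ (GroupLieAlgebra (𝓡 d) G)}

/-- Rationality enters only through |q| ≤ |num q| ≤ Q. The factor d + 1 in place of d keeps the
bound at least 1 when d = 0. -/
theorem norm_adMat_le {Q : ℝ} (hQ : 1 ≤ Q) (hX : IsRationalBasis Q X) (i : Fin d) :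
    ‖adMat X i‖ ≤ (d + 1) * Q := by
  obtain ⟨q, hq, hb⟩ := hX
  have h1 : ∀ j, ‖X.equivFun ⁅X i, X j⁆‖ ≤ Q := fun j => by
    rw [pi_norm_le_iff_of_nonneg (by linarith)]
    intro k
    have h2 : X.equivFun ⁅X i, X j⁆ k = (q i j k : ℝ) := by
      rw [hq, ← Module.Basis.equivFun_symm_apply, LinearEquiv.apply_symm_apply]
    rw [h2, Rat.cast_def, norm_div, Real.norm_natCast, Real.norm_eq_abs, ← Int.cast_abs,
      Int.abs_eq_natAbs, Int.cast_natCast]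
    have h3 : (1 : ℝ) ≤ (q i j k).den := by exact_mod_cast (q i j k).den_pos
    exact (div_le_self (by positivity) h3).trans (hb i j k).1
  refine ContinuousLinearMap.opNorm_le_bound _ (by positivity) fun v => ?_
  simp only [adMat, sum_apply, ContinuousLinearMap.smulRight_apply, ContinuousLinearMap.proj_apply]
  calc _ ≤ ∑ _j : Fin d, ‖v‖ * Q := by
        refine (norm_sum_le _ _).trans (Finset.sum_le_sum fun j _ => ?_)
        rw [norm_smul]
        exact mul_le_mul (norm_le_pi_norm v j) (h1 j) (norm_nonneg _) (norm_nonneg _)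
    _ = d * Q * ‖v‖ := by
        rw [Finset.sum_const, Finset.card_univ, Fintype.card_fin, nsmul_eq_mul]; ring
    _ ≤ (d + 1) * Q * ‖v‖ := by gcongr; linarith

/-- The constant in the bound for the frame of invariant vector fields. -/
def frameConst (d : ℕ) : ℝ := (d + 1) * ((d + 1) * ((d + 1) * (d + 1) ^ d) ^ d) ^ d

theorem one_le_frameConst (d : ℕ) : 1 ≤ frameConst d := by
  have h : (1 : ℝ) ≤ d + 1 := by simp
  have h1 := one_le_mul_of_one_le_of_one_le h (one_le_pow₀ (n := d) h)
  have h2 := one_le_mul_of_one_le_of_one_le h (one_le_pow₀ (n := d) h1)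
  exact one_le_mul_of_one_le_of_one_le h (one_le_pow₀ (n := d) h2)

/-- With M = (d + 1) Q the frame is bounded by `frameConst d` · Q^{d³}, and every rate up to step m
is O_d(m/ε). -/
theorem foldr_frameDeriv_bound {A : Fin d → (Fin d → ℝ) →L[ℝ] (Fin d → ℝ)} {Q : ℝ} (hQ : 1 ≤ Q)
    (hA : ∀ i, ‖A i‖ ≤ (d + 1) * Q) {m : ℕ} (hm : 1 ≤ m) {ε B : ℝ} (hε : 0 < ε) (hε1 : ε ≤ 1)
    {φ : (Fin d → ℝ) → ℝ} (hφ : ContDiff ℝ ∞ φ) (hb : DerivBound m B (d * (4 * m / ε)) φ)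
    (l : List (Fin d)) (hl : l.length ≤ m) (t : Fin d → ℝ) (ht : ‖t‖ ≤ 1) :
    ‖l.foldr (frameDeriv A) φ t‖ ≤ B * ((d + 1) * frameConst d *
      (4 * (d + 1) + d * (d * d)) * (m / ε) * Q ^ (d * (d * d))) ^ m := by
  have hm' : (1 : ℝ) ≤ m := by exact_mod_cast hm
  have hM : 1 ≤ ((d : ℝ) + 1) * Q := one_le_mul_of_one_le_of_one_le (by simp) hQ
  have hV := fun r => (derivBound_invFrame hM hA r).2
  have hB := hb.nonneg
  have h1 := (derivBound_foldr_frameDeriv (derivBound_invFrame hM hA 0).1 hV (by positivity)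
    (by positivity) hφ (m := m) l (r := 0) (by omega) (hb.of_le (by omega))).norm_le t ht
  refine h1.trans (mul_le_mul_of_nonneg_left ?_ hB)
  have e : ((d : ℝ) + 1) * ((d + 1) * ((d + 1) * ((d + 1) * Q) ^ d) ^ d) ^ d =
      frameConst d * Q ^ (d * (d * d)) := by
    simp only [frameConst, mul_pow, ← pow_mul]
    rw [show d * (d * d) = d * d * d by ring]
    ring
  have hmε : 1 ≤ (m : ℝ) / ε := by rw [le_div_iff₀ hε]; linarith
  have hC := one_le_frameConst d
  rw [e]
  have hQK : 1 ≤ Q ^ (d * (d * d)) := one_le_pow₀ hQ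
  have h2 : d * (frameConst d * Q ^ (d * (d * d))) * (d * (4 * m / ε) + m * (d * (d * d))) ≤
      (d + 1) * frameConst d * (4 * (d + 1) + d * (d * d)) * (m / ε) * Q ^ (d * (d * d)) := by
    have h3 : (m : ℝ) ≤ m / ε := le_div_self (by positivity) hε hε1
    calc _ ≤ (d + 1) * (frameConst d * Q ^ (d * (d * d))) *
          ((d + 1) * (4 * (m / ε)) + m / ε * (d * (d * d))) := by
          rw [mul_div_assoc]
          gcongr <;> linarith
      _ = _ := by ring
  -- The factor per derivative is at least 1, so fewer than m derivatives also obey the bound with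
  -- exponent m.
  have h4 : 1 ≤ (d + 1) * frameConst d * (4 * (d + 1) + d * (d * d)) * (m / ε) *
      Q ^ (d * (d * d)) := by
    refine one_le_mul_of_one_le_of_one_le (one_le_mul_of_one_le_of_one_le
      (one_le_mul_of_one_le_of_one_le (one_le_mul_of_one_le_of_one_le (by simp) hC) ?_) hmε) hQK
    have : (0 : ℝ) ≤ d * (d * d) := by positivity
    have : (0 : ℝ) ≤ d := by positivity
    linarith
  exact (pow_le_pow_left₀ (by positivity) h2 _).trans (pow_le_pow_right₀ h4 hl)

variable [LieGroup (𝓡 d) ∞ G] [T2Space G] {Γ : Subgroup G}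

theorem norm_sub_groupConv_le_of_lipschitz (hX : ∀ g : G, ∃! t : Fin d → ℝ, expProd X t = g)
    {φ : (Fin d → ℝ) → ℝ} (hφ : Continuous φ) (hφc : HasCompactSupport φ) (hφ0 : ∀ t, 0 ≤ φ t)
    (hφ1 : ∫ t, φ t = 1) {ε : ℝ} (hε : 0 ≤ ε)
    (hφs : Function.support φ ⊆ Metric.closedBall 0 (ε / 2)) {H : G → ℂ} (hH : Continuous H) {L : ℝ}
    (hL0 : 0 ≤ L) (hL : ∀ g h, ‖H g - H (h⁻¹ * g)‖ ≤ L * ‖coords X h‖) (g : G) :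
    ‖H g - groupConv X φ H g‖ ≤ ε * L := by
  have hi := integrable_smul_inv_expProd_mul (X := X) hH hφ hφc g
  refine norm_sub_groupConv_le (hφ.integrable_of_hasCompactSupport hφc) hφ0 hφ1 g hi fun t ht => ?_
  refine (hL g (expProd X t)).trans ?_
  rw [coords_expProd hX, mul_comm]
  have h2 := mem_closedBall_zero_iff.1 (hφs ht)
  gcongr
  linarith

theorem supNorm_sub_le (hX : ∀ g : G, ∃! t : Fin d → ℝ, expProd X t = g) {F Φ : G ⧸ Γ → ℂ}
    (hF : lipNorm X F ≠ ⊤) (hFc : Continuous fun g : G => F (g : G ⧸ Γ)) {φ : (Fin d → ℝ) → ℝ}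
    (hφ : Continuous φ) (hφc : HasCompactSupport φ) (hφ0 : ∀ t, 0 ≤ φ t) (hφ1 : ∫ t, φ t = 1)
    {ε : ℝ} (hε : 0 < ε) (hφs : Function.support φ ⊆ Metric.closedBall 0 (ε / 2))
    (hΦ : ∀ g : G, Φ (g : G ⧸ Γ) = groupConv X φ (fun g => F (g : G ⧸ Γ)) g) :
    supNorm (F - Φ) ≤ ENNReal.ofReal ε * (1 + lipNorm X F) := by
  refine iSup_le fun x => ?_
  obtain ⟨g, rfl⟩ := QuotientGroup.mk_surjective x
  rw [Pi.sub_apply, hΦ]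
  have h1 := norm_sub_groupConv_le_of_lipschitz hX hφ hφc hφ0 hφ1 hε.le hφs hFc
    ENNReal.toReal_nonneg (norm_sub_inv_mul_le hF) g
  rw [← ofReal_norm]
  calc _ ≤ ENNReal.ofReal (ε * (lipNorm X F).toReal) := ENNReal.ofReal_le_ofReal h1
    _ = ENNReal.ofReal ε * lipNorm X F := by
      rw [ENNReal.ofReal_mul hε.le, ENNReal.ofReal_toReal hF]
    _ ≤ _ := by gcongr; exact le_add_self

/-- The ball of radius ε/2 has volume ε^d, which cancels ε^{-d} from the sup of the bump. Since ε ≤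
C₁⁻¹ and m ≥ 1 give C₁ ≤ m/ε, the constant C₁^m is traded for a second factor (m/ε)^m. -/
theorem sobolevNorm_le (hA : ∀ i, IsStrictLower (adMat X i))
    (hX : ∀ g : G, ∃! t : Fin d → ℝ, expProd X t = g) {Q : ℝ} (hQ : 1 ≤ Q)
    (hrat : IsRationalBasis Q X) {F Φ : G ⧸ Γ → ℂ}
    (hFc : Continuous fun g : G => F (g : G ⧸ Γ)) (hF : supNorm F ≠ ⊤) {m : ℕ} (hm : 1 ≤ m) {ε : ℝ}
    (hε : 0 < ε) (hε1 : ε ≤ 1) {φ : (Fin d → ℝ) → ℝ} (hφ : ContDiff ℝ ∞ φ)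
    (hφs : Function.support φ ⊆ Metric.closedBall 0 (ε / 2)) {C : ℝ} (hC : 0 < C)
    (hφb : DerivBound m ((C / ε) ^ d) (d * (4 * m / ε)) φ)
    (hΦ : ∀ g : G, Φ (g : G ⧸ Γ) = groupConv X φ (fun g => F (g : G ⧸ Γ)) g)
    (hεc : ε ≤ ((d + 1) * frameConst d * (4 * (d + 1) + d * (d * d)))⁻¹) :
    sobolevNorm X m Φ ≤
      ENNReal.ofReal (C ^ d * ((m : ℝ) / ε) ^ (2 * m) * Q ^ (d * (d * d) * m)) * supNorm F := by
  have hm' : (1 : ℝ) ≤ m := by exact_mod_cast hm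
  have hφc : HasCompactSupport φ :=
    HasCompactSupport.of_support_subset_isCompact (isCompact_closedBall _ _) hφs
  have hf := one_le_frameConst d
  refine iSup₂_le fun l hl => iSup_le fun x => ?_
  obtain ⟨g, rfl⟩ := QuotientGroup.mk_surjective x
  rw [foldr_lieDeriv_eq hA hX hFc hφ hφc hΦ l g]
  have h1 := norm_groupConv_le (X := X) (by positivity : 0 ≤ ε / 2)
    (support_foldr_frameDeriv (A := adMat X) l Metric.isClosed_closedBall hφs)
    (fun t ht => foldr_frameDeriv_bound hQ (norm_adMat_le hQ hrat) hm hε hε1 hφ hφb l hl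
      t ((mem_closedBall_zero_iff.1 ht).trans (by linarith)))
    (fun g : G => norm_le_supNorm hF (g : G ⧸ Γ)) g
  have hC₁ : 0 < ((d : ℝ) + 1) * frameConst d * (4 * (d + 1) + d * (d * d)) := by positivity
  generalize ((d : ℝ) + 1) * frameConst d * (4 * (d + 1) + d * (d * d)) = C₁ at *
  have h2 : (C / ε) ^ d * (C₁ * (m / ε) * Q ^ (d * (d * d))) ^ m * (2 * (ε / 2)) ^ d ≤
      C ^ d * ((m : ℝ) / ε) ^ (2 * m) * Q ^ (d * (d * d) * m) := by
    have h3 : C₁ ≤ m / ε := by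
      rw [le_div_iff₀ hε]
      have : C₁ * ε ≤ C₁ * C₁⁻¹ := by gcongr
      rw [mul_inv_cancel₀ hC₁.ne'] at this
      linarith
    calc _ = C ^ d * (C₁ * (m / ε) * Q ^ (d * (d * d))) ^ m := by
          rw [mul_div_cancel₀ _ two_ne_zero, div_pow]
          field_simp
      _ ≤ C ^ d * ((m / ε) * (m / ε) * Q ^ (d * (d * d))) ^ m := by gcongr
      _ = _ := by rw [mul_pow, ← pow_mul, ← sq, ← pow_mul, mul_assoc (C ^ d)]
  rw [← ofReal_norm]
  calc _ ≤ ENNReal.ofReal (C ^ d * ((m : ℝ) / ε) ^ (2 * m) * Q ^ (d * (d * d) * m) *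
        (supNorm F).toReal) := ENNReal.ofReal_le_ofReal (h1.trans (by gcongr))
    _ = _ := by rw [ENNReal.ofReal_mul (by positivity), ENNReal.ofReal_toReal hF]

end Main

end Nil

end

/-! ### Choice of constants and of the bump -/

open Nil in
theorem lemma7p9 (d : ℕ) :
    ∃ (c C : ℝ) (K : ℕ), 0 < c ∧ c < 1 ∧ 0 < C ∧
      ∀ (G : Type*) [Group G] [TopologicalSpace G] [T2Space G] [SecondCountableTopology G]
        [ChartedSpace (EuclideanSpace ℝ (Fin d)) G] [LieGroup (𝓡 d) ∞ G]
        [SimplyConnectedSpace G] [Group.IsNilpotent G]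
        [MeasurableSpace G] [BorelSpace G] (μ : Measure G) [μ.IsHaarMeasure]
        (Γ : Subgroup G) [DiscreteTopology Γ] [CompactSpace (G ⧸ Γ)]
        (X : Module.Basis (Fin d) ℝ (GroupLieAlgebra (𝓡 d) G)) (Q : ℝ),
        Nil.IsMalcevBasis Γ X → 1 ≤ Q → Nil.IsRationalBasis Q X →
        ∀ F : G ⧸ Γ → ℂ, Nil.lipNorm X F ≠ ⊤ →
        ∀ m : ℕ, 1 ≤ m → ∀ ε : ℝ, 0 < ε → ε < c →
        ∃ ψ : G ⧸ Γ → ℝ,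
          -- `ψ` is a smooth bump at the base point
          Nil.IsSmooth d ψ ∧ (∀ x, 0 ≤ ψ x) ∧
          (∫ h, ψ (h : G ⧸ Γ) ∂(Nil.nilMeasure X μ)) = 1 ∧
          Function.support ψ ⊆
            (fun g : G => (g : G ⧸ Γ)) '' {g | ‖Nil.coords X g‖ < min ε (1 / 2)} ∧
          -- uniform approximation
          Nil.supNorm (F - Nil.conv X μ F ψ) ≤ ENNReal.ofReal ε * (1 + Nil.lipNorm X F) ∧
          -- smoothness and Sobolev bound
          Nil.IsSmooth d (Nil.conv X μ F ψ) ∧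
          Nil.sobolevNorm X m (Nil.conv X μ F ψ) ≤
            ENNReal.ofReal (C * ((m : ℝ) / ε) ^ (2 * m) * Q ^ (K * m)) * Nil.supNorm F := by
  obtain ⟨C₀, hC₀, hbump⟩ := exists_box_bump d
  set C₁ : ℝ := (d + 1) * frameConst d * (4 * (d + 1) + d * (d * d)) with hC₁
  have hC₁4 : 4 ≤ C₁ := by
    have h0 : (1 : ℝ) ≤ (d + 1) * frameConst d :=
      one_le_mul_of_one_le_of_one_le (by simp) (one_le_frameConst d)
    have h1 : (4 : ℝ) ≤ 4 * (d + 1) + d * (d * d) := by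
      have : (0 : ℝ) ≤ d * (d * d) := by positivity
      have : (0 : ℝ) ≤ d := by positivity
      linarith
    calc (4 : ℝ) = 1 * 4 := by norm_num
      _ ≤ _ := by rw [hC₁]; gcongr
  have hc4 : C₁⁻¹ ≤ 1 / 4 := by rw [one_div]; gcongr
  -- The threshold 1/C₁ is what lets (m/ε)^m absorb C₁^m, and C₁ ≥ 4 keeps it below 1 and the bump
  -- inside the box. C₀^d is the constant of the box bump, and d³ is the power of Q in the frame
  -- bound.
  refine ⟨C₁⁻¹, C₀ ^ d, d * (d * d), by positivity, by linarith, by positivity, ?_⟩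
  intro G _ _ _ _ _ _ _ _ _ _ μ _ Γ _ _ X Q hX hQ hrat F hF m hm ε hε hεc
  have hm' : (1 : ℝ) ≤ m := by exact_mod_cast hm
  have hε4 : ε < 1 / 4 := hεc.trans_le hc4
  have hA : ∀ i, IsStrictLower (adMat X i) := isStrictLower_adMat X hX.ideal
  have hX' := hX.existsUnique_coord
  have hFc := continuous_of_lipNorm_ne_top hA hX' hF
  have hsup : supNorm F ≠ ⊤ := ne_top_of_le_ne_top hF (supNorm_le_lipNorm F)
  obtain ⟨φ, hφ, hφ0, hφs, hφ1, hφb⟩ := hbump m hm ε hε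
  have hφc : HasCompactSupport φ :=
    HasCompactSupport.of_support_subset_isCompact (isCompact_closedBall _ _) hφs
  have hρ : ε / 2 < 1 / 2 := by linarith
  have hconv : ∀ g : G, conv X μ F (descend X φ) (g : G ⧸ Γ) =
      groupConv X φ (fun g => F (g : G ⧸ Γ)) g := conv_descend hA hX μ hφ hρ hφs hFc
  refine ⟨descend X φ, isSmooth_descend hA hX hφ hρ hφs, descend_nonneg hφ0, ?_, ?_, ?_, ?_, ?_⟩
  · have h1 := integral_descend_smul hA hX μ hφ hρ hφs (H := fun _ : G => (1 : ℝ)) continuous_const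
    simpa [hφ1] using h1
  · intro x hx
    obtain ⟨g, rfl, hg⟩ := exists_of_descend_ne_zero hx
    have h1 : ‖coords X g‖ ≤ ε / 2 := mem_closedBall_zero_iff.1 (hφs hg)
    have h2 : ‖coords X g‖ < min ε (1 / 2) := lt_min (by linarith) (by linarith)
    exact ⟨g, h2, rfl⟩
  · exact supNorm_sub_le hX' hF hFc hφ.continuous hφc hφ0 hφ1 hε hφs hconv
  · have h1 := contMDiff_groupConv hA hX' hFc hφ hφc
    refine h1.congr hconv
  · exact sobolevNorm_le hA hX' hQ hrat hFc hsup hm hε (by linarith) hφ hφs hC₀ hφb hconv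
      (hεc.le.trans_eq (by rw [hC₁]))
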